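/- **Setting.** Let $q=2^f$ with $f\ge 1$, let $\mathbb F_q$ be the field with $q$ elements, $\operatorname{Tr}:\mathbb F_q\to\mathbb F_2$ the trace and $\phi(x)=e^{2\pi i\operatorname{Tr}(x)/2}$. Let $G=\mathrm F_4(q)$ be the Chevalley group generated by the root elements $x_\alpha(t)$ ($\alpha\in\Phi$, $t\in\mathbb F_q$), and let $U=\mathrm{UF}_4(q)$ be its Sylow $2$-subgroup generated by the root subgroups $X_n=\{x_n(t)\mid t\in\mathbb F_q\}$, $x_n(t)=x_{\alpha_n}(t)$, of the positive roots $\alpha_1,\dots,\alpha_{24}$. Here $\alpha_1,\alpha_2$ (long) and $\alpha_3,\alpha_4$ (short) are the simple roots, and, in coordinates with respect to them, $\alpha_5=1100$, $\alpha_6=0110$, $\alpha_7=0011$, $\alpha_8=1110$, $\alpha_9=0120$, $\alpha_{10}=0111$, $\alpha_{11}=1120$, $\alpha_{16}=0122$. Put $$\mathcal S=\{\alpha_1,\dots,\alpha_{11},\alpha_{16}\},\qquad \mathcal Z=\{\alpha_8,\alpha_{10},\alpha_{11},\alpha_{16}\},\qquad \mathcal N=\Phi^+\setminus\mathcal S,$$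 let $X_{\mathcal N}$ be the subgroup generated by the root subgroups of the roots in $\mathcal N$, and $X_{\mathcal S}=U/X_{\mathcal N}$. The family $\mathcal F_{7,2}$ is the set of the inflations to $U$ of those $\chi\in\operatorname{Irr}(X_{\mathcal S})$ whose kernel contains none of $X_8,X_{10},X_{11},X_{16}$. For $a=(a_8,a_{10},a_{11},a_{16})\in(\mathbb F_q^\times)^4$ say that $\chi\in\mathcal F_{7,2}$ has label $a$ if $\chi(x_n(t))=\chi(1)\phi(a_nt)$ for all $t\in\mathbb F_q$ and $n\in\{8,10,11,16\}$. Put $$y_5=x_5\!\left(\tfrac{a_{11}}{a_8^2}\right),\quad y_{6,9}=x_6\!\left(\tfrac{a_8a_{16}}{a_{10}^2a_{11}}\right)x_9\!\left(\tfrac{a_8^2a_{16}}{a_{10}^2a_{11}^2}\right),\quad y_7=x_7\!\left(\tfrac{a_{10}}{a_{16}}\right).$$ Let $T_1,\dots,T_8$ be the subsets $\varnothing$, $\{y_{6,9}\}$, $\{y_7\}$, $\{y_5\}$, $\{y_5,y_7\}$, $\{y_5,y_{6,9}\}$, $\{y_{6,9},y_7\}$, $\{y_5,y_{6,9},y_7\}$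 of $\{y_5,y_{6,9},y_7\}$, and let $\mathcal F_{7,2}^i$ be the set of the $\chi\in\mathcal F_{7,2}$ that have some label $a$ for which $\chi(y)=-\chi(1)$ if $y\in T_i$ and $\chi(y)=\chi(1)$ if $y\in\{y_5,y_{6,9},y_7\}\setminus T_i$. **Proposition.** 1. $X_{\mathcal N}$ is normal in $U$, $|X_{\mathcal S}|=q^{12}$, and $\mathcal Z$ is the set of the roots in $\mathcal S$ whose root subgroup is central in $X_{\mathcal S}$. The pair $(\mathcal S,\mathcal Z)$ has the form $[4,12,9]$: $|\mathcal Z|=4$, $|\mathcal S|=12$, and for exactly $9$ pairs $i<j$ of indices of roots in $\mathcal S$ the images of $X_i$ and $X_j$ in $X_{\mathcal S}$ do not commute elementwise. 2. $\mathcal F_{7,2}\subseteq\operatorname{Irr}(U)$ and $\mathcal F_{7,2}=\bigsqcup_{i=1}^8\mathcal F_{7,2}^i$, where $\mathcal F_{7,2}^1$ consists of $8(q-1)^4$ characters of degree $q^4/8$, and each $\mathcal F_{7,2}^i$, $i=2,\dots,8$, consists of $2(q-1)^4$ characters of degree $q^4/4$. 3. Every character in $\mathcal F_{7,2}$ has a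 unique label $a\in(\mathbb F_q^\times)^4$. For every $a$ and every $i\in\{2,\dots,8\}$, exactly two characters in $\mathcal F^i_{7,2}$ have label $a$. The characters in $\mathcal F^1_{7,2}$ with label $a$ are in bijection with the triples $(c_{1,4},c_2,c_3)\in\mathbb F_2^3$: the character that corresponds to a triple is the one that is afforded by an irreducible representation containing a nonzero vector that is fixed by $X_5,X_6,X_7,X_9$, on which $x_n(t)$ acts as $\phi(a_nt)$ for $n\in\{8,10,11,16\}$, and on which $$x_1\!\left(\tfrac{a_{10}^2a_{11}}{a_8^2a_{16}}\right)x_4\!\left(\tfrac{a_{10}a_{11}}{a_8a_{16}}\right),\qquad x_2\!\left(\tfrac{a_{16}}{a_{10}^2}\right),\qquad x_3\!\left(\tfrac{a_8}{a_{11}}\right)$$ act as $(-1)^{c_{1,4}}$, $(-1)^{c_2}$, $(-1)^{c_3}$. 4. The characters in $\mathcal F_{7,2}^1$ confirm, for the cuspidal characters $\mathrm F_4^I[1]$ and $\mathrm F_4^{II}[1]$ of $G$, Malle's conjecture that for every cuspidal $\rho\in\operatorname{Irr}(G)$ there is a $\chi\in\operatorname{Irr}(U)$ with $\chi(1)=\rho(1)_2$,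 the $2$-part of $\rho(1)$: if $\rho\in\operatorname{Irr}(G)$ is cuspidal of degree $$\tfrac18q^4(q-1)^4(q^2+q+1)^2(q^4+1)(q^4-q^2+1)\quad\text{or}\quad\tfrac1{24}q^4(q-1)^4(q^2-q+1)^2(q^4+1)(q^4-q^2+1)$$ (the degrees of $\mathrm F_4^I[1]$ and $\mathrm F_4^{II}[1]$, respectively), then $\rho(1)_2=q^4/8$, and there is a $\chi\in\mathcal F_{7,2}^1$ with $\chi(1)=\rho(1)_2$. -/

import Mathlib

noncomputable section

namespace UF4

/-! ### Irreducible characters -/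

/-- `Irr G`: the ordinary irreducible characters of `G`, as functions `G → ℂ`. -/
def Irr (G : Type*) [Group G] : Set (G → ℂ) :=
  {χ | ∃ (n : ℕ) (ρ : Representation ℂ G (Fin n → ℂ)),
    ρ.IsIrreducible ∧ ∀ g, χ g = ρ.character g}

/-- The additive character `φ(x) = exp (2 π i Tr(x) / 2)` of a finite field `K` of
characteristic `2`, where `Tr` is the trace to the prime field. -/
def phi (K : Type*) [Field K] [CharP K 2] (x : K) : ℂ :=
  letI : Algebra (ZMod 2) K := ZMod.algebra K 2
  ZMod.stdAddChar (Algebra.trace (ZMod 2) K x)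

/-! ### The root system of type `F₄` -/

/-- The positive roots `α₁, …, α₂₄` of type `F₄`, in coordinates with respect to the simple roots
`α₁, α₂` (long) and `α₃, α₄` (short), ordered as usual by height.
(The index is `1`-based; every index other than `1, …, 23` is read as `24`.) -/
def posRoot : ℕ → Fin 4 → ℤ
  | 1 => ![1, 0, 0, 0]
  | 2 => ![0, 1, 0, 0]
  | 3 => ![0, 0, 1, 0]
  | 4 => ![0, 0, 0, 1]
  | 5 => ![1, 1, 0, 0]
  | 6 => ![0, 1, 1, 0]
  | 7 => ![0, 0, 1, 1]
  | 8 => ![1, 1, 1, 0]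
  | 9 => ![0, 1, 2, 0]
  | 10 => ![0, 1, 1, 1]
  | 11 => ![1, 1, 2, 0]
  | 12 => ![1, 1, 1, 1]
  | 13 => ![0, 1, 2, 1]
  | 14 => ![1, 2, 2, 0]
  | 15 => ![1, 1, 2, 1]
  | 16 => ![0, 1, 2, 2]
  | 17 => ![1, 2, 2, 1]
  | 18 => ![1, 1, 2, 2]
  | 19 => ![1, 2, 3, 1]
  | 20 => ![1, 2, 2, 2]
  | 21 => ![1, 2, 3, 2]
  | 22 => ![1, 2, 4, 2]
  | 23 => ![1, 3, 4, 2]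
  | _ => ![2, 3, 4, 2]

/-- The set `Φ` of all `48` roots. -/
def roots : Finset (Fin 4 → ℤ) :=
  (Finset.Icc 1 24).image posRoot ∪ (Finset.Icc 1 24).image fun n => -posRoot n

/-- The type of roots. -/
abbrev Root : Type := {v : Fin 4 → ℤ // v ∈ roots}

theorem posRoot_mem (n : ℕ) : posRoot n ∈ roots := by
  unfold posRoot
  split <;> decide

/-- The positive root `αₙ`. -/
def α (n : ℕ) : Root := ⟨posRoot n, posRoot_mem n⟩

/-- The Gram matrix of the simple roots (long roots have squared length `4`, short roots `2`). -/
def gram : Matrix (Fin 4) (Fin 4) ℤ :=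
  !![4, -2, 0, 0; -2, 4, -2, 0; 0, -2, 2, -1; 0, 0, -1, 2]

/-- The invariant inner product in simple root coordinates. -/
def ip (u v : Fin 4 → ℤ) : ℤ := ∑ i, ∑ j, u i * gram i j * v j

theorem ip_self_pos {r : Fin 4 → ℤ} (hr : r ∈ roots) : 0 < ip r r := by
  revert r
  decide

theorem ip_add_nsmul (s r : Fin 4 → ℤ) (i : ℕ) : ip (s + i • r) r = ip s r + i * ip r r := by
  simp only [ip, Fin.sum_univ_four, Pi.add_apply, Pi.smul_apply]
  simp only [nsmul_eq_mul]
  ring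

theorem ip_neg_self (r : Fin 4 → ℤ) : ip (-r) r = -ip r r := by
  simp only [ip, Fin.sum_univ_four, Pi.neg_apply]
  ring

/-- The largest `p` such that `s, s - r, …, s - p r` are roots (for `s ≠ r`). -/
def below (r s : Fin 4 → ℤ) : ℕ :=
  if s - r ∉ roots then 0 else if s - 2 • r ∉ roots then 1 else 2

/-- The coefficient of the simple coroot `αⱼ^∨` in the coroot `r^∨ = 2 r / (r, r)`. -/
def corootCoeff (r : Fin 4 → ℤ) (j : Fin 4) : ℤ := r j * gram j j / ip r r

/-- The Cartan integer `⟨r, αⱼ^∨⟩ = 2 (r, αⱼ) / (αⱼ, αⱼ)`. -/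
def cartanInt (r : Fin 4 → ℤ) (j : Fin 4) : ℤ := 2 * ip r (Pi.single j 1) / gram j j

/-! ### The Chevalley group of type `F₄` in characteristic `2`, and its subgroup `U` -/

/-- The index set of a Chevalley basis of the `52`-dimensional Lie algebra of type `F₄`:
root vectors `e_s` (`s ∈ Φ`) and `h_j = h_{α_j}` (`1 ≤ j ≤ 4`). -/
abbrev Idx : Type := Root ⊕ Fin 4

/-- The matrix of the root element `x_r(t) = exp (t ad e_r)` in a Chevalley basis, over a field of
characteristic `2` (column `b` holds the image of the basis vector `b`). In general
* `x_r(t) e_s = ∑ᵢ ± (p + i choose i) tⁱ e_{s + i r}` for `s ≠ ± r`, with `p = below r s`,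
* `x_r(t) e_r = e_r` and `x_r(t) e_{-r} = e_{-r} + t h_r - t² e_r`,
* `x_r(t) h_j = h_j - ⟨r, αⱼ^∨⟩ t e_r`;

in characteristic `2` the signs, which depend on the choice of the Chevalley basis, disappear. -/
def rootMatrix {K : Type*} [Field K] (r : Root) (t : K) : Matrix Idx Idx K :=
  Matrix.of fun a b =>
    match a, b with
    | .inl u, .inl s => ∑ i ∈ Finset.range 3,
        if u.1 = s.1 + i • r.1 then ((below r.1 s.1 + i).choose i : K) * t ^ i else 0
    | .inr j, .inl s => if s.1 = -r.1 then (corootCoeff r.1 j : K) * t else 0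
    | .inl u, .inr j => if u.1 = r.1 then (cartanInt r.1 j : K) * t else 0
    | .inr i, .inr j => if i = j then 1 else 0

/-- The grading of the basis by the inner product with `r` (with a minus sign). -/
def grade (r : Root) : Idx → ℤ
  | .inl s => -ip s.1 r.1
  | .inr _ => 0

theorem rootMatrix_blockTriangular {K : Type*} [Field K] (r : Root) (t : K) :
    (rootMatrix r t).BlockTriangular (grade r) := by
  have hr := ip_self_pos r.2
  rintro (u | i) (s | j) h
  · simp only [grade] at h
    simp only [rootMatrix, Matrix.of_apply]
    refine Finset.sum_eq_zero fun i _ => if_neg fun e => ?_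
    rw [e, ip_add_nsmul] at h
    have : 0 ≤ (i : ℤ) * ip r.1 r.1 := by positivity
    linarith
  · simp only [grade] at h
    simp only [rootMatrix, Matrix.of_apply]
    refine if_neg fun e => ?_
    rw [e] at h
    linarith
  · simp only [grade] at h
    simp only [rootMatrix, Matrix.of_apply]
    refine if_neg fun e => ?_
    rw [e, ip_neg_self] at h
    linarith
  · simp [grade] at h

theorem rootMatrix_eq_one {K : Type*} [Field K] (r : Root) (t : K) (a b : Idx)
    (h : grade r a = grade r b) : rootMatrix r t a b = (1 : Matrix Idx Idx K) a b := by
  have hr := ip_self_pos r.2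
  rcases a with u | i <;> rcases b with s | j
  · simp only [grade] at h
    simp only [rootMatrix, Matrix.of_apply]
    rw [Finset.sum_eq_single 0]
    · rw [zero_nsmul, add_zero, add_zero, Nat.choose_zero_right, Nat.cast_one, pow_zero, mul_one,
        Matrix.one_apply]
      by_cases e : u = s
      · rw [if_pos (congrArg Subtype.val e), if_pos (congrArg Sum.inl e)]
      · rw [if_neg fun h => e (Subtype.ext h), if_neg fun h => e (Sum.inl_injective h)]
    · intro i _ hi
      refine if_neg fun e => ?_
      rw [e, ip_add_nsmul] at h
      have : 0 < (i : ℤ) * ip r.1 r.1 := by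
        have : 0 < (i : ℤ) := by omega
        positivity
      linarith
    · simp
  · simp only [grade] at h
    simp only [rootMatrix, Matrix.of_apply]
    rw [if_neg, Matrix.one_apply_ne (by simp)]
    intro e
    rw [e] at h
    linarith
  · simp only [grade] at h
    simp only [rootMatrix, Matrix.of_apply]
    rw [if_neg, Matrix.one_apply_ne (by simp)]
    intro e
    rw [e, ip_neg_self] at h
    linarith
  · simp [rootMatrix, Matrix.one_apply]

theorem rootMatrix_det {K : Type*} [Field K] (r : Root) (t : K) : (rootMatrix r t).det = 1 := by
  rw [(rootMatrix_blockTriangular r t).det]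
  refine Finset.prod_eq_one fun k _ => ?_
  have : (rootMatrix r t).toSquareBlock (grade r) k = 1 := by
    ext a b
    rw [Matrix.toSquareBlock_def, Matrix.of_apply,
      rootMatrix_eq_one r t a.1 b.1 (a.2.trans b.2.symm)]
    simp [Matrix.one_apply, Subtype.ext_iff]
  rw [this, Matrix.det_one]

/-- The root element `x_r(t)`, as an invertible matrix. -/
def rootElt {K : Type*} [Field K] (r : Root) (t : K) : Matrix.GeneralLinearGroup Idx K :=
  Matrix.GeneralLinearGroup.mkOfDetNeZero (rootMatrix r t) (by simp [rootMatrix_det])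

/-- The Chevalley group `F₄(K)` (`K` of characteristic `2`): the group generated by all root
elements in the adjoint representation. -/
def F4 (K : Type*) [Field K] : Subgroup (Matrix.GeneralLinearGroup Idx K) :=
  Subgroup.closure {g | ∃ (r : Root) (t : K), g = rootElt r t}

/-- `U = UF₄(K)`: the subgroup generated by the root subgroups of the positive roots. It is a Sylow
`2`-subgroup of `F₄(K)` when `K` is finite of characteristic `2`. -/
def U (K : Type*) [Field K] : Subgroup (Matrix.GeneralLinearGroup Idx K) :=
  Subgroup.closure {g | ∃ (n : ℕ) (t : K), g = rootElt (α n) t}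

/-- The root element `x_r(t)` of `F₄(K)`. -/
def xG {K : Type*} [Field K] (r : Root) (t : K) : F4 K :=
  ⟨rootElt r t, Subgroup.subset_closure ⟨r, t, rfl⟩⟩

/-- The root element `xₙ(t) = x_{αₙ}(t)` of `U`. -/
def x {K : Type*} [Field K] (n : ℕ) (t : K) : U K :=
  ⟨rootElt (α n) t, Subgroup.subset_closure ⟨n, t, rfl⟩⟩

/-! ### Pattern and quattern groups -/

/-- `X_P`, for a set `P` of (indices of) positive roots: the subgroup of `U` generated by the root
subgroups `Xₙ`, `n ∈ P`. -/
def X (K : Type*) [Field K] (P : Finset ℕ) : Subgroup (U K) :=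
  Subgroup.closure {g | ∃ n ∈ P, ∃ t : K, g = x n t}

/-- The quattern group `X_S = U / X_N` for `S = Φ⁺ \ N`. (The normal closure of `X_N` is `X_N` when
`X_N` is normal in `U`, the only case that is used.) -/
abbrev Quattern (K : Type*) [Field K] (S : Finset ℕ) : Type _ :=
  U K ⧸ Subgroup.normalClosure (X K (Finset.Icc 1 24 \ S) : Set (U K))

/-- The image of `xₙ(t)` in `X_S`. -/
def xbar {K : Type*} [Field K] (S : Finset ℕ) (n : ℕ) (t : K) : Quattern K S :=
  QuotientGroup.mk (x n t)

/-- `𝒵(X_S)`: the roots in `S` whose root subgroup is central in `X_S`. -/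
def centralRoots (K : Type*) [Field K] (S : Finset ℕ) : Set ℕ :=
  {n | n ∈ S ∧ ∀ t : K, xbar S n t ∈ Subgroup.center (Quattern K S)}

/-- The pairs `(i, j)`, `i < j`, in `S` with `[x_i(s), x_j(t)] ≠ 1` in `X_S` for some `s, t`. -/
def nontrivialPairs (K : Type*) [Field K] (S : Finset ℕ) : Set (ℕ × ℕ) :=
  {p | p.1 ∈ S ∧ p.2 ∈ S ∧ p.1 < p.2 ∧ ∃ s t : K, ¬Commute (xbar S p.1 s) (xbar S p.2 t)}

/-- `Irr(X_S)_Z`: the irreducible characters of `X_S` whose kernel contains no root subgroup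
`X_γ`, `γ ∈ Z`. -/
def IrrQuattern (K : Type*) [Field K] (S Z : Finset ℕ) : Set (Quattern K S → ℂ) :=
  {χ | χ ∈ Irr (Quattern K S) ∧ ∀ n ∈ Z, ∃ t : K, χ (xbar S n t) ≠ χ 1}

/-! ### The family `F_{7,2}` -/

/-- The set `S` of the core. -/
def coreS : Finset ℕ := {1, 2, 3, 4, 5, 6, 7, 8, 9, 10, 11, 16}

/-- The set `Z` of the core. -/
def coreZ : Finset ℕ := {8, 10, 11, 16}

/-- The family `F_{7,2}` of characters of `U`: the inflations to `U` of the elements of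
`Irr(X_S)_Z`. -/
def F72 (K : Type*) [Field K] : Set (U K → ℂ) :=
  (fun (χ : Quattern K coreS → ℂ) (u : U K) => χ (QuotientGroup.mk u)) '' IrrQuattern K coreS coreZ

/-- The labels `a₈, a₁₀, a₁₁, a₁₆ ∈ K^×`. -/
structure ALabel (K : Type*) [Field K] where
  a8 : Kˣ
  a10 : Kˣ
  a11 : Kˣ
  a16 : Kˣ

/-- The label attached to the root `αₙ`, `n ∈ Z`. -/
def ALabel.coeff {K : Type*} [Field K] (a : ALabel K) : ℕ → K
  | 8 => a.a8
  | 10 => a.a10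
  | 11 => a.a11
  | 16 => a.a16
  | _ => 0

/-- The character `χ` lies above the linear character `x_γ(t) ↦ φ(a_γ t)`, `γ ∈ Z`, of `X_Z`. -/
def HasALabel {K : Type*} [Field K] [CharP K 2] (χ : U K → ℂ) (a : ALabel K) : Prop :=
  ∀ n ∈ coreZ, ∀ t : K, χ (x n t) = χ 1 * phi K (a.coeff n * t)

/-- The generator `x₅(a₁₁/a₈²)` of the subgroup `Y'₂` of `Y' = Y'₁ Y'₂ Y'₃`. -/
def y5 {K : Type*} [Field K] (a : ALabel K) : U K := x 5 ((a.a11 : K) / (a.a8 : K) ^ 2)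

/-- The generator of the subgroup `Y'₃ ⊆ X₆ X₉`: the element `x₆(c) x₉(a₈ c / a₁₁)` with
`c = a₈ a₁₆ / (a₁₀² a₁₁)`. -/
def y69 {K : Type*} [Field K] (a : ALabel K) : U K :=
  x 6 ((a.a8 : K) * a.a16 / ((a.a10 : K) ^ 2 * a.a11)) *
    x 9 ((a.a8 : K) ^ 2 * a.a16 / ((a.a10 : K) ^ 2 * (a.a11 : K) ^ 2))

/-- The generator `x₇(a₁₀/a₁₆)` of the subgroup `Y'₁`. -/
def y7 {K : Type*} [Field K] (a : ALabel K) : U K := x 7 ((a.a10 : K) / a.a16)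

/-- The sign `(-1)^b`. -/
def sgn (b : Bool) : ℂ := if b then -1 else 1

/-- The labels `e₅, e_{6,9}, e₇` that occur in the `i`-th subfamily, `i = 1, …, 8`
(here numbered `0, …, 7`). -/
def eLabel : Fin 8 → Bool × Bool × Bool :=
  ![(false, false, false),
    (false, true, false),
    (false, false, true),
    (true, false, false),
    (true, false, true),
    (true, true, false),
    (false, true, true),
    (true, true, true)]

/-- The characters in `F_{7,2}` over the label `a` on which the three generators of `Y'` act as the
signs prescribed by the `e`-labels of the `i`-th subfamily. -/
def F72At (K : Type*) [Field K] [CharP K 2] (i : Fin 8) (a : ALabel K) : Set (U K → ℂ) :=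
  {χ | χ ∈ F72 K ∧ HasALabel χ a ∧
    χ (y5 a) = sgn (eLabel i).1 * χ 1 ∧
    χ (y69 a) = sgn (eLabel i).2.1 * χ 1 ∧
    χ (y7 a) = sgn (eLabel i).2.2 * χ 1}

/-- The subfamily `F_{7,2}^{i+1}`, `i = 0, …, 7`. -/
def F72Sub (K : Type*) [Field K] [CharP K 2] (i : Fin 8) : Set (U K → ℂ) :=
  ⋃ a : ALabel K, F72At K i a

/-- `χ` has the labels `c_{1,4}, c₂, c₃` over `a`: in a representation affording `χ` there is a
nonzero vector which is fixed by `X₅, X₆, X₇, X₉`, on which `X_Z` acts by the linear character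
given by `a`, and on which the three generators `x₁(c) x₄(a₈ c / a₁₀)`
(with `c = a₁₀² a₁₁ / (a₈² a₁₆)`), `x₂(a₁₆/a₁₀²)`, `x₃(a₈/a₁₁)` of `X'` act by the signs
`(-1)^{c_{1,4}}, (-1)^{c₂}, (-1)^{c₃}`. Equivalently, `χ` is a constituent of the character induced
from the corresponding linear character of `X' Y Z`. -/
def HasCLabel {K : Type*} [Field K] [CharP K 2] (χ : U K → ℂ) (a : ALabel K)
    (c : Bool × Bool × Bool) : Prop :=
  ∃ (n : ℕ) (ρ : Representation ℂ (U K) (Fin n → ℂ)),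
    ρ.IsIrreducible ∧ (∀ g, χ g = ρ.character g) ∧
    ∃ v : Fin n → ℂ, v ≠ 0 ∧
      (∀ m ∈ ({5, 6, 7, 9} : Finset ℕ), ∀ t : K, ρ (x m t) v = v) ∧
      (∀ m ∈ coreZ, ∀ t : K, ρ (x m t) v = phi K (a.coeff m * t) • v) ∧
      ρ (x 1 ((a.a10 : K) ^ 2 * a.a11 / ((a.a8 : K) ^ 2 * a.a16)) *
        x 4 ((a.a10 : K) * a.a11 / ((a.a8 : K) * a.a16))) v = sgn c.1 • v ∧
      ρ (x 2 ((a.a16 : K) / (a.a10 : K) ^ 2)) v = sgn c.2.1 • v ∧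
      ρ (x 3 ((a.a8 : K) / a.a11)) v = sgn c.2.2 • v

/-! ### The cuspidal characters `F₄^I[1]` and `F₄^II[1]` -/

/-- The unipotent radical of the standard maximal parabolic subgroup of `F₄(K)` belonging to the
simple root `α_{i+1}`: it is generated by the `X_r`, `r` a positive root in which that simple root
occurs. -/
def unipRadical (K : Type*) [Field K] (i : Fin 4) : Subgroup (F4 K) :=
  Subgroup.closure {g | ∃ (n : ℕ) (t : K), 0 < posRoot n i ∧ g = xG (α n) t}

/-- A character of `F₄(K)` is cuspidal if the trivial character is not a constituent of its
restriction to the unipotent radical of a proper standard parabolic subgroup (it suffices to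
consider the maximal ones). -/
def IsCuspidal {K : Type*} [Field K] (ψ : F4 K → ℂ) : Prop :=
  ∀ i : Fin 4, ∑ᶠ u : unipRadical K i, ψ u = 0

/-- The cuspidal irreducible character `F₄^I[1]` of `F₄(q)`, identified by its degree
`q⁴ Φ₁(q)⁴ Φ₃(q)² Φ₈(q) Φ₁₂(q) / 8`. -/
def IsF4I {K : Type*} [Field K] (ψ : F4 K → ℂ) : Prop :=
  ψ ∈ Irr (F4 K) ∧ IsCuspidal ψ ∧
    ψ 1 = (Nat.card K : ℂ) ^ 4 * ((Nat.card K : ℂ) - 1) ^ 4 *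
      ((Nat.card K : ℂ) ^ 2 + Nat.card K + 1) ^ 2 * ((Nat.card K : ℂ) ^ 4 + 1) *
      ((Nat.card K : ℂ) ^ 4 - (Nat.card K : ℂ) ^ 2 + 1) / 8

/-- The cuspidal irreducible character `F₄^II[1]` of `F₄(q)`, identified by its degree
`q⁴ Φ₁(q)⁴ Φ₆(q)² Φ₈(q) Φ₁₂(q) / 24`. -/
def IsF4II {K : Type*} [Field K] (ψ : F4 K → ℂ) : Prop :=
  ψ ∈ Irr (F4 K) ∧ IsCuspidal ψ ∧
    ψ 1 = (Nat.card K : ℂ) ^ 4 * ((Nat.card K : ℂ) - 1) ^ 4 *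
      ((Nat.card K : ℂ) ^ 2 - Nat.card K + 1) ^ 2 * ((Nat.card K : ℂ) ^ 4 + 1) *
      ((Nat.card K : ℂ) ^ 4 - (Nat.card K : ℂ) ^ 2 + 1) / 24

end UF4

end

/-!
The proof is Clifford theory for the elementary abelian normal subgroup `A` of order `q⁸` of `X_S`
that is generated by the root subgroups of the eight non-simple roots in `S`. The quotient
`X_S / A` is elementary abelian of order `q⁴`, and both parts have explicit coordinates.

*Structure of `X_S`.* Chevalley's commutator formula in characteristic `2` is an identity between
`52 × 52` matrices whose entries are polynomials in two parameters over the field with two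
elements. It is verified by a computation in a model in which basis vectors are integer codes
(`wordElt_eq_of_wordsAgree`, `x_mul_x_comm`). That no root element of `S` is lost in the quotient
follows from coordinate functions: certain matrix entries are additive on `U`, or on the subgroup
generated by the non-simple root elements, and vanish on `X_N` (`coord_mul`, `aElt_eq_one`). This
gives the order of `X_S`, its central root subgroups and the nine pairs that do not commute.

*Weights.* A linear character of `A` is a weight `(bₙ)`, with `xₙ(t)` acting as `φ(bₙ t)`, and
every representation contains a weight vector. An irreducible representation belongs to the family
when `b₈`, `b₁₀`, `b₁₁`, `b₁₆` are not zero; these form the label `a`. Translating a weight vector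
by an element with simple coordinates `s = (s₀, s₁, s₂, s₃)` changes the other weights by
expressions such as `b₈ s₂ + b₁₁ s₂²` (`IsWeightVector.apply_pElt`), in such a way that the
arguments of `φ` at `y₅`, `y_{6,9}` and `y₇` change by elements of the form `z + z²`. By the
additive form of Hilbert's Theorem 90, two weights with the same label are conjugate if and only if
they give the same values of `φ` at these three elements (`hasLabels_of_isWeightVector`,
`IsWeightVector.exists_translate`). So the orbits of weights correspond to a label and three signs
`e`.

*Inertia groups.* The stabilizer of a weight is generated by `A` and three involutions
`p₁ ∈ X₁ X₄`, `p₂ ∈ X₂`, `p₃ ∈ X₃`, the nonzero solutions of the quadratic equations `z + z² = 0`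
(`IsWeightVector.exists_eq_pProd_mul_aElt`). Their commutators are `y₅`, `y_{6,9}` and `y₇`, which
act by the signs `e`. On the vectors of the given weight, the products of the involutions therefore
commute up to the signs given by an alternating form on `𝔽₂³` with coefficients `e`
(`HasLabels.signCommute`). For a maximal isotropic subspace of this form, the subgroup
`inertia a e` is normal, and it acts by scalars on a suitable weight vector, whose translates are
distinguished by these scalars (`IsGood.exists_isStableVector`). Hence the degree is the index of
`inertia a e`, and the character is determined by the scalars (`IsStableVector.finrank_eq_index`,
`IsStableVector.character_congr`).

*Counting.* If all signs are trivial, the form is zero, the isotropic subspace is `𝔽₂³`, the degree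
is `q⁴/8`, and the signs by which `p₁`, `p₂`, `p₃` act are arbitrary: eight characters. Otherwise
the form has rank two, the maximal isotropic subspaces are planes, the degree is `q⁴/4`, and only
the scalar by which the one-dimensional radical acts is an invariant, with two possible values: two
characters (`ncard_labelChars`). In both cases all values are reached by twisting with linear
characters of `X_S / A`.

For the cuspidal characters only the `2`-part of the given degrees has to be computed, and all
factors other than `q⁴/8` are odd, up to the factor `1/3` in the second case.
-/

noncomputable section

namespace UF4

/-! ### A computable model of the root elements -/

/-- The linear form by which roots are encoded as integers. It separates the vectors `u` and
`s + k r` with roots `u`, `s`, `r` and `|k| ≤ 2`, so that root strings can be followed on the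
encodings. -/
def lin (v : Fin 4 → ℤ) : ℤ := v 0 + 10 * v 1 + 150 * v 2 + 3000 * v 3

/-- The code of a basis vector: `j` for `h_j`, and a shifted value of `lin` for a root vector. -/
def code : Idx → ℕ
  | .inl s => (lin s.1 + 30000).toNat
  | .inr j => j

/-- The value of `lin` at the positive root `αₙ`. -/
def rootCode : ℕ → ℕ
  | 1 => 1 | 2 => 10 | 3 => 150 | 4 => 3000 | 5 => 11 | 6 => 160 | 7 => 3150 | 8 => 161
  | 9 => 310 | 10 => 3160 | 11 => 311 | 12 => 3161 | 13 => 3310 | 14 => 321 | 15 => 3311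
  | 16 => 6310 | 17 => 3321 | 18 => 6311 | 19 => 3471 | 20 => 6321 | 21 => 6471 | 22 => 6621
  | 23 => 6631 | _ => 6632

/-- The codes of the `48` root vectors. -/
def rootCodes : List ℕ :=
  (List.range 24).map (fun n => 30000 + rootCode (n + 1)) ++
    (List.range 24).map (fun n => 30000 - rootCode (n + 1))

/-- The codes of all `52` basis vectors. -/
def codes : List ℕ := List.range 4 ++ rootCodes

/-- The bit mask of a list of natural numbers; with it a membership test becomes a single bit
operation, which the kernel carries out on binary numbers. -/
def mask (l : List ℕ) : ℕ := l.foldr (fun c m => 2 ^ c ||| m) 0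

theorem testBit_mask (l : List ℕ) (c : ℕ) : (mask l).testBit c = true ↔ c ∈ l := by
  induction l with
  | nil => simp [mask]
  | cons d l ih =>
    have : mask (d :: l) = 2 ^ d ||| mask l := rfl
    rw [this, Nat.testBit_or, Bool.or_eq_true, ih, Nat.testBit_two_pow, List.mem_cons,
      decide_eq_true_iff, eq_comm]

/-- Membership of a code in the list of codes of roots, as a bit test. -/
def isRoot (c : ℕ) : Bool := Nat.beq (Nat.land 1 (Nat.shiftRight (mask rootCodes) c)) 1

/-- `force n f` is `f n`; in the kernel `n` is evaluated before it is passed on to `f`, so that it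
is not evaluated once for each of its occurrences in `f n`. -/
def force {A : Type} (n : ℕ) (f : ℕ → A) : A :=
  Nat.rec (motive := fun _ => A) (f 0) (fun k _ => f (Nat.succ k)) n

theorem force_eq {A : Type} (n : ℕ) (f : ℕ → A) : force n f = f n := by
  cases n <;> rfl

/-- The indices `j` for which the coefficient of `αⱼ^∨` in `αₙ^∨` is odd. -/
def corootOdd (n : ℕ) : List ℕ :=
  ((List.finRange 4).filter fun j => corootCoeff (posRoot n) j % 2 = 1).map Fin.val

/-- Whether the Cartan integer `⟨αₙ, αⱼ^∨⟩` is odd. -/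
def cartanOdd (n : ℕ) (j : ℕ) : Bool := cartanInt (posRoot n) (Fin.ofNat 4 j) % 2 = 1

/-- The column of `xₙ(t)` in characteristic `2` that belongs to the basis vector with code `c`:
a pair `(d, k)` stands for the multiple `tᵏ` of the basis vector with code `d`. -/
def column (n c' : ℕ) : List (ℕ × ℕ) :=
  force c' fun c => force (rootCode n) fun r =>
  bif Nat.ble c 3 then (c, 0) :: (bif cartanOdd n c then [(Nat.add 30000 r, 1)] else [])
  else bif isRoot c then
    (c, 0) ::
      ((bif isRoot (Nat.add c r) &&
          !(isRoot (Nat.sub c r) && !isRoot (Nat.sub c (Nat.mul 2 r)))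
        then [(Nat.add c r, 1)] else []) ++
      ((bif isRoot (Nat.add c (Nat.mul 2 r)) &&
          !(isRoot (Nat.sub c r) && isRoot (Nat.sub c (Nat.mul 2 r)))
        then [(Nat.add c (Nat.mul 2 r), 2)] else []) ++
      (bif Nat.beq (Nat.add c r) 30000 then (corootOdd n).map (·, 1) else [])))
  else []

/-- A letter `(n, p, q)` stands for the root element `xₙ(sᵖ t^q)`, and a term `(c, i, j)` for the
multiple `sⁱ tʲ` of the basis vector with code `c`. -/
def applyLetter (x : ℕ × ℕ × ℕ) (l : List (ℕ × ℕ × ℕ)) : List (ℕ × ℕ × ℕ) :=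
  l.flatMap fun y => force y.2.1 fun i => force y.2.2 fun j => (column x.1 y.1).map fun z =>
    force z.1 fun d => force z.2 fun k =>
    force (Nat.add i (Nat.mul k x.2.1)) fun i' => force (Nat.add j (Nat.mul k x.2.2)) fun j' =>
    (d, i', j')

/-- The image of the basis vector with code `c` under a word in root elements. -/
def applyWord (w : List (ℕ × ℕ × ℕ)) (c : ℕ) : List (ℕ × ℕ × ℕ) :=
  w.foldr applyLetter [(c, 0, 0)]

/-- Adding a term to a list of terms, with cancellation modulo `2`. -/
def toggle (y : ℕ × ℕ × ℕ) (l : List (ℕ × ℕ × ℕ)) : List (ℕ × ℕ × ℕ) :=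
  if y ∈ l then l.erase y else y :: l

/-- Whether a sum of terms vanishes modulo `2`. -/
def cancels (l : List (ℕ × ℕ × ℕ)) : Bool := (l.foldr toggle []).isEmpty

/-- Whether two words in root elements are equal modulo `2`. -/
def wordsAgree (w w' : List (ℕ × ℕ × ℕ)) : Bool :=
  codes.all fun c => cancels (applyWord w c ++ applyWord w' c)

/-! ### Correctness of the model -/

theorem posRoot_bounds : ∀ v ∈ roots, (-2 ≤ v 0 ∧ v 0 ≤ 2) ∧ (-3 ≤ v 1 ∧ v 1 ≤ 3) ∧
    (-4 ≤ v 2 ∧ v 2 ≤ 4) ∧ (-2 ≤ v 3 ∧ v 3 ≤ 2) := by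
  decide

theorem digits_eq_zero {a b c d : ℤ} (ha : -8 ≤ a ∧ a ≤ 8) (hb : -12 ≤ b ∧ b ≤ 12)
    (hc : -16 ≤ c ∧ c ≤ 16) (h : a + 10 * b + 150 * c + 3000 * d = 0) :
    a = 0 ∧ b = 0 ∧ c = 0 ∧ d = 0 := by
  have hd : d = 0 := by omega
  subst hd
  have hc : c = 0 := by omega
  subst hc
  omega

theorem lin_add_smul_injective {u s r : Fin 4 → ℤ} (hu : u ∈ roots) (hs : s ∈ roots)
    (hr : r ∈ roots) {k : ℤ} (hk : -2 ≤ k) (hk' : k ≤ 2) (h : lin u = lin s + k * lin r) :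
    u = s + k • r := by
  have h1 := posRoot_bounds u hu
  have h2 := posRoot_bounds s hs
  have h3 := posRoot_bounds r hr
  unfold lin at h
  obtain ⟨h0, h1, h2, h3⟩ := digits_eq_zero (a := u 0 - s 0 - k * r 0) (b := u 1 - s 1 - k * r 1)
    (c := u 2 - s 2 - k * r 2) (d := u 3 - s 3 - k * r 3)
    (by interval_cases k <;> omega) (by interval_cases k <;> omega)
    (by interval_cases k <;> omega) (by linear_combination h)
  have key : ∀ i, u i = s i + k * r i := by
    rw [Fin.forall_fin_succ, Fin.forall_fin_succ, Fin.forall_fin_succ, Fin.forall_fin_one]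
    exact ⟨by linarith, by linarith!, by linarith!, by linarith!⟩
  ext i
  simp [key i]

theorem lin_add_smul (s r : Fin 4 → ℤ) (k : ℤ) : lin (s + k • r) = lin s + k * lin r := by
  simp only [lin, Pi.add_apply, Pi.smul_apply, smul_eq_mul]; ring

theorem lin_bounds {v : Fin 4 → ℤ} (hv : v ∈ roots) : -7000 ≤ lin v ∧ lin v ≤ 7000 := by
  have := posRoot_bounds v hv
  unfold lin; omega

theorem lin_posRoot (n : ℕ) : lin (posRoot n) = rootCode n := by
  unfold posRoot rootCode
  split <;> simp [lin]

theorem mem_rootCodes (c : ℕ) : c ∈ rootCodes ↔ ∃ u : Root, code (.inl u) = c := by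
  have hb (n : ℕ) : rootCode n ≤ 7000 := by
    have := lin_bounds (posRoot_mem n)
    rw [lin_posRoot] at this
    omega
  have hneg (v : Fin 4 → ℤ) : lin (-v) = -lin v := by simp [lin]; ring
  simp only [rootCodes, List.mem_append, List.mem_map, List.mem_range, Subtype.exists, code]
  constructor
  · rintro (⟨n, hn, rfl⟩ | ⟨n, hn, rfl⟩)
    · refine ⟨posRoot (n + 1), posRoot_mem _, ?_⟩
      rw [lin_posRoot]; omega
    · refine ⟨-posRoot (n + 1), ?_, ?_⟩
      · exact Finset.mem_union_right _ (Finset.mem_image.2 ⟨n + 1, by simp; omega, rfl⟩)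
      · have := hb (n + 1)
        rw [hneg, lin_posRoot]; omega
  · rintro ⟨v, hv, rfl⟩
    rcases Finset.mem_union.1 hv with h | h <;> obtain ⟨n, hn, rfl⟩ := Finset.mem_image.1 h <;>
      rw [Finset.mem_Icc] at hn
    · refine Or.inl ⟨n - 1, by omega, ?_⟩
      rw [lin_posRoot, show n - 1 + 1 = n by omega]; omega
    · refine Or.inr ⟨n - 1, by omega, ?_⟩
      have := hb n
      rw [hneg, lin_posRoot, show n - 1 + 1 = n by omega]; omega

theorem isRoot_iff (c : ℕ) : isRoot c = true ↔ ∃ u : Root, code (.inl u) = c := by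
  rw [← mem_rootCodes, ← testBit_mask, Nat.testBit]
  change Nat.beq (1 &&& (mask rootCodes >>> c)) 1 = true ↔ _
  rw [Nat.beq_eq]
  have : 1 &&& (mask rootCodes >>> c) = (mask rootCodes >>> c) % 2 := by
    rw [Nat.and_comm, Nat.and_one_is_mod]
  rw [this]
  simp

theorem code_inl (s : Root) : (code (.inl s) : ℤ) = lin s.1 + 30000 := by
  have := lin_bounds s.2
  simp only [code]; omega

theorem code_injective : Function.Injective code := by
  rintro (s | i) (u | j) h
  · have h1 := code_inl s
    have h2 := code_inl u
    have : s.1 = u.1 + (0 : ℤ) • u.1 :=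
      lin_add_smul_injective s.2 u.2 u.2 (by norm_num) (by norm_num) (by omega)
    rw [zero_smul, add_zero] at this
    rw [Subtype.ext this]
  · have h1 := code_inl s
    have h2 := lin_bounds s.2
    have : code (.inr j) = j := rfl
    omega
  · have h1 := code_inl u
    have h2 := lin_bounds u.2
    have : code (.inr i) = i := rfl
    omega
  · exact congrArg _ (Fin.ext h)

theorem code_mem_codes (b : Idx) : code b ∈ codes := by
  rcases b with s | j
  · exact List.mem_append_right _ ((mem_rootCodes _).2 ⟨s, rfl⟩)
  · exact List.mem_append_left _ (List.mem_range.2 j.2)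

theorem isRoot_add_smul (s r : Root) (c : ℕ) (k : ℤ) (hk : -2 ≤ k) (hk' : k ≤ 2)
    (hc : (c : ℤ) = code (.inl s) + k * lin r.1) : isRoot c = true ↔ s.1 + k • r.1 ∈ roots := by
  rw [isRoot_iff]
  rw [code_inl] at hc
  constructor
  · rintro ⟨u, hu⟩
    have h1 := code_inl u
    rw [← lin_add_smul_injective u.2 s.2 r.2 hk hk' (by rw [hu] at h1; linarith)]
    exact u.2
  · intro h
    refine ⟨⟨_, h⟩, ?_⟩
    have h1 := code_inl ⟨_, h⟩
    rw [lin_add_smul] at h1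
    have : ((code (.inl ⟨_, h⟩) : ℕ) : ℤ) = c := by rw [h1]; linarith
    exact_mod_cast this

section Field

variable {K : Type*} [Field K]

/-- The basis vector with code `c`; it is `0` if `c` is not a code. -/
def basisVec (K : Type*) [Field K] (c : ℕ) : Idx → K := fun a => if code a = c then 1 else 0

theorem basisVec_code (b : Idx) : basisVec K (code b) = Pi.single b 1 := by
  ext a
  simp only [basisVec, Pi.single_apply, code_injective.eq_iff]

theorem int_cast_of_charTwo [CharP K 2] (z : ℤ) : (z : K) = if z % 2 = 1 then 1 else 0 := by
  have h2 : (2 : K) = 0 := CharTwo.two_eq_zero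
  rcases Int.emod_two_eq_zero_or_one z with h | h <;> rw [h]
  · obtain ⟨k, rfl⟩ := Int.dvd_of_emod_eq_zero h
    push_cast; simp [h2]
  · obtain ⟨k, rfl⟩ : ∃ k, z = 2 * k + 1 := ⟨z / 2, by omega⟩
    push_cast; simp [h2]

theorem basisVec_inl_of_lt {c : ℕ} (hc : c < 4) (u : Root) : basisVec K c (.inl u) = 0 := by
  have h1 := code_inl u
  have h2 := lin_bounds u.2
  exact if_neg (by omega)

theorem basisVec_val (i j : Fin 4) : basisVec K i (.inr j) = if j = i then 1 else 0 := by
  by_cases h : j = i <;> simp [basisVec, code, h, ← Fin.ext_iff]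

/-- In characteristic `2` the structure constants are determined by two bits of information about
the root string, because `below r s ≤ 2`. -/
theorem below_choose_one [CharP K 2] (r s : Fin 4 → ℤ) :
    ((below r s + 1).choose 1 : K) = if s - r ∈ roots ∧ s - 2 • r ∉ roots then 0 else 1 := by
  have h2 : (2 : K) = 0 := CharTwo.two_eq_zero
  have h3 : (3 : K) = 1 := by linear_combination h2
  unfold below
  by_cases h5 : s - r ∈ roots <;> by_cases h6 : s - 2 • r ∈ roots <;>
    simp only [h5, h6, not_true, not_false_iff, if_true, if_false, and_true, and_false] <;>
    norm_num [Nat.choose] <;> assumption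

theorem below_choose_two [CharP K 2] (r s : Fin 4 → ℤ) :
    ((below r s + 2).choose 2 : K) = if s - r ∈ roots ∧ s - 2 • r ∈ roots then 0 else 1 := by
  have h2 : (2 : K) = 0 := CharTwo.two_eq_zero
  have h3 : (3 : K) = 1 := by linear_combination h2
  have h6' : (6 : K) = 0 := by linear_combination 3 * h2
  unfold below
  by_cases h5 : s - r ∈ roots <;> by_cases h6 : s - 2 • r ∈ roots <;>
    simp only [h5, h6, not_true, not_false_iff, if_true, if_false, and_true, and_false] <;>
    norm_num [Nat.choose] <;> assumption

theorem sum_map_cond (b : Bool) (f : ℕ × ℕ → Idx → K) (z : ℕ × ℕ) (a : Idx) :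
    (List.map f (bif b then [z] else [])).sum a = if b = true then f z a else 0 := by
  cases b <;> simp

theorem sum_map_corootOdd (n : ℕ) (t : K) (a : Idx) :
    (List.map (fun p => t ^ p.2 • basisVec K p.1) ((corootOdd n).map (·, 1))).sum a =
      match a with
      | .inl _ => 0
      | .inr j => if corootCoeff (posRoot n) j % 2 = 1 then t else 0 := by
  have key (P : Fin 4 → Bool) : (List.map (fun p => t ^ p.2 • basisVec K p.1)
      ((((List.finRange 4).filter P).map Fin.val).map (·, 1))).sum =
        ∑ i : Fin 4, if P i then t • basisVec K i else 0 := by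
    rw [Fin.sum_univ_def]
    induction List.finRange 4 with
    | nil => rfl
    | cons i l ih => cases h : P i <;> simp_all
  rw [corootOdd, key, Finset.sum_apply]
  rcases a with u | j
  · refine Finset.sum_eq_zero fun i _ => ?_
    split_ifs <;> simp [basisVec_inl_of_lt i.2]
  · rw [Finset.sum_eq_single j]
    · by_cases h : corootCoeff (posRoot n) j % 2 = 1 <;> simp [h, basisVec_val]
    · intro i _ hi
      split_ifs <;> simp [basisVec_val, hi.symm]
    · simp

/-- The columns of `xₙ(t)` are given by `column`. -/
theorem rootMatrix_mulVec [CharP K 2] (n : ℕ) (t : K) (c : ℕ) :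
    (rootMatrix (α n) t).mulVec (basisVec K c) =
      ((column n c).map fun p => t ^ p.2 • basisVec K p.1).sum := by
  have h2 : (2 : K) = 0 := CharTwo.two_eq_zero
  have hα : lin (α n).1 = rootCode n := lin_posRoot n
  have hr := lin_bounds (α n).2
  by_cases hc : ∃ b, code b = c
  swap
  · have h0 : basisVec K c = 0 := by
      ext a; simp only [basisVec, Pi.zero_apply, ite_eq_right_iff]
      exact fun h => absurd ⟨a, h⟩ hc
    have h3 : Nat.ble c 3 = false := by
      rw [Bool.eq_false_iff, Ne, Nat.ble_eq]
      exact fun h => hc ⟨.inr ⟨c, by omega⟩, rfl⟩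
    have h4 : isRoot c = false := by
      rw [Bool.eq_false_iff, Ne, isRoot_iff]
      rintro ⟨u, hu⟩
      exact hc ⟨_, hu⟩
    rw [h0, Matrix.mulVec_zero, column, force_eq, force_eq, h3, h4]
    rfl
  obtain ⟨b, rfl⟩ := hc
  rw [basisVec_code, Matrix.mulVec_single_one, column, force_eq, force_eq]
  rcases b with s | j
  · have hcs := code_inl s
    have hs := lin_bounds s.2
    set c := code (.inl s)
    have h3 : Nat.ble c 3 = false := by
      rw [Bool.eq_false_iff, Ne, Nat.ble_eq]; omega
    have h4 : isRoot c = true := (isRoot_iff _).2 ⟨s, rfl⟩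
    have e1 : isRoot (Nat.add c (rootCode n)) = true ↔ s.1 + 1 • (α n).1 ∈ roots := by
      rw [isRoot_add_smul s (α n) _ 1 (by norm_num) (by norm_num)
        (by change ((c + rootCode n : ℕ) : ℤ) = _; push_cast; rw [hα]; ring), one_smul, one_smul]
    have e2 : isRoot (Nat.add c (Nat.mul 2 (rootCode n))) = true ↔ s.1 + 2 • (α n).1 ∈ roots := by
      rw [isRoot_add_smul s (α n) _ 2 (by norm_num) (by norm_num)
        (by change ((c + 2 * rootCode n : ℕ) : ℤ) = _; push_cast; rw [hα])]
      norm_cast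
    have e3 : isRoot (Nat.sub c (rootCode n)) = true ↔ s.1 - (α n).1 ∈ roots := by
      rw [isRoot_add_smul s (α n) _ (-1) (by norm_num) (by norm_num)
        (by change ((c - rootCode n : ℕ) : ℤ) = _; rw [hα]; omega), neg_one_smul, sub_eq_add_neg]
    have e4 : isRoot (Nat.sub c (Nat.mul 2 (rootCode n))) = true ↔
        s.1 - 2 • (α n).1 ∈ roots := by
      rw [isRoot_add_smul s (α n) _ (-2) (by norm_num) (by norm_num)
        (by change ((c - 2 * rootCode n : ℕ) : ℤ) = _; rw [hα]; omega), neg_smul, sub_eq_add_neg]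
      norm_cast
    have e5 : Nat.beq (Nat.add c (rootCode n)) 30000 = true ↔ s.1 = -(α n).1 := by
      rw [Nat.beq_eq]
      change c + rootCode n = 30000 ↔ _
      constructor
      · intro h
        have := lin_add_smul_injective (k := -2) s.2 (α n).2 (α n).2 (by norm_num) (by norm_num)
          (by linarith)
        rw [this]; ext i; simp; ring
      · intro h
        have : lin s.1 = -lin (α n).1 := by rw [h]; simp [lin]; ring
        omega
    have hvec (k : ℕ) (hk : k ≤ 2) (hm : s.1 + k • (α n).1 ∈ roots) (u : Root) :
        basisVec K (c + k * rootCode n) (.inl u) = if u.1 = s.1 + k • (α n).1 then 1 else 0 := by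
      have : c + k * rootCode n = code (.inl ⟨_, hm⟩) := by
        have h1 := code_inl ⟨_, hm⟩
        have h2 := lin_add_smul s.1 (α n).1 k
        rw [natCast_zsmul, hα] at h2
        rw [h2] at h1
        have : ((c + k * rootCode n : ℕ) : ℤ) = code (.inl ⟨_, hm⟩) := by
          push_cast; rw [h1, hcs]; ring
        exact_mod_cast this
      rw [this]
      simp only [basisVec, code_injective.eq_iff, Sum.inl.injEq, Subtype.ext_iff]
    have hvec' (k : ℕ) (hm : isRoot (c + k * rootCode n) = true) (j : Fin 4) :
        basisVec K (c + k * rootCode n) (.inr j) = 0 := by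
      obtain ⟨u, hu⟩ := (isRoot_iff _).1 hm
      rw [← hu]
      simp [basisVec, code_injective.eq_iff]
    rw [h3, h4]
    simp only [cond_false, cond_true]
    rw [List.map_cons, List.sum_cons, List.map_append, List.sum_append, List.map_append,
      List.sum_append]
    have hcoroot (a : Idx) : (List.map (fun p => t ^ p.2 • basisVec K p.1)
        (bif (c.add (rootCode n)).beq 30000 then (corootOdd n).map (·, 1) else [])).sum a =
          match a with
          | .inl _ => 0
          | .inr j => if s.1 = -(α n).1 then (corootCoeff (α n).1 j : K) * t else 0 := by
      by_cases hs : s.1 = -(α n).1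
      · rw [e5.2 hs, cond_true, sum_map_corootOdd]
        rcases a with u | j
        · rfl
        · simp only [if_pos hs, int_cast_of_charTwo]
          change (if corootCoeff (posRoot n) j % 2 = 1 then t else 0) =
            (if corootCoeff (posRoot n) j % 2 = 1 then 1 else 0) * t
          split_ifs <;> simp
      · rw [Bool.eq_false_iff.2 (e5.not.2 hs)]
        rcases a with u | j <;> simp [hs]
    ext a
    simp only [Pi.add_apply, sum_map_cond, hcoroot]
    rcases a with u | j
    · simp only [Matrix.col_apply, rootMatrix, Matrix.of_apply, Finset.sum_range_succ,
        Finset.sum_range_zero, zero_add, add_zero]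
      rw [add_assoc]
      rw [below_choose_one, below_choose_two]
      refine congr (congrArg _ ?_) (congr (congrArg _ ?_) ?_)
      · have : basisVec K c (.inl u) = if u.1 = s.1 then 1 else 0 := by
          simp only [basisVec, c, code_injective.eq_iff, Sum.inl.injEq, Subtype.ext_iff]
        simp [this]
      · by_cases hm : s.1 + 1 • (α n).1 ∈ roots
        · have hv := hvec 1 (by norm_num) hm u
          rw [one_mul] at hv
          simp only [Bool.and_eq_true, Bool.not_eq_true', ← Bool.not_eq_true, e3, e4, Nat.add_eq,
            Pi.smul_apply, hv, smul_eq_mul]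
          split_ifs <;> simp_all
        · rw [if_neg fun h => hm (by rw [← h]; exact u.2), if_neg]
          rw [Bool.and_eq_true, e1]
          exact fun h => hm h.1
      · by_cases hm : s.1 + 2 • (α n).1 ∈ roots
        · have hv := hvec 2 (by norm_num) hm u
          simp only [Bool.and_eq_true, Bool.not_eq_true', ← Bool.not_eq_true, e3, Nat.add_eq,
            Nat.mul_eq, Pi.smul_apply, hv, smul_eq_mul]
          split_ifs <;> simp_all
        · rw [if_neg fun h => hm (by rw [← h]; exact u.2), if_neg]
          rw [Bool.and_eq_true, e2]
          exact fun h => hm h.1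
    · have h0 : basisVec K c (.inr j) = 0 := by simp [basisVec, c, code_injective.eq_iff]
      have h1 : isRoot (c.add (rootCode n)) = true →
          basisVec K (c.add (rootCode n)) (.inr j) = 0 := by
        have := hvec' 1
        rw [one_mul] at this
        exact fun h => this h j
      have h5 : isRoot (c.add (Nat.mul 2 (rootCode n))) = true →
          basisVec K (c.add (Nat.mul 2 (rootCode n))) (.inr j) = 0 := fun h => hvec' 2 h j
      simp only [Matrix.col_apply, rootMatrix, Matrix.of_apply, Pi.smul_apply, h0, smul_zero,
        zero_add, Bool.and_eq_true]
      have h6 (p : Prop) [Decidable p] : (if isRoot (c.add (rootCode n)) = true ∧ p then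
          t ^ 1 • basisVec K (c.add (rootCode n)) (.inr j) else 0) = 0 :=
        ite_eq_right_iff.2 fun h => by rw [h1 h.1, smul_zero]
      have h7 (p : Prop) [Decidable p] : (if isRoot (c.add (Nat.mul 2 (rootCode n))) = true ∧ p
          then t ^ 2 • basisVec K (c.add (Nat.mul 2 (rootCode n))) (.inr j) else 0) = 0 :=
        ite_eq_right_iff.2 fun h => by rw [h5 h.1, smul_zero]
      rw [h6, h7, zero_add, zero_add]
  · have h3 : Nat.ble (code (.inr j)) 3 = true := by
      rw [Nat.ble_eq]; exact Nat.le_of_lt_succ j.2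
    have hj : cartanOdd n (code (.inr j)) = true ↔ cartanInt (posRoot n) j % 2 = 1 := by
      rw [cartanOdd, decide_eq_true_iff]
      simp [code]
    rw [h3, cond_true, List.map_cons, List.sum_cons]
    have hr' : Nat.add 30000 (rootCode n) = code (.inl (α n)) := by
      have := code_inl (α n)
      change 30000 + rootCode n = _
      omega
    rw [hr']
    ext a
    rw [Pi.add_apply, sum_map_cond]
    simp only [hj]
    rcases a with u | i
    · simp only [Matrix.col_apply, rootMatrix, Matrix.of_apply]
      rw [int_cast_of_charTwo]
      have h0 : basisVec K (code (.inr j)) (.inl u) = 0 := basisVec_inl_of_lt j.2 u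
      have h1 : basisVec K (code (.inl (α n))) (.inl u) = if u.1 = (α n).1 then 1 else 0 := by
        simp only [basisVec, code_injective.eq_iff, Sum.inl.injEq, Subtype.ext_iff]
      simp only [Pi.smul_apply, h0, h1, smul_eq_mul, mul_zero, zero_add]
      change (if u.1 = (α n).1 then (if cartanInt (posRoot n) j % 2 = 1 then 1 else 0) * t else 0)
        = _
      split_ifs <;> simp
    · have h0 : basisVec K (code (.inr j)) (.inr i) = if i = j then 1 else 0 := basisVec_val j i
      have h1 : basisVec K (code (.inl (α n))) (.inr i) = 0 := by
        simp [basisVec, code_injective.eq_iff]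
      simp only [Matrix.col_apply, rootMatrix, Matrix.of_apply, Pi.smul_apply, h0, h1]
      simp

end Field

/-! ### Relations between root elements -/

section Field

variable {K : Type*} [Field K]

/-- The vector described by a list of terms. -/
def evalTerms (s t : K) (l : List (ℕ × ℕ × ℕ)) : Idx → K :=
  (l.map fun y => (s ^ y.2.1 * t ^ y.2.2) • basisVec K y.1).sum

/-- The product of root elements described by a list of letters. -/
def wordElt (s t : K) (w : List (ℕ × ℕ × ℕ)) : Matrix.GeneralLinearGroup Idx K :=
  (w.map fun y => rootElt (α y.1) (s ^ y.2.1 * t ^ y.2.2)).prod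

theorem evalTerms_append (s t : K) (l l' : List (ℕ × ℕ × ℕ)) :
    evalTerms s t (l ++ l') = evalTerms s t l + evalTerms s t l' := by
  simp [evalTerms]

theorem evalTerms_applyLetter [CharP K 2] (s t : K) (y : ℕ × ℕ × ℕ) (l : List (ℕ × ℕ × ℕ)) :
    evalTerms s t (applyLetter y l) =
      (rootMatrix (α y.1) (s ^ y.2.1 * t ^ y.2.2)).mulVec (evalTerms s t l) := by
  induction l with
  | nil => simp [evalTerms, applyLetter]
  | cons z l ih =>
    have h1 : applyLetter y (z :: l) = applyLetter y [z] ++ applyLetter y l := by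
      simp [applyLetter]
    have h2 : evalTerms s t (z :: l) = evalTerms s t [z] + evalTerms s t l :=
      evalTerms_append s t [z] l
    rw [h1, h2, evalTerms_append, ih, Matrix.mulVec_add]
    congr 1
    simp only [evalTerms, applyLetter, force_eq, List.flatMap_cons, List.flatMap_nil,
      List.append_nil, List.map_cons, List.map_nil, List.sum_cons, List.sum_nil, add_zero,
      Matrix.mulVec_smul, rootMatrix_mulVec, List.map_map, List.smul_sum]
    congr 1
    refine List.map_congr_left fun p _ => ?_
    simp only [Function.comp, smul_smul, Nat.add_eq, Nat.mul_eq]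
    congr 1
    ring

theorem evalTerms_applyWord [CharP K 2] (s t : K) (w : List (ℕ × ℕ × ℕ)) (c : ℕ) :
    evalTerms s t (applyWord w c) = (wordElt s t w).1.mulVec (basisVec K c) := by
  induction w with
  | nil => simp [applyWord, evalTerms, wordElt]
  | cons y w ih =>
    have : (wordElt s t (y :: w)).1 =
        rootMatrix (α y.1) (s ^ y.2.1 * t ^ y.2.2) * (wordElt s t w).1 := rfl
    rw [this, ← Matrix.mulVec_mulVec, ← ih]
    exact evalTerms_applyLetter s t y _

theorem evalTerms_toggle [CharP K 2] (s t : K) (y : ℕ × ℕ × ℕ) (l : List (ℕ × ℕ × ℕ)) :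
    evalTerms s t (toggle y l) = evalTerms s t (y :: l) := by
  unfold toggle
  split_ifs with h
  · have := ((List.perm_cons_erase h).map
      fun y => (s ^ y.2.1 * t ^ y.2.2) • basisVec K y.1).sum_eq
    simp only [evalTerms, List.map_cons, List.sum_cons] at this ⊢
    rw [this, ← add_assoc]
    ext a
    rw [Pi.add_apply, Pi.add_apply, CharTwo.add_self_eq_zero, zero_add]
  · rfl

theorem evalTerms_of_cancels [CharP K 2] (s t : K) {l : List (ℕ × ℕ × ℕ)} (h : cancels l = true) :
    evalTerms s t l = 0 := by
  have key : evalTerms s t (l.foldr toggle []) = evalTerms s t l := by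
    clear h
    induction l with
    | nil => rfl
    | cons y l ih =>
      rw [List.foldr_cons, evalTerms_toggle]
      simp only [evalTerms, List.map_cons, List.sum_cons] at ih ⊢
      rw [ih]
  rw [← key, List.isEmpty_iff.1 h]
  rfl

/-- It suffices to compare the columns of two matrices, in the encoded form. -/
theorem GL_ext_basisVec {g h : Matrix.GeneralLinearGroup Idx K}
    (H : ∀ c ∈ codes, g.1.mulVec (basisVec K c) = h.1.mulVec (basisVec K c)) : g = h := by
  refine Units.ext (Matrix.ext fun a b => ?_)
  have := congrFun (H _ (code_mem_codes b)) a
  rwa [basisVec_code, Matrix.mulVec_single_one, Matrix.mulVec_single_one] at this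

theorem eq_of_add_eq_zero [CharP K 2] {v w : Idx → K} (h : v + w = 0) : v = w := by
  ext a
  exact CharTwo.add_eq_zero.1 (congrFun h a)

/-- Soundness of the computation: words that agree modulo `2` as polynomials in `s` and `t` define
equal elements for all values of `s` and `t`. -/
theorem wordElt_eq_of_wordsAgree [CharP K 2] (s t : K) {w w' : List (ℕ × ℕ × ℕ)}
    (h : wordsAgree w w' = true) : wordElt s t w = wordElt s t w' := by
  refine GL_ext_basisVec fun c hc => eq_of_add_eq_zero ?_
  rw [← evalTerms_applyWord, ← evalTerms_applyWord, ← evalTerms_append]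
  exact evalTerms_of_cancels s t (List.all_eq_true.1 h c hc)

/-- The terms of the column of `xₙ(s + t)` that belongs to the basis vector with code `c`. -/
def sumColumn (n c : ℕ) : List (ℕ × ℕ × ℕ) :=
  (column n c).flatMap fun p => if p.2 = 0 then [(p.1, 0, 0)] else [(p.1, p.2, 0), (p.1, 0, p.2)]

/-- Whether `xₙ(s) xₙ(t) = xₙ(s + t)` modulo `2`. -/
def additivityHolds (n : ℕ) : Bool :=
  codes.all fun c => (column n c).all (fun p => Nat.ble p.2 2) &&
    cancels (applyWord [(n, 1, 0), (n, 0, 1)] c ++ sumColumn n c)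

theorem evalTerms_sumColumn [CharP K 2] (n c : ℕ) (s t : K) (h : ∀ p ∈ column n c, p.2 ≤ 2) :
    evalTerms s t (sumColumn n c) = (rootMatrix (α n) (s + t)).mulVec (basisVec K c) := by
  rw [rootMatrix_mulVec, sumColumn]
  revert h
  induction column n c with
  | nil => exact fun _ => rfl
  | cons p l ih =>
    intro h
    rw [List.flatMap_cons, evalTerms_append, ih fun q hq => h q (List.mem_cons_of_mem _ hq),
      List.map_cons, List.sum_cons]
    congr 1
    obtain ⟨d, k⟩ := p
    have hk : k ≤ 2 := h (d, k) List.mem_cons_self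
    interval_cases k
    · simp [evalTerms]
    · simp [evalTerms, add_smul]
    · simp [evalTerms, add_smul, CharTwo.add_sq]

theorem rootElt_add_of_additivityHolds [CharP K 2] {n : ℕ} (h : additivityHolds n = true)
    (s t : K) : rootElt (α n) s * rootElt (α n) t = rootElt (α n) (s + t) := by
  refine GL_ext_basisVec fun c hc => eq_of_add_eq_zero ?_
  have h1 := List.all_eq_true.1 h c hc
  rw [Bool.and_eq_true, List.all_eq_true] at h1
  have h2 := evalTerms_of_cancels s t h1.2
  rw [evalTerms_append, evalTerms_applyWord,
    evalTerms_sumColumn n c s t fun p hp => Nat.le_of_ble_eq_true (h1.1 p hp)] at h2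
  have h3 : wordElt s t [(n, 1, 0), (n, 0, 1)] = rootElt (α n) s * rootElt (α n) t := by
    simp [wordElt]
  rw [h3] at h2
  exact h2

end Field

/-- The factors of the commutator of `x_m(s)` and `x_n(t)`, as letters: they are found among
`x_{m+n}(st)`, `x_{m+2n}(st²)`, `x_{2m+n}(s²t)`, and their structure constants are odd exactly when
the corresponding root vectors occur in the columns of `x_m` and `x_n` at `e_n` and `e_m`. -/
def commutatorWord (m n : ℕ) : List (ℕ × ℕ × ℕ) :=
  (List.range' 1 24).flatMap fun k =>
    (if (30000 + rootCode k, 1) ∈ column m (30000 + rootCode n) then [(k, 1, 1)] else []) ++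
    (if (30000 + rootCode k, 2) ∈ column n (30000 + rootCode m) then [(k, 1, 2)] else []) ++
    (if (30000 + rootCode k, 2) ∈ column m (30000 + rootCode n) then [(k, 2, 1)] else [])

/-- Whether Chevalley's commutator formula for `x_m(s)` and `x_n(t)` holds modulo `2`. -/
def commutatorHolds (m n : ℕ) : Bool :=
  wordsAgree [(m, 1, 0), (n, 0, 1)] ((n, 0, 1) :: (m, 1, 0) :: commutatorWord m n)

set_option maxRecDepth 100000 in
theorem additivityHolds_all : ∀ n ∈ List.range' 1 24, additivityHolds n = true := by
  decide +kernel

set_option maxRecDepth 100000 in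
theorem commutatorHolds_low : ∀ m ∈ [1, 2, 3], ∀ n ∈ List.range' (m + 1) (24 - m),
    commutatorHolds m n = true := by
  decide +kernel

set_option maxRecDepth 100000 in
theorem commutatorHolds_mid : ∀ m ∈ [4, 5, 6, 7], ∀ n ∈ List.range' (m + 1) (24 - m),
    commutatorHolds m n = true := by
  decide +kernel

set_option maxRecDepth 100000 in
theorem commutatorHolds_high : ∀ m ∈ [8, 9, 10, 11, 16], ∀ n ∈ List.range' (m + 1) (24 - m),
    commutatorHolds m n = true := by
  decide +kernel

set_option maxRecDepth 100000 in
theorem commutatorHolds_sixteen : ∀ m ∈ [12, 13, 14, 15], commutatorHolds m 16 = true := by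
  decide +kernel

/-- Only the commutators that involve a root in `S` are needed. -/
theorem commutatorHolds_of_mem {m n : ℕ} (hm : 1 ≤ m) (hmn : m < n) (hn : n ≤ 24)
    (h : m ∈ coreS ∨ n ∈ coreS) : commutatorHolds m n = true := by
  have hn' : n ∈ List.range' (m + 1) (24 - m) := by rw [List.mem_range'_1]; omega
  by_cases hS : m ∈ coreS
  · have : ∀ m ∈ coreS, m ∈ [1, 2, 3] ∨ m ∈ [4, 5, 6, 7] ∨ m ∈ [8, 9, 10, 11, 16] := by decide
    rcases this m hS with h1 | h1 | h1
    · exact commutatorHolds_low m h1 n hn'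
    · exact commutatorHolds_mid m h1 n hn'
    · exact commutatorHolds_high m h1 n hn'
  · have h1 : ∀ n ∈ coreS, n ≤ 11 ∨ n = 16 := by decide
    have h2 : ∀ m ∈ Finset.Icc 1 11, m ∈ coreS := by decide
    have h3 : 12 ≤ m := by
      by_contra h3
      exact hS (h2 m (Finset.mem_Icc.2 ⟨hm, by omega⟩))
    have h4 := (h1 n (h.resolve_left hS)).resolve_left (by omega)
    subst h4
    exact commutatorHolds_sixteen m (by interval_cases m <;> simp)

/-! ### The group `U` -/

section Field

variable {K : Type*} [Field K]

theorem α_eq_of_not_mem {n : ℕ} (hn : n ∉ Finset.Icc 1 24) : α n = α 24 := by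
  rw [Finset.mem_Icc] at hn
  refine Subtype.ext ?_
  change posRoot n = posRoot 24
  unfold posRoot
  split <;> first | rfl | (exfalso; omega)

/-- Root elements with an index out of range coincide with those of `α₂₄`. -/
theorem exists_mem_Icc_x_eq (n : ℕ) : ∃ m ∈ Finset.Icc 1 24, ∀ t : K, x n t = x m t := by
  by_cases hn : n ∈ Finset.Icc 1 24
  · exact ⟨n, hn, fun _ => rfl⟩
  · exact ⟨24, by simp, fun t => Subtype.ext (by simp only [x, α_eq_of_not_mem hn])⟩

/-- The product of root elements described by a list of letters, in `U`. -/
def wordU (s t : K) (w : List (ℕ × ℕ × ℕ)) : U K :=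
  (w.map fun y => x y.1 (s ^ y.2.1 * t ^ y.2.2)).prod

theorem coe_wordU (s t : K) (w : List (ℕ × ℕ × ℕ)) : (wordU s t w : _) = wordElt s t w := by
  simp [wordU, wordElt, x, Function.comp_def]

theorem x_mem_X {P : Finset ℕ} {n : ℕ} (hn : n ∈ P) (t : K) : x n t ∈ X K P :=
  Subgroup.subset_closure ⟨n, hn, t, rfl⟩

theorem X_Icc : X K (Finset.Icc 1 24) = ⊤ := by
  have h : {g : U K | ∃ n ∈ Finset.Icc 1 24, ∃ t : K, g = x n t} =
      ((↑) : U K → _) ⁻¹' {g | ∃ (n : ℕ) (t : K), g = rootElt (α n) t} := by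
    ext g
    constructor
    · rintro ⟨n, -, t, rfl⟩
      exact ⟨n, t, rfl⟩
    · rintro ⟨n, t, hg⟩
      obtain ⟨m, hm, h⟩ := exists_mem_Icc_x_eq (K := K) n
      refine ⟨m, hm, t, ?_⟩
      rw [← h]
      exact Subtype.ext hg
  rw [X, h]
  exact Subgroup.closure_closure_coe_preimage

theorem wordU_mem {P : Finset ℕ} (s t : K) {w : List (ℕ × ℕ × ℕ)} (h : ∀ y ∈ w, y.1 ∈ P) :
    wordU s t w ∈ X K P := by
  refine Subgroup.list_prod_mem _ fun g hg => ?_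
  obtain ⟨y, hy, rfl⟩ := List.mem_map.1 hg
  exact x_mem_X (h y hy) _

variable [CharP K 2]

theorem x_mul_x (n : ℕ) (s t : K) : x n s * x n t = x n (s + t) := by
  obtain ⟨m, hm, h⟩ := exists_mem_Icc_x_eq (K := K) n
  rw [h, h, h]
  refine Subtype.ext (rootElt_add_of_additivityHolds (additivityHolds_all m ?_) s t)
  rw [Finset.mem_Icc] at hm
  rw [List.mem_range'_1]; omega

theorem x_zero (n : ℕ) : x n (0 : K) = 1 := by
  have := x_mul_x n (0 : K) 0
  rwa [add_zero, mul_eq_left] at this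

theorem x_mul_self (n : ℕ) (t : K) : x n t * x n t = 1 := by
  rw [x_mul_x, CharTwo.add_self_eq_zero, x_zero]

theorem x_inv (n : ℕ) (t : K) : (x n t)⁻¹ = x n t := inv_eq_of_mul_eq_one_left (x_mul_self n t)

/-- Chevalley's commutator formula. -/
theorem x_mul_x_comm {m n : ℕ} (hm : 1 ≤ m) (hmn : m < n) (hn : n ≤ 24)
    (h : m ∈ coreS ∨ n ∈ coreS) (s t : K) :
    x m s * x n t = x n t * x m s * wordU s t (commutatorWord m n) := by
  refine Subtype.ext ?_
  have := wordElt_eq_of_wordsAgree s t (commutatorHolds_of_mem hm hmn hn h)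
  rw [← coe_wordU, ← coe_wordU] at this
  simpa [wordU, mul_assoc] using this

/-- Induction over the subgroup generated by some root subgroups: since the root elements are
involutions, inverses need not be considered. -/
theorem X_induction {P : Finset ℕ} {p : U K → Prop} (one : p 1)
    (mul : ∀ n ∈ P, ∀ t g, g ∈ X K P → p g → p (x n t * g)) {g : U K} (hg : g ∈ X K P) : p g := by
  induction hg using Subgroup.closure_induction_left with
  | one => exact one
  | mul_left y hy g hg ih =>
    obtain ⟨n, hn, t, rfl⟩ := hy
    exact mul n hn t g hg ih
  | inv_mul_cancel y hy g hg ih =>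
    obtain ⟨n, hn, t, rfl⟩ := hy
    rw [x_inv]
    exact mul n hn t g hg ih

/-- A criterion for the normality of the subgroup generated by some root subgroups. -/
theorem X_normal {P : Finset ℕ} (hP : P ⊆ Finset.Icc 1 24)
    (hS : ∀ m ∈ Finset.Icc 1 24, m ∉ P → m ∈ coreS)
    (h : ∀ m ∈ Finset.Icc 1 24, m ∉ P → ∀ n ∈ P,
      (∀ y ∈ commutatorWord (min m n) (max m n), y.1 ∈ P)) : (X K P).Normal := by
  have key : ∀ m ∈ Finset.Icc 1 24, ∀ (s : K), ∀ g ∈ X K P, x m s * g * (x m s)⁻¹ ∈ X K P := by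
    intro m hm s g hg
    by_cases hmP : m ∈ P
    · have := x_mem_X hmP s
      exact Subgroup.mul_mem _ (Subgroup.mul_mem _ this hg) (Subgroup.inv_mem _ this)
    refine X_induction (p := fun g => x m s * g * (x m s)⁻¹ ∈ X K P) (by simp) ?_ hg
    intro n hn t g _ ih
    have hn' := Finset.mem_Icc.1 (hP hn)
    have hm' := Finset.mem_Icc.1 hm
    have e : x m s * (x n t * g) * (x m s)⁻¹ =
        x m s * x n t * (x m s)⁻¹ * (x m s * g * (x m s)⁻¹) := by group
    rw [e]
    refine Subgroup.mul_mem _ ?_ ih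
    have hw := h m hm hmP n hn
    rcases lt_trichotomy m n with hlt | rfl | hlt
    · rw [min_eq_left hlt.le, max_eq_right hlt.le] at hw
      have h1 := x_mul_x_comm hm'.1 hlt hn'.2 (Or.inl (hS m hm hmP)) s t
      have h2 : x m s * x n t * (x m s)⁻¹ = (wordU s t (commutatorWord m n) * x n t) := by
        have h3 := congrArg (fun g => x m s * x n t * g * x n t) h1
        simp only [← mul_assoc] at h3
        rw [x_inv]
        have e1 : x m s * x n t * x n t * x m s = 1 := by
          rw [mul_assoc (x m s), x_mul_self, mul_one, x_mul_self]
        rw [e1, one_mul] at h3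
        rw [← h3, mul_assoc _ (x n t) (x n t), x_mul_self, mul_one]
      rw [h2]
      exact Subgroup.mul_mem _ (wordU_mem s t hw) (x_mem_X hn t)
    · exact absurd hn hmP
    · rw [min_eq_right hlt.le, max_eq_left hlt.le] at hw
      have h1 := x_mul_x_comm hn'.1 hlt hm'.2 (Or.inr (hS m hm hmP)) t s
      have h2 : x m s * x n t * (x m s)⁻¹ = x n t * wordU t s (commutatorWord n m) := by
        have h3 := congrArg (fun g => x m s * g) h1
        simp only [← mul_assoc] at h3
        rw [x_mul_self, one_mul] at h3
        rw [← h3, x_inv]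
      rw [h2]
      exact Subgroup.mul_mem _ (x_mem_X hn t) (wordU_mem t s hw)
  refine ⟨fun g hg u => ?_⟩
  have hu : u ∈ X K (Finset.Icc 1 24) := X_Icc (K := K) ▸ Subgroup.mem_top u
  revert g
  refine X_induction (p := fun u => ∀ g ∈ X K P, u * g * u⁻¹ ∈ X K P) (by simp) ?_ hu
  intro n hn t u _ ih g hg
  have e : x n t * u * g * (x n t * u)⁻¹ = x n t * (u * g * u⁻¹) * (x n t)⁻¹ := by group
  rw [e]
  exact key n hn t _ (ih g hg)

/-- The indices of the positive roots that are not in `S`. -/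
abbrev coreN : Finset ℕ := Finset.Icc 1 24 \ coreS

theorem X_coreN_normal : (X K coreN).Normal :=
  X_normal Finset.sdiff_subset (by decide) (by decide +kernel)

/-- The indices of the positive roots that are not simple. -/
abbrev nonsimple : Finset ℕ := Finset.Icc 5 24

theorem X_nonsimple_normal : (X K nonsimple).Normal :=
  X_normal (by decide) (by decide) (by decide +kernel)

end Field

/-! ### Coordinates -/

/-- Matrix positions at which the coordinates of elements of `U` can be read off: for `n ∈ S`, the
triple `(a, b, F)` consists of the indices `a`, `b` of two roots with `a = b + αₙ` and of the list
`F` of further roots whose root vectors occur in the submodule generated by `e_b`. -/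
def position : ℕ → ℕ × ℕ × List ℕ
  | 1 => (24, 23, []) | 2 => (23, 22, [24]) | 3 => (19, 17, [21]) | 4 => (21, 19, [])
  | 5 => (24, 22, []) | 6 => (19, 15, [21]) | 7 => (21, 17, []) | 8 => (17, 10, [19, 21])
  | 9 => (23, 20, [24]) | 10 => (21, 15, [19]) | 11 => (24, 20, [23])
  | _ => (22, 11, [24, 19, 23])

/-- The set of roots whose root elements generate the subgroup on which the `n`-th coordinate is
additive: all positive roots for the simple roots, and the non-simple ones otherwise. -/
def domain (n : ℕ) : Finset ℕ := if n ≤ 4 then Finset.Icc 1 24 else nonsimple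

/-- A level function for which all elements of the domain of the `n`-th coordinate are block
triangular. -/
def level (n c : ℕ) : ℕ :=
  if c ∈ (position n).2.2.map (30000 + rootCode ·) then 0
  else if c = 30000 + rootCode (position n).1 then 1
  else if c = 30000 + rootCode (position n).2.1 then 2 else 3

/-- Whether `level` is compatible with the columns of `x_m`. -/
def levelValid (n m : ℕ) : Bool :=
  (((position n).1 :: (position n).2.1 :: (position n).2.2).map (30000 + rootCode ·)).all fun c =>
    (column m c).all fun p => Nat.ble (level n p.1) (level n c)

set_option maxRecDepth 100000 in
theorem levelValid_of_mem : ∀ n ∈ coreS, ∀ m ∈ domain n, levelValid n m = true := by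
  decide +kernel

set_option maxRecDepth 100000 in
theorem filter_column_position : ∀ n ∈ coreS, ∀ m ∈ domain n,
    (column m (30000 + rootCode (position n).2.1)).filter
        (fun p => p.1 = 30000 + rootCode (position n).1) =
      bif m == n then [(30000 + rootCode (position n).1, 1)] else [] := by
  decide +kernel

theorem code_α (n : ℕ) : code (.inl (α n)) = 30000 + rootCode n := by
  have h1 := code_inl (α n)
  have h2 : lin (α n).1 = rootCode n := lin_posRoot n
  omega

section Field

variable {K : Type*} [Field K]

/-- The `n`-th coordinate of an element of `U`, for `n ∈ S`. -/
def coord (n : ℕ) (g : U K) : K := g.1.1 (.inl (α (position n).1)) (.inl (α (position n).2.1))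

theorem rootMatrix_diag (r : Root) (t : K) (a : Idx) : rootMatrix r t a a = 1 := by
  rw [rootMatrix_eq_one r t a a rfl, Matrix.one_apply_eq]

theorem level_position {n : ℕ} (hn : n ∈ coreS) :
    level n (code (.inl (α (position n).1))) = 1 ∧ level n (code (.inl (α (position n).2.1))) = 2 ∧
      ∀ c, (level n c = 1 → c = 30000 + rootCode (position n).1) ∧
        (level n c = 2 → c = 30000 + rootCode (position n).2.1) := by
  rw [code_α, code_α]
  refine ⟨?_, ?_, fun c => ⟨fun h => ?_, fun h => ?_⟩⟩
  · revert n; decide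
  · revert n; decide
  · unfold level at h
    split_ifs at h <;> simp_all
  · unfold level at h
    split_ifs at h <;> simp_all

/-- The levels `1` and `2` consist of a single basis vector each. The entry at these two positions
is therefore a unipotent `2 × 2` block of a block triangular matrix. -/
theorem mul_apply_of_blockTriangular {n : ℕ} (hn : n ∈ coreS) {M N : Matrix Idx Idx K}
    (hM : M.BlockTriangular fun a => level n (code a))
    (hN : N.BlockTriangular fun a => level n (code a)) :
    let a : Idx := .inl (α (position n).1)
    let b : Idx := .inl (α (position n).2.1)
    (M * N) a a = M a a * N a a ∧ (M * N) b b = M b b * N b b ∧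
      (M * N) a b = M a a * N a b + M a b * N b b := by
  intro a b
  obtain ⟨ha, hb, hc⟩ := level_position hn
  have ha' : ∀ c, level n (code c) = 1 → c = a := fun c h =>
    code_injective (by rw [(hc _).1 h, code_α])
  have hb' : ∀ c, level n (code c) = 2 → c = b := fun c h =>
    code_injective (by rw [(hc _).2 h, code_α])
  have hM' : ∀ i j, level n (code j) < level n (code i) → M i j = 0 := fun i j h => hM h
  have hN' : ∀ i j, level n (code j) < level n (code i) → N i j = 0 := fun i j h => hN h
  have hab : a ≠ b := by
    intro h
    have h12 : (1 : ℕ) = 2 := ha.symm.trans ((congrArg (fun c => level n (code c)) h).trans hb)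
    exact absurd h12 (by norm_num)
  refine ⟨?_, ?_, ?_⟩
  · rw [Matrix.mul_apply]
    refine Finset.sum_eq_single_of_mem a (Finset.mem_univ _) fun c _ hca => ?_
    rcases lt_trichotomy (level n (code c)) 1 with h | h | h
    · rw [hM' a c (by rw [ha]; exact h), zero_mul]
    · exact absurd (ha' c h) hca
    · rw [hN' c a (by rw [ha]; exact h), mul_zero]
  · rw [Matrix.mul_apply]
    refine Finset.sum_eq_single_of_mem b (Finset.mem_univ _) fun c _ hca => ?_
    rcases lt_trichotomy (level n (code c)) 2 with h | h | h
    · rw [hM' b c (by rw [hb]; exact h), zero_mul]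
    · exact absurd (hb' c h) hca
    · rw [hN' c b (by rw [hb]; exact h), mul_zero]
  · rw [Matrix.mul_apply, Fintype.sum_eq_add a b hab]
    rintro c ⟨hca, hcb⟩
    rcases lt_trichotomy (level n (code c)) 1 with h | h | h
    · rw [hM' a c (by rw [ha]; exact h), zero_mul]
    · exact absurd (ha' c h) hca
    · rcases lt_trichotomy (level n (code c)) 2 with h' | h' | h'
      · omega
      · exact absurd (hb' c h') hcb
      · rw [hN' c b (by rw [hb]; exact h'), mul_zero]

variable [CharP K 2]

/-- A matrix entry of `xₙ(t)` is read off from the list `column`. -/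
theorem rootMatrix_apply (n : ℕ) (t : K) (a b : Idx) :
    rootMatrix (α n) t a b =
      (((column n (code b)).filter (·.1 = code a)).map fun p => t ^ p.2).sum := by
  have h := congrFun (rootMatrix_mulVec n t (code b)) a
  rw [basisVec_code, Matrix.mulVec_single_one, Matrix.col_apply] at h
  rw [h]
  induction column n (code b) with
  | nil => rfl
  | cons p l ih =>
    rw [List.map_cons, List.sum_cons, Pi.add_apply, ih]
    by_cases hp : p.1 = code a
    · simp [hp, basisVec]
    · simp [hp, basisVec, Ne.symm hp]

theorem rootMatrix_position {m n : ℕ} (hn : n ∈ coreS) (hm : m ∈ domain n) (t : K) :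
    rootMatrix (α m) t (.inl (α (position n).1)) (.inl (α (position n).2.1)) =
      if m = n then t else 0 := by
  rw [rootMatrix_apply, code_α, code_α, filter_column_position n hn m hm]
  by_cases h : m = n
  · simp [h]
  · simp [h, beq_eq_false_iff_ne.2 h]

theorem coord_x {m n : ℕ} (hn : n ∈ coreS) (hm : m ∈ domain n) (t : K) :
    coord n (x m t) = if m = n then t else 0 := rootMatrix_position hn hm t

theorem rootMatrix_blockTriangular_level {m n : ℕ} (hn : n ∈ coreS) (hm : m ∈ domain n) (t : K) :
    (rootMatrix (α m) t).BlockTriangular fun a => level n (code a) := by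
  intro a b hab
  have h := levelValid_of_mem n hn m hm
  simp only [levelValid, List.all_eq_true] at h
  rw [rootMatrix_apply, List.filter_eq_nil_iff.2, List.map_nil, List.sum_nil]
  intro p hp hpa
  rw [decide_eq_true_iff] at hpa
  refine absurd (Nat.le_of_ble_eq_true (h (code b) ?_ p hp)) (by rw [hpa]; exact not_le.2 hab)
  -- a basis vector with a level below `3` is one of those that `position` lists
  by_contra hb
  simp only [List.map_cons, List.mem_cons, not_or] at hb
  have h3 : level n (code b) = 3 := by
    unfold level
    rw [if_neg hb.2.2, if_neg hb.1, if_neg hb.2.1]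
  have h4 : level n (code a) ≤ 3 := by
    unfold level
    split_ifs <;> simp
  have hab' : level n (code b) < level n (code a) := hab
  omega

theorem blockTriangular_of_mem {n : ℕ} (hn : n ∈ coreS) {g : U K} (hg : g ∈ X K (domain n)) :
    g.1.1.BlockTriangular (fun a => level n (code a)) ∧
      g.1.1 (.inl (α (position n).1)) (.inl (α (position n).1)) = 1 ∧
      g.1.1 (.inl (α (position n).2.1)) (.inl (α (position n).2.1)) = 1 := by
  refine X_induction (p := fun g => g.1.1.BlockTriangular (fun a => level n (code a)) ∧
      g.1.1 (.inl (α (position n).1)) (.inl (α (position n).1)) = 1 ∧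
      g.1.1 (.inl (α (position n).2.1)) (.inl (α (position n).2.1)) = 1) ?_ ?_ hg
  · exact ⟨Matrix.blockTriangular_one, Matrix.one_apply_eq _, Matrix.one_apply_eq _⟩
  · intro m hm t g _ ih
    have h1 := rootMatrix_blockTriangular_level hn hm t
    have h2 := mul_apply_of_blockTriangular hn h1 ih.1
    refine ⟨h1.mul ih.1, h2.1.trans ?_, h2.2.1.trans ?_⟩
    · rw [ih.2.1, rootMatrix_diag, mul_one]
    · rw [ih.2.2, rootMatrix_diag, mul_one]

/-- The `n`-th coordinate is additive on its domain. -/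
theorem coord_mul {n : ℕ} (hn : n ∈ coreS) {g h : U K} (hg : g ∈ X K (domain n))
    (hh : h ∈ X K (domain n)) : coord n (g * h) = coord n g + coord n h := by
  have h1 := blockTriangular_of_mem hn hg
  have h2 := blockTriangular_of_mem hn hh
  refine (mul_apply_of_blockTriangular hn h1.1 h2.1).2.2.trans ?_
  rw [h1.2.1, h2.2.2, one_mul, mul_one, add_comm]
  rfl

end Field

/-! ### The quattern group `X_S` -/

/-- The part of the commutator of `x_m(s)` and `x_n(t)` that survives in `X_S`. -/
def coreWord (m n : ℕ) : List (ℕ × ℕ × ℕ) := (commutatorWord m n).filter fun y => y.1 ∈ coreS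

/-- The pairs of indices in `S` whose root subgroups do not commute in `X_S`. -/
def corePairs : Finset (ℕ × ℕ) :=
  {(1, 2), (1, 6), (1, 9), (2, 3), (2, 7), (3, 4), (3, 5), (4, 6), (4, 9)}

/-- The indices of the roots in `S` that are not simple. -/
def coreA : List ℕ := [5, 6, 7, 8, 9, 10, 11, 16]

set_option maxRecDepth 100000 in
theorem coreWord_eq_nil : ∀ m ∈ coreS, ∀ n ∈ coreS, m < n → (m, n) ∉ corePairs →
    coreWord m n = [] := by
  decide +kernel

set_option maxRecDepth 100000 in
theorem coreWord_eq : coreWord 1 2 = [(5, 1, 1)] ∧ coreWord 1 6 = [(8, 1, 1)] ∧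
    coreWord 1 9 = [(11, 1, 1)] ∧ coreWord 2 3 = [(6, 1, 1), (9, 1, 2)] ∧
    coreWord 2 7 = [(10, 1, 1), (16, 1, 2)] ∧ coreWord 3 4 = [(7, 1, 1)] ∧
    coreWord 3 5 = [(8, 1, 1), (11, 2, 1)] ∧ coreWord 4 6 = [(10, 1, 1)] ∧
    coreWord 4 9 = [(16, 2, 1)] := by
  decide +kernel

section Field

variable {K : Type*} [Field K] [CharP K 2]

/-- The root element `xₙ(t)` of `X_S`. -/
abbrev xb (n : ℕ) (t : K) : Quattern K coreS := xbar coreS n t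

theorem normalClosure_coreN :
    Subgroup.normalClosure (X K coreN : Set (U K)) = X K coreN :=
  have := X_coreN_normal (K := K)
  Subgroup.normalClosure_eq_self _

theorem mk_eq_one_iff (g : U K) : (QuotientGroup.mk g : Quattern K coreS) = 1 ↔ g ∈ X K coreN := by
  rw [QuotientGroup.eq_one_iff, normalClosure_coreN]

theorem xb_eq_one {n : ℕ} (hn : n ∈ coreN) (t : K) : xb n t = 1 :=
  (mk_eq_one_iff _).2 (x_mem_X hn t)

theorem xb_mul_xb (n : ℕ) (s t : K) : xb n s * xb n t = xb n (s + t) :=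
  congrArg QuotientGroup.mk (x_mul_x n s t)

theorem xb_zero (n : ℕ) : xb n (0 : K) = 1 := congrArg QuotientGroup.mk (x_zero n)

theorem xb_mul_self (n : ℕ) (t : K) : xb n t * xb n t = 1 :=
  congrArg QuotientGroup.mk (x_mul_self n t)

/-- The image of a word in `X_S`: the letters outside `S` disappear. -/
theorem mk_wordU (s t : K) (w : List (ℕ × ℕ × ℕ)) (hw : ∀ y ∈ w, y.1 ∈ Finset.Icc 1 24) :
    (QuotientGroup.mk (wordU s t w) : Quattern K coreS) =
      ((w.filter fun y => y.1 ∈ coreS).map fun y => xb y.1 (s ^ y.2.1 * t ^ y.2.2)).prod := by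
  induction w with
  | nil => rfl
  | cons y w ih =>
    have h1 : wordU s t (y :: w) = x y.1 (s ^ y.2.1 * t ^ y.2.2) * wordU s t w := rfl
    have ih' := ih fun z hz => hw z (List.mem_cons_of_mem _ hz)
    rw [h1, QuotientGroup.mk_mul, ih']
    by_cases hy : y.1 ∈ coreS
    · simp only [hy, decide_true, List.filter_cons_of_pos, List.map_cons, List.prod_cons]
      rfl
    · have h2 : y.1 ∈ coreN := Finset.mem_sdiff.2 ⟨hw y List.mem_cons_self, hy⟩
      have h3 : (QuotientGroup.mk (x y.1 (s ^ y.2.1 * t ^ y.2.2)) : Quattern K coreS) = 1 :=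
        xb_eq_one h2 _
      rw [h3, one_mul, List.filter_cons_of_neg (by simp [hy])]

theorem mem_commutatorWord {m n : ℕ} : ∀ y ∈ commutatorWord m n, y.1 ∈ Finset.Icc 1 24 := by
  intro y hy
  obtain ⟨k, hk, hy⟩ := List.mem_flatMap.1 hy
  rw [List.mem_range'_1] at hk
  have : y.1 = k := by
    simp only [List.mem_append] at hy
    rcases hy with (h | h) | h <;> split_ifs at h <;> simp_all
  rw [this, Finset.mem_Icc]; omega

/-- The commutator formula in `X_S`. -/
theorem xb_mul_xb_comm {m n : ℕ} (hm : m ∈ coreS) (hn : n ∈ coreS) (hmn : m < n) (s t : K) :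
    xb m s * xb n t = xb n t * xb m s *
      ((coreWord m n).map fun y => xb y.1 (s ^ y.2.1 * t ^ y.2.2)).prod := by
  have hS : ∀ n ∈ coreS, 1 ≤ n ∧ n ≤ 24 := by decide
  rw [coreWord, ← mk_wordU s t _ mem_commutatorWord]
  exact congrArg QuotientGroup.mk (x_mul_x_comm (hS m hm).1 hmn (hS n hn).2 (Or.inl hm) s t)

theorem xb_commute {m n : ℕ} (hm : m ∈ coreS) (hn : n ∈ coreS) (h1 : (m, n) ∉ corePairs)
    (h2 : (n, m) ∉ corePairs) (s t : K) : Commute (xb m s) (xb n t) := by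
  rcases lt_trichotomy m n with h | rfl | h
  · have := xb_mul_xb_comm hm hn h s t
    rwa [coreWord_eq_nil m hm n hn h h1, List.map_nil, List.prod_nil, mul_one] at this
  · rw [commute_iff_eq, xb_mul_xb, xb_mul_xb, add_comm]
  · have := xb_mul_xb_comm hn hm h t s
    rw [coreWord_eq_nil n hn m hm h h2, List.map_nil, List.prod_nil, mul_one] at this
    exact this.symm

theorem xb_comm_1_2 (s t : K) : xb 1 s * xb 2 t = xb 2 t * xb 1 s * xb 5 (s * t) := by
  simpa [coreWord_eq] using
    xb_mul_xb_comm (m := 1) (n := 2) (by decide) (by decide) (by decide) s t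

theorem xb_comm_1_6 (s t : K) : xb 1 s * xb 6 t = xb 6 t * xb 1 s * xb 8 (s * t) := by
  simpa [coreWord_eq] using
    xb_mul_xb_comm (m := 1) (n := 6) (by decide) (by decide) (by decide) s t

theorem xb_comm_1_9 (s t : K) : xb 1 s * xb 9 t = xb 9 t * xb 1 s * xb 11 (s * t) := by
  simpa [coreWord_eq] using
    xb_mul_xb_comm (m := 1) (n := 9) (by decide) (by decide) (by decide) s t

theorem xb_comm_2_3 (s t : K) :
    xb 2 s * xb 3 t = xb 3 t * xb 2 s * (xb 6 (s * t) * xb 9 (s * t ^ 2)) := by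
  simpa [coreWord_eq] using
    xb_mul_xb_comm (m := 2) (n := 3) (by decide) (by decide) (by decide) s t

theorem xb_comm_2_7 (s t : K) :
    xb 2 s * xb 7 t = xb 7 t * xb 2 s * (xb 10 (s * t) * xb 16 (s * t ^ 2)) := by
  simpa [coreWord_eq] using
    xb_mul_xb_comm (m := 2) (n := 7) (by decide) (by decide) (by decide) s t

theorem xb_comm_3_4 (s t : K) : xb 3 s * xb 4 t = xb 4 t * xb 3 s * xb 7 (s * t) := by
  simpa [coreWord_eq] using
    xb_mul_xb_comm (m := 3) (n := 4) (by decide) (by decide) (by decide) s t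

theorem xb_comm_3_5 (s t : K) :
    xb 3 s * xb 5 t = xb 5 t * xb 3 s * (xb 8 (s * t) * xb 11 (s ^ 2 * t)) := by
  simpa [coreWord_eq] using
    xb_mul_xb_comm (m := 3) (n := 5) (by decide) (by decide) (by decide) s t

theorem xb_comm_4_6 (s t : K) : xb 4 s * xb 6 t = xb 6 t * xb 4 s * xb 10 (s * t) := by
  simpa [coreWord_eq] using
    xb_mul_xb_comm (m := 4) (n := 6) (by decide) (by decide) (by decide) s t

theorem xb_comm_4_9 (s t : K) : xb 4 s * xb 9 t = xb 9 t * xb 4 s * xb 16 (s ^ 2 * t) := by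
  simpa [coreWord_eq] using
    xb_mul_xb_comm (m := 4) (n := 9) (by decide) (by decide) (by decide) s t

/-- Induction over `X_S`. -/
theorem quattern_induction {p : Quattern K coreS → Prop} (one : p 1)
    (mul : ∀ n ∈ coreS, ∀ t g, p g → p (xb n t * g)) (g : Quattern K coreS) : p g := by
  obtain ⟨u, rfl⟩ := QuotientGroup.mk_surjective g
  have hu : u ∈ X K (Finset.Icc 1 24) := X_Icc (K := K) ▸ Subgroup.mem_top u
  refine X_induction (p := fun u => p (QuotientGroup.mk u)) one ?_ hu
  intro n hn t u _ ih
  rw [QuotientGroup.mk_mul]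
  by_cases hS : n ∈ coreS
  · exact mul n hS t _ ih
  · have : (QuotientGroup.mk (x n t) : Quattern K coreS) = 1 :=
      xb_eq_one (Finset.mem_sdiff.2 ⟨hn, hS⟩) t
    rwa [this, one_mul]

/-- The product of the elements `xₙ(tₙ)` of `X_S`, over the non-simple roots in `S`. -/
def aElt (t : ℕ → K) : Quattern K coreS := (coreA.map fun n => xb n (t n)).prod

theorem prod_map_xb_mul {l : List ℕ} (hl : ∀ m ∈ l, m ∈ coreA) (s t : ℕ → K) :
    (l.map fun n => xb n (s n)).prod * (l.map fun n => xb n (t n)).prod =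
      (l.map fun n => xb n (s n + t n)).prod := by
  have hA : ∀ m ∈ coreA, ∀ n ∈ coreA, m ∈ coreS ∧ n ∈ coreS ∧ (m, n) ∉ corePairs := by decide
  induction l with
  | nil => simp
  | cons n l ih =>
    have h1 : Commute (xb n (t n)) (l.map fun n => xb n (s n)).prod := by
      refine Commute.list_prod_right _ _ fun g hg => ?_
      obtain ⟨m, hm, rfl⟩ := List.mem_map.1 hg
      have hm' := hl m (List.mem_cons_of_mem _ hm)
      have hn' := hl n List.mem_cons_self
      exact xb_commute (hA n hn' m hm').1 (hA n hn' m hm').2.1 (hA n hn' m hm').2.2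
        (hA m hm' n hn').2.2 _ _
    rw [List.map_cons, List.map_cons, List.map_cons, List.prod_cons, List.prod_cons,
      List.prod_cons, ← ih fun m hm => hl m (List.mem_cons_of_mem _ hm), ← xb_mul_xb]
    simp only [mul_assoc]
    rw [← mul_assoc _ (xb n (t n)), ← h1.eq, mul_assoc]

theorem aElt_mul (s t : ℕ → K) : aElt s * aElt t = aElt (s + t) :=
  prod_map_xb_mul (fun _ h => h) s t

theorem aElt_zero : aElt (0 : ℕ → K) = 1 := by
  simp [aElt, coreA, xb_zero]

theorem aElt_single {n : ℕ} (hn : n ∈ coreA) (u : K) : aElt (Pi.single n u) = xb n u := by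
  have h : n = 5 ∨ n = 6 ∨ n = 7 ∨ n = 8 ∨ n = 9 ∨ n = 10 ∨ n = 11 ∨ n = 16 := by
    simpa [coreA] using hn
  rcases h with rfl | rfl | rfl | rfl | rfl | rfl | rfl | rfl <;>
    simp [aElt, coreA, xb_zero, Pi.single_apply]

/-- The subgroup of `X_S` that is generated by the root subgroups of the non-simple roots. -/
def subA (K : Type*) [Field K] [CharP K 2] : Subgroup (Quattern K coreS) :=
  (X K nonsimple).map (QuotientGroup.mk' _)

instance : (subA K).Normal :=
  have := X_nonsimple_normal (K := K)
  Subgroup.Normal.map this _ (QuotientGroup.mk'_surjective _)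

theorem xb_mem_subA {n : ℕ} (hn : n ∈ nonsimple) (t : K) : xb n t ∈ subA K :=
  Subgroup.mem_map_of_mem _ (x_mem_X hn t)

/-- The non-simple roots in `S` generate an elementary abelian subgroup with the normal form
`aElt`. -/
theorem mem_subA {g : Quattern K coreS} : g ∈ subA K ↔ ∃ t, g = aElt t := by
  constructor
  · rintro ⟨u, hu, rfl⟩
    refine X_induction (p := fun u => ∃ t, QuotientGroup.mk' _ u = aElt t) ?_ ?_ hu
    · exact ⟨0, by rw [map_one, aElt_zero]⟩
    · rintro n hn t u - ⟨s, hs⟩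
      rw [map_mul, hs]
      by_cases hS : n ∈ coreS
      · refine ⟨Pi.single n t + s, ?_⟩
        have : ∀ n ∈ nonsimple, n ∈ coreS → n ∈ coreA := by decide
        rw [← aElt_mul, aElt_single (this n hn hS)]
        rfl
      · refine ⟨s, ?_⟩
        have h1 : n ∈ Finset.Icc 1 24 := by
          rw [Finset.mem_Icc] at hn ⊢; omega
        have : (QuotientGroup.mk' _ (x n t) : Quattern K coreS) = 1 :=
          xb_eq_one (Finset.mem_sdiff.2 ⟨h1, hS⟩) t
        rw [this, one_mul]
  · rintro ⟨t, rfl⟩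
    refine Subgroup.list_prod_mem _ fun g hg => ?_
    obtain ⟨n, hn, rfl⟩ := List.mem_map.1 hg
    have : ∀ n ∈ coreA, n ∈ nonsimple := by decide
    exact xb_mem_subA (this n hn) _

end Field

/-! ### The order and the commutators of `X_S` -/

theorem domain_eq {n : ℕ} (hn : n ∈ coreA) : domain n = nonsimple := by
  have : ∀ n ∈ coreA, ¬ n ≤ 4 := by decide
  exact if_neg (this n hn)

theorem mem_coreS_of_mem_coreA {n : ℕ} (hn : n ∈ coreA) : n ∈ coreS := by
  have : ∀ n ∈ coreA, n ∈ coreS := by decide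
  exact this n hn

section Field

variable {K : Type*} [Field K]

theorem aElt_congr {s t : ℕ → K} (h : ∀ n ∈ coreA, s n = t n) : aElt s = aElt t := by
  unfold aElt
  congr 1
  exact List.map_congr_left fun n hn => by rw [h n hn]

variable [CharP K 2]

theorem coord_one {n : ℕ} (hn : n ∈ coreS) : coord n (1 : U K) = 0 := by
  have h : (1 : U K) ∈ X K (domain n) := Subgroup.one_mem _
  have := coord_mul hn h h
  rwa [mul_one, left_eq_add] at this

/-- A coordinate vanishes on products of other root elements of its domain. -/
theorem coord_eq_zero {P : Finset ℕ} {n : ℕ} (hn : n ∈ coreS) (hP : P ⊆ domain n) (hnP : n ∉ P)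
    {g : U K} (hg : g ∈ X K P) : coord n g = 0 := by
  refine X_induction (p := fun g => coord n g = 0) (coord_one hn) (fun m hm t g hg ih => ?_) hg
  have hle : X K P ≤ X K (domain n) :=
    Subgroup.closure_mono fun g ⟨k, hk, t, h⟩ => ⟨k, hP hk, t, h⟩
  rw [coord_mul hn (x_mem_X (hP hm) t) (hle hg), ih, coord_x hn (hP hm),
    if_neg (ne_of_mem_of_not_mem hm hnP), add_zero]

theorem coreN_subset_domain {n : ℕ} : coreN ⊆ domain n := by
  unfold domain
  split_ifs
  · exact Finset.sdiff_subset
  · decide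

/-- The coordinates separate the elements `aElt t`, because they are additive on the subgroup of the
non-simple roots and vanish on the root elements of the roots outside `S`. -/
theorem aElt_eq_one {t : ℕ → K} (h : aElt t = 1) : ∀ n ∈ coreA, t n = 0 := by
  intro n hn
  have hnS := mem_coreS_of_mem_coreA hn
  have h1 : aElt t = QuotientGroup.mk (coreA.map fun m => x m (t m)).prod := by
    simp [aElt, coreA]
    rfl
  rw [h1, mk_eq_one_iff] at h
  have h2 := coord_eq_zero hnS coreN_subset_domain (fun h => (Finset.mem_sdiff.1 h).2 hnS) h
  have key : ∀ l : List ℕ, (∀ m ∈ l, m ∈ coreA) → (l.map fun m => x m (t m)).prod ∈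
      X K (domain n) ∧ coord n (l.map fun m => x m (t m)).prod =
        (l.map fun m => if m = n then t m else 0).sum := by
    intro l hl
    induction l with
    | nil => exact ⟨Subgroup.one_mem _, coord_one hnS⟩
    | cons m l ih =>
      obtain ⟨ih1, ih2⟩ := ih fun k hk => hl k (List.mem_cons_of_mem _ hk)
      have hm : m ∈ domain n := by
        rw [domain_eq hn]
        have : ∀ n ∈ coreA, n ∈ nonsimple := by decide
        exact this m (hl m List.mem_cons_self)
      rw [List.map_cons, List.prod_cons, coord_mul hnS (x_mem_X hm _) ih1, ih2, coord_x hnS hm]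
      exact ⟨Subgroup.mul_mem _ (x_mem_X hm _) ih1, by simp⟩
  rw [(key coreA fun _ h => h).2] at h2
  simp only [coreA, List.mem_cons, List.not_mem_nil, or_false] at hn
  rcases hn with rfl | rfl | rfl | rfl | rfl | rfl | rfl | rfl <;> simpa [coreA] using h2

theorem aElt_injective {s t : ℕ → K} (h : aElt s = aElt t) : ∀ n ∈ coreA, s n = t n := by
  intro n hn
  have : aElt (s + t) = 1 := by rw [← aElt_mul, h, aElt_mul, CharTwo.add_self_eq_zero, aElt_zero]
  exact CharTwo.add_eq_zero.1 (aElt_eq_one this n hn)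

/-- The coordinates of an element of `X_S` with respect to the simple roots. -/
def simpleCoord : Quattern K coreS →* Multiplicative (Fin 4 → K) :=
  QuotientGroup.lift _
    (MonoidHom.mk' (fun g : U K => Multiplicative.ofAdd fun i : Fin 4 => coord (i + 1) g) (by
      intro g h
      have hS : ∀ i : Fin 4, (i : ℕ) + 1 ∈ coreS := by decide
      have hd : ∀ i : Fin 4, domain ((i : ℕ) + 1) = Finset.Icc 1 24 := by decide
      have hm : ∀ (i : Fin 4) (g : U K), g ∈ X K (domain ((i : ℕ) + 1)) := by
        intro i g
        rw [hd, X_Icc]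
        exact Subgroup.mem_top g
      rw [← ofAdd_add]
      congr 1
      ext i
      exact coord_mul (hS i) (hm i g) (hm i h))) (by
    intro g hg
    rw [normalClosure_coreN] at hg
    have hS : ∀ i : Fin 4, (i : ℕ) + 1 ∈ coreS := by decide
    rw [MonoidHom.mem_ker, MonoidHom.mk'_apply, ← ofAdd_zero]
    congr 1
    ext i
    exact coord_eq_zero (hS i) coreN_subset_domain
      (fun h => (Finset.mem_sdiff.1 h).2 (hS i)) hg)

theorem simpleCoord_xb {n : ℕ} (hn : n ∈ Finset.Icc 1 24) (t : K) :
    simpleCoord (xb n t) = Multiplicative.ofAdd fun i : Fin 4 => if n = i + 1 then t else 0 := by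
  have hS : ∀ i : Fin 4, (i : ℕ) + 1 ∈ coreS := by decide
  have hd : ∀ i : Fin 4, domain ((i : ℕ) + 1) = Finset.Icc 1 24 := by decide
  change Multiplicative.ofAdd (fun i : Fin 4 => coord (i + 1) (x n t)) = _
  congr 1
  ext i
  rw [coord_x (hS i) (by rw [hd]; exact hn)]

/-- The product of root elements of simple roots with the given simple coordinates. -/
def pElt (s : Fin 4 → K) : Quattern K coreS := xb 1 (s 0) * xb 2 (s 1) * xb 3 (s 2) * xb 4 (s 3)

theorem simpleCoord_pElt (s : Fin 4 → K) : simpleCoord (pElt s) = Multiplicative.ofAdd s := by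
  simp only [pElt, map_mul]
  rw [simpleCoord_xb (by decide), simpleCoord_xb (by decide), simpleCoord_xb (by decide),
    simpleCoord_xb (by decide), ← ofAdd_add, ← ofAdd_add, ← ofAdd_add]
  congr 1
  ext i
  fin_cases i <;> simp

theorem simpleCoord_aElt (t : ℕ → K) : simpleCoord (aElt t) = 1 := by
  rw [aElt, map_list_prod, List.map_map]
  refine List.prod_eq_one fun g hg => ?_
  obtain ⟨n, hn, rfl⟩ := List.mem_map.1 hg
  rw [Function.comp_apply]
  have h1 : ∀ n ∈ coreA, n ∈ Finset.Icc 1 24 ∧ ∀ i : Fin 4, n ≠ i + 1 := by decide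
  rw [simpleCoord_xb (h1 n hn).1, ← ofAdd_zero]
  congr 1
  ext i
  exact if_neg ((h1 n hn).2 i)

theorem mk_xb_commute {m n : ℕ} (hm : m ∈ coreS) (hn : n ∈ coreS) (s t : K) :
    Commute (QuotientGroup.mk (xb m s) : Quattern K coreS ⧸ subA K)
      (QuotientGroup.mk (xb n t)) := by
  have key : ∀ {m n : ℕ}, m ∈ coreS → n ∈ coreS → m < n → ∀ s t : K,
      Commute (QuotientGroup.mk (xb m s) : Quattern K coreS ⧸ subA K)
        (QuotientGroup.mk (xb n t)) := by
    intro m n hm hn hmn s t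
    have hw : ∀ m ∈ coreS, ∀ n ∈ coreS, m < n → ∀ y ∈ coreWord m n, y.1 ∈ nonsimple := by
      decide +kernel
    have h := xb_mul_xb_comm hm hn hmn s t
    have h1 : ((coreWord m n).map fun y => xb y.1 (s ^ y.2.1 * t ^ y.2.2)).prod ∈ subA K := by
      refine Subgroup.list_prod_mem _ fun g hg => ?_
      obtain ⟨y, hy, rfl⟩ := List.mem_map.1 hg
      exact xb_mem_subA (hw m hm n hn hmn y hy) _
    have h2 := congrArg (QuotientGroup.mk : _ → Quattern K coreS ⧸ subA K) h
    rw [QuotientGroup.mk_mul_of_mem _ h1] at h2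
    exact h2
  rcases lt_trichotomy m n with h | rfl | h
  · exact key hm hn h s t
  · rw [commute_iff_eq, ← QuotientGroup.mk_mul, ← QuotientGroup.mk_mul, xb_mul_xb, xb_mul_xb,
      add_comm]
  · exact (key hn hm h t s).symm

theorem mk_eq_mk_pElt (g : Quattern K coreS) :
    (QuotientGroup.mk g : Quattern K coreS ⧸ subA K) =
      QuotientGroup.mk (pElt (simpleCoord g).toAdd) := by
  refine quattern_induction (p := fun g => (QuotientGroup.mk g : Quattern K coreS ⧸ subA K) =
      QuotientGroup.mk (pElt (simpleCoord g).toAdd)) ?_ ?_ g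
  · rw [map_one]
    simp [pElt, xb_zero]
  · intro n hn t g ih
    have hI : ∀ n ∈ coreS, n ∈ Finset.Icc 1 24 := by decide
    have hn4 : ∀ n ∈ coreS, n = 1 ∨ n = 2 ∨ n = 3 ∨ n = 4 ∨ n ∈ nonsimple := by decide
    rw [map_mul, toAdd_mul, simpleCoord_xb (hI n hn), toAdd_ofAdd, QuotientGroup.mk_mul, ih]
    generalize Multiplicative.toAdd (simpleCoord g) = s
    have h12 := mk_xb_commute (K := K) (m := 1) (n := 2) (by decide) (by decide)
    have h13 := mk_xb_commute (K := K) (m := 1) (n := 3) (by decide) (by decide)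
    have h14 := mk_xb_commute (K := K) (m := 1) (n := 4) (by decide) (by decide)
    have h23 := mk_xb_commute (K := K) (m := 2) (n := 3) (by decide) (by decide)
    have h24 := mk_xb_commute (K := K) (m := 2) (n := 4) (by decide) (by decide)
    have h34 := mk_xb_commute (K := K) (m := 3) (n := 4) (by decide) (by decide)
    have hadd : ∀ n (s t : K), (QuotientGroup.mk (xb n (s + t)) : Quattern K coreS ⧸ subA K) =
        QuotientGroup.mk (xb n s) * QuotientGroup.mk (xb n t) := by
      intro n s t
      rw [← QuotientGroup.mk_mul, xb_mul_xb]
    rcases hn4 n hn with rfl | rfl | rfl | rfl | hn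
    · simp [pElt, hadd, mul_assoc]
    · simp only [pElt, QuotientGroup.mk_mul, hadd, mul_assoc, Pi.add_apply,
        Fin.coe_ofNat_eq_mod]
      simp only [QuotientGroup.mk_one, Nat.reduceMod, Nat.reduceAdd, Nat.reduceEqDiff, if_false,
        if_true, xb_zero, one_mul, ← mul_assoc]
      rw [(h12 (s 0) t).eq]
    · simp only [pElt, QuotientGroup.mk_mul, hadd, mul_assoc, Pi.add_apply,
        Fin.coe_ofNat_eq_mod]
      simp only [QuotientGroup.mk_one, Nat.reduceMod, Nat.reduceAdd, Nat.reduceEqDiff, if_false,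
        if_true, xb_zero, one_mul, ← mul_assoc]
      rw [mul_assoc _ _ (QuotientGroup.mk (xb 3 t)), (h23 (s 1) t).eq, ← mul_assoc,
        (h13 (s 0) t).eq]
    · simp only [pElt, QuotientGroup.mk_mul, hadd, mul_assoc, Pi.add_apply,
        Fin.coe_ofNat_eq_mod]
      simp only [QuotientGroup.mk_one, Nat.reduceMod, Nat.reduceAdd, Nat.reduceEqDiff, if_false,
        if_true, xb_zero, one_mul, ← mul_assoc]
      rw [mul_assoc _ _ (QuotientGroup.mk (xb 4 t)), (h34 (s 2) t).eq, ← mul_assoc,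
        mul_assoc _ _ (QuotientGroup.mk (xb 4 t)), (h24 (s 1) t).eq, ← mul_assoc,
        (h14 (s 0) t).eq]
    · have h1 : (QuotientGroup.mk (xb n t) : Quattern K coreS ⧸ subA K) = 1 :=
        (QuotientGroup.eq_one_iff _).2 (xb_mem_subA hn t)
      have h2 : (fun i : Fin 4 => if n = (i : ℕ) + 1 then t else 0) = 0 := by
        ext i
        rw [Finset.mem_Icc] at hn
        exact if_neg (by omega)
      rw [h1, one_mul, h2, zero_add]

/-- Every element of `X_S` is determined by its simple coordinates up to an element of the
elementary abelian normal subgroup. -/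
theorem exists_eq_pElt_mul_aElt (g : Quattern K coreS) :
    ∃ t, g = pElt (simpleCoord g).toAdd * aElt t := by
  obtain ⟨t, ht⟩ := mem_subA.1 (QuotientGroup.eq.1 (mk_eq_mk_pElt g).symm)
  exact ⟨t, by rw [← ht, mul_inv_cancel_left]⟩

theorem ker_simpleCoord : (simpleCoord (K := K)).ker = subA K := by
  ext g
  rw [MonoidHom.mem_ker, mem_subA]
  constructor
  · intro h
    obtain ⟨t, ht⟩ := exists_eq_pElt_mul_aElt g
    refine ⟨t, ht.trans ?_⟩
    rw [h]
    simp [pElt, xb_zero]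
  · rintro ⟨t, rfl⟩
    exact simpleCoord_aElt t

theorem simpleCoord_surjective : Function.Surjective (simpleCoord (K := K)) :=
  fun s => ⟨pElt s.toAdd, simpleCoord_pElt _⟩

theorem card_subA : Nat.card (subA K) = Nat.card K ^ 8 := by
  let e (t : {n // n ∈ coreA.toFinset} → K) (n : ℕ) : K :=
    if h : n ∈ coreA.toFinset then t ⟨n, h⟩ else 0
  have he : ∀ t n (hn : n ∈ coreA.toFinset), e t n = t ⟨n, hn⟩ := fun t n hn => dif_pos hn
  let f : ({n // n ∈ coreA.toFinset} → K) → subA K := fun t => ⟨aElt (e t), mem_subA.2 ⟨_, rfl⟩⟩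
  clear_value e
  have hf : Function.Bijective f := by
    constructor
    · intro s t hst
      have h : ∀ n ∈ coreA, e s n = e t n := aElt_injective (congrArg Subtype.val hst)
      ext ⟨n, hn⟩
      rw [← he s n hn, ← he t n hn]
      exact h n (List.mem_toFinset.1 hn)
    · rintro ⟨g, hg⟩
      obtain ⟨t, rfl⟩ := mem_subA.1 hg
      exact ⟨fun n => t n, Subtype.ext (aElt_congr fun n hn => he _ n (List.mem_toFinset.2 hn))⟩
  have h8 : Nat.card {n // n ∈ coreA.toFinset} = 8 := by
    rw [Nat.card_eq_fintype_card, Fintype.card_coe]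
    rfl
  rw [← Nat.card_congr (Equiv.ofBijective f hf), Nat.card_fun, h8]

/-- The quotient by the elementary abelian subgroup of order `q⁸` is `K⁴`, by the simple
coordinates. -/
theorem card_quattern : Nat.card (Quattern K coreS) = Nat.card K ^ 12 := by
  rw [← Subgroup.card_mul_index (subA K), card_subA, ← ker_simpleCoord, Subgroup.index_ker,
    MonoidHom.range_eq_top.2 simpleCoord_surjective, Subgroup.card_top]
  change Nat.card K ^ 8 * Nat.card (Fin 4 → K) = _
  rw [Nat.card_fun, Nat.card_fin, ← pow_add]

theorem xb_eq_one_iff {n : ℕ} (hn : n ∈ coreA) {t : K} : xb n t = 1 ↔ t = 0 := by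
  refine ⟨fun h => ?_, fun h => h ▸ xb_zero n⟩
  rw [← aElt_single hn] at h
  simpa using aElt_eq_one h n hn

theorem aElt_two {m n : ℕ} (hm : m ∈ coreA) (hn : n ∈ coreA) (hmn : m ≠ n) {s t : K}
    (h : xb m s * xb n t = 1) : s = 0 := by
  rw [← aElt_single hm, ← aElt_single hn, aElt_mul] at h
  simpa [Pi.single_eq_of_ne hmn] using aElt_eq_one h m hm

theorem not_commute_of_mem_corePairs {p : ℕ × ℕ} (hp : p ∈ corePairs) :
    ¬Commute (xb p.1 (1 : K)) (xb p.2 1) := by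
  have key : ∀ {a b c : Quattern K coreS}, a * b = b * a * c → c ≠ 1 → ¬Commute a b := by
    intro a b c h hc hab
    exact hc (mul_eq_left.1 (h.symm.trans hab.eq))
  have h1 : ∀ n ∈ coreA, xb n ((1 : K) * 1) ≠ 1 := fun n hn h => by
    simpa using (xb_eq_one_iff hn).1 h
  simp only [corePairs, Finset.mem_insert, Finset.mem_singleton] at hp
  rcases hp with rfl | rfl | rfl | rfl | rfl | rfl | rfl | rfl | rfl
  · exact key (xb_comm_1_2 1 1) (h1 5 (by decide))
  · exact key (xb_comm_1_6 1 1) (h1 8 (by decide))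
  · exact key (xb_comm_1_9 1 1) (h1 11 (by decide))
  · exact key (xb_comm_2_3 1 1) fun h => by
      simpa using aElt_two (m := 6) (n := 9) (by decide) (by decide) (by decide) h
  · exact key (xb_comm_2_7 1 1) fun h => by
      simpa using aElt_two (m := 10) (n := 16) (by decide) (by decide) (by decide) h
  · exact key (xb_comm_3_4 1 1) (h1 7 (by decide))
  · exact key (xb_comm_3_5 1 1) fun h => by
      simpa using aElt_two (m := 8) (n := 11) (by decide) (by decide) (by decide) h
  · exact key (xb_comm_4_6 1 1) (h1 10 (by decide))
  · exact key (xb_comm_4_9 1 1) fun h => by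
      have := (xb_eq_one_iff (n := 16) (by decide)).1 h
      simp at this

theorem nontrivialPairs_coreS : nontrivialPairs K coreS = (corePairs : Set (ℕ × ℕ)) := by
  ext p
  constructor
  · rintro ⟨h1, h2, h3, s, t, h⟩
    by_contra hp
    have h4 : (p.2, p.1) ∉ corePairs := by
      have : ∀ p ∈ corePairs, p.1 < p.2 := by decide
      exact fun h => absurd (this _ h) (not_lt.2 h3.le)
    exact h (xb_commute h1 h2 hp h4 s t)
  · intro hp
    have : ∀ p ∈ corePairs, p.1 ∈ coreS ∧ p.2 ∈ coreS ∧ p.1 < p.2 := by decide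
    obtain ⟨h1, h2, h3⟩ := this p hp
    exact ⟨h1, h2, h3, 1, 1, not_commute_of_mem_corePairs hp⟩

theorem commute_xb_of_mem_coreZ {n : ℕ} (hn : n ∈ coreZ) (t : K) (g : Quattern K coreS) :
    Commute (xb n t) g := by
  have h : ∀ n ∈ coreZ, n ∈ coreS ∧ ∀ m ∈ coreS, (n, m) ∉ corePairs ∧ (m, n) ∉ corePairs := by
    decide
  obtain ⟨h1, h2⟩ := h n hn
  refine quattern_induction (p := fun g => Commute (xb n t) g) (Commute.one_right _) ?_ g
  exact fun m hm s g hg => (xb_commute h1 hm (h2 m hm).1 (h2 m hm).2 t s).mul_right hg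

theorem centralRoots_coreS : centralRoots K coreS = (coreZ : Set ℕ) := by
  ext n
  constructor
  · rintro ⟨hn, h⟩
    by_contra hZ
    have : ∀ n ∈ coreS, n ∉ coreZ → ∃ p ∈ corePairs, p.1 = n ∨ p.2 = n := by decide
    obtain ⟨p, hp, hpn⟩ := this n hn hZ
    refine not_commute_of_mem_corePairs (K := K) hp ?_
    rcases hpn with rfl | rfl
    · exact (Subgroup.mem_center_iff.1 (h 1) _).symm
    · exact Subgroup.mem_center_iff.1 (h 1) _
  · intro hn
    refine ⟨(by decide : coreZ ⊆ coreS) hn, fun t => ?_⟩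
    exact Subgroup.mem_center_iff.2 fun g => (commute_xb_of_mem_coreZ hn t g).eq.symm

end Field

/-! ### Irreducible representations -/

section Representation

open Module

variable {G G' V V' : Type*} [Group G] [Group G'] [AddCommGroup V] [Module ℂ V] [AddCommGroup V']
  [Module ℂ V']

theorem isIrreducible_iff (ρ : Representation ℂ G V) :
    ρ.IsIrreducible ↔ Nontrivial V ∧
      ∀ W : Submodule ℂ V, (∀ g, ∀ v ∈ W, ρ g v ∈ W) → W = ⊥ ∨ W = ⊤ := by
  constructor
  · intro h
    refine ⟨?_, fun W hW => ?_⟩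
    · by_contra hV
      rw [not_nontrivial_iff_subsingleton] at hV
      refine bot_ne_top (α := Subrepresentation ρ) ?_
      exact Subrepresentation.toSubmodule_injective (Subsingleton.elim _ _)
    · rcases h.eq_bot_or_eq_top ⟨W, fun g v hv => hW g v hv⟩ with h | h
      · exact Or.inl (congrArg Subrepresentation.toSubmodule h)
      · exact Or.inr (congrArg Subrepresentation.toSubmodule h)
  · rintro ⟨hV, h⟩
    refine { exists_pair_ne := ⟨⊥, ⊤, fun h => ?_⟩, eq_bot_or_eq_top := fun W => ?_ }
    · exact bot_ne_top (α := Submodule ℂ V)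
        (congrArg Subrepresentation.toSubmodule h)
    · rcases h W.toSubmodule fun g v hv => W.apply_mem_toSubmodule g hv with h | h
      · exact Or.inl (Subrepresentation.toSubmodule_injective h)
      · exact Or.inr (Subrepresentation.toSubmodule_injective h)

/-- Irreducibility is inherited by a representation (possibly of another group) on an isomorphic
space whose operators include those of the given one up to scalars. This covers equivalent
representations, inflations, and twists by linear characters. -/
theorem IsIrreducible.transfer {ρ : Representation ℂ G V} {σ : Representation ℂ G' V'}
    (h : ρ.IsIrreducible) (e : V ≃ₗ[ℂ] V')
    (he : ∀ g, ∃ g' : G', ∃ c : ℂ, ∀ v, e (ρ g v) = c • σ g' (e v)) : σ.IsIrreducible := by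
  rw [isIrreducible_iff] at h ⊢
  obtain ⟨hV, h⟩ := h
  refine ⟨e.toEquiv.symm.nontrivial, fun W hW => ?_⟩
  have hW' : ∀ g, ∀ v ∈ W.comap (e : V →ₗ[ℂ] V'), ρ g v ∈ W.comap (e : V →ₗ[ℂ] V') := by
    intro g v hv
    obtain ⟨g', c, hc⟩ := he g
    rw [Submodule.mem_comap, LinearEquiv.coe_coe, hc]
    exact W.smul_mem c (hW g' _ hv)
  rcases h _ hW' with h | h
  · left
    rw [Submodule.eq_bot_iff] at h ⊢
    intro w hw
    have := h (e.symm w) (by simpa using hw)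
    simpa using this
  · right
    rw [Submodule.eq_top_iff'] at h ⊢
    intro w
    simpa using h (e.symm w)

/-- The representation on `V'` obtained by transport of structure. -/
def transport (ρ : Representation ℂ G V) (e : V ≃ₗ[ℂ] V') : Representation ℂ G V' where
  toFun g := e.conj (ρ g)
  map_one' := by rw [map_one]; exact e.conj_id
  map_mul' g h := by rw [map_mul, Module.End.mul_eq_comp, LinearEquiv.conj_comp]; rfl

theorem transport_apply (ρ : Representation ℂ G V) (e : V ≃ₗ[ℂ] V') (g : G) (v : V') :
    transport ρ e g v = e (ρ g (e.symm v)) := rfl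

theorem transport_irreducible {ρ : Representation ℂ G V} (h : ρ.IsIrreducible) (e : V ≃ₗ[ℂ] V') :
    (transport ρ e).IsIrreducible :=
  IsIrreducible.transfer h e fun g => ⟨g, 1, fun v => by simp [transport_apply]⟩

/-- The twist of a representation by a linear character. -/
def twist (ν : G →* ℂ) (ρ : Representation ℂ G V) : Representation ℂ G V where
  toFun g := ν g • ρ g
  map_one' := by simp
  map_mul' g h := by rw [map_mul, map_mul, smul_mul_smul_comm]

theorem twist_apply (ν : G →* ℂ) (ρ : Representation ℂ G V) (g : G) (v : V) :
    twist ν ρ g v = ν g • ρ g v := rfl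

theorem twist_irreducible {ρ : Representation ℂ G V} (h : ρ.IsIrreducible) (ν : G →* ℂ) :
    (twist ν ρ).IsIrreducible :=
  IsIrreducible.transfer h (.refl ℂ V) fun g => ⟨g, ν g⁻¹, fun v => by
    rw [twist_apply, smul_smul, ← map_mul, inv_mul_cancel, map_one, one_smul]
    rfl⟩

theorem comp_irreducible_iff {f : G' →* G} (hf : Function.Surjective f)
    (ρ : Representation ℂ G V) :
    Representation.IsIrreducible (ρ.comp f : Representation ℂ G' V) ↔ ρ.IsIrreducible := by
  constructor
  · exact fun h => IsIrreducible.transfer h (.refl ℂ V) fun g => ⟨f g, 1, fun v => by simp⟩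
  · refine fun h => IsIrreducible.transfer h (.refl ℂ V) fun g => ?_
    obtain ⟨g', rfl⟩ := hf g
    exact ⟨g', 1, fun v => by simp⟩

/-- Every non-zero element of the group algebra acts non-trivially in some irreducible
representation. -/
theorem exists_irreducible_asAlgebraHom_ne_zero [Finite G] {T : MonoidAlgebra ℂ G} (hT : T ≠ 0) :
    ∃ (n : ℕ) (ρ : Representation ℂ G (Fin n → ℂ)), ρ.IsIrreducible ∧ ρ.asAlgebraHom T ≠ 0 := by
  have : Fintype G := Fintype.ofFinite G
  have : NeZero (Nat.card G : ℂ) := ⟨Nat.cast_ne_zero.2 Nat.card_pos.ne'⟩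
  have hss : sSup {m : Submodule (MonoidAlgebra ℂ G) (MonoidAlgebra ℂ G) |
      IsSimpleModule (MonoidAlgebra ℂ G) m} = ⊤ := IsSemisimpleModule.sSup_simples_eq_top _ _
  have h1 : ∃ m : Submodule (MonoidAlgebra ℂ G) (MonoidAlgebra ℂ G),
      IsSimpleModule (MonoidAlgebra ℂ G) m ∧ ∃ y ∈ m, T * y ≠ 0 := by
    by_contra! h
    have h2 : (1 : MonoidAlgebra ℂ G) ∈ sSup {m : Submodule (MonoidAlgebra ℂ G)
      (MonoidAlgebra ℂ G) | IsSimpleModule (MonoidAlgebra ℂ G) m} := hss ▸ Submodule.mem_top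
    refine hT ?_
    have h3 : ∀ y ∈ sSup {m : Submodule (MonoidAlgebra ℂ G)
      (MonoidAlgebra ℂ G) | IsSimpleModule (MonoidAlgebra ℂ G) m}, T * y = 0 := by
      intro y hy
      rw [sSup_eq_iSup'] at hy
      induction hy using Submodule.iSup_induction' with
      | mem m y hy => exact h m m.2 y hy
      | zero => exact mul_zero T
      | add y z _ _ hy hz => rw [mul_add, hy, hz, add_zero]
    simpa using h3 1 h2
  obtain ⟨m, hm, y, hy, hTy⟩ := h1
  let σ : Representation ℂ G m := Representation.ofModule' m
  have hσ1 : ∀ r : MonoidAlgebra ℂ G, ∀ w : m, σ.asAlgebraHom r w = r • w := fun r w => by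
    change (MonoidAlgebra.lift ℂ (m →ₗ[ℂ] m) G
      ((MonoidAlgebra.lift ℂ (m →ₗ[ℂ] m) G).symm (Algebra.lsmul ℂ ℂ m))) r w = r • w
    rw [Equiv.apply_symm_apply]
    rfl
  have hσ : σ.IsIrreducible := by
    rw [isIrreducible_iff]
    have hm' := (isSimpleModule_iff _ _).1 hm
    refine ⟨Submodule.nontrivial_iff_ne_bot.2 fun h => ?_, fun W hW => ?_⟩
    · rw [h, Submodule.mem_bot] at hy
      exact hTy (by rw [hy, mul_zero])
    · have hWr : ∀ r : MonoidAlgebra ℂ G, ∀ w ∈ W, r • w ∈ W := by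
        intro r w hw
        rw [← hσ1]
        induction r using MonoidAlgebra.induction_on with
        | of g => simpa using hW g w hw
        | add r s hr hs => rw [map_add]; exact W.add_mem hr hs
        | smul c r hr => rw [map_smul]; exact W.smul_mem c hr
      let W' : Submodule (MonoidAlgebra ℂ G) m :=
        { W with smul_mem' := fun r w hw => hWr r w hw }
      have hW' : ∀ w, w ∈ W' ↔ w ∈ W := fun w => Iff.rfl
      rcases hm'.eq_bot_or_eq_top W' with h | h
      · exact Or.inl ((Submodule.eq_bot_iff _).2 fun w hw =>
          (Submodule.mem_bot (MonoidAlgebra ℂ G)).1 (h ▸ (hW' w).2 hw))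
      · exact Or.inr ((Submodule.eq_top_iff').2 fun w => (hW' w).1 (h ▸ Submodule.mem_top))
  have : FiniteDimensional ℂ (MonoidAlgebra ℂ G) :=
    Module.Finite.equiv (MonoidAlgebra.coeffLinearEquiv ℂ).symm
  have : FiniteDimensional ℂ m := inferInstanceAs (FiniteDimensional ℂ (m.restrictScalars ℂ))
  let e : m ≃ₗ[ℂ] (Fin (finrank ℂ m) → ℂ) := LinearEquiv.ofFinrankEq _ _ (by simp)
  refine ⟨_, transport σ e, transport_irreducible hσ e, fun h => hTy ?_⟩
  have h1 : ∀ r : MonoidAlgebra ℂ G, (transport σ e).asAlgebraHom r =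
      e.conj (σ.asAlgebraHom r) := by
    intro r
    induction r using MonoidAlgebra.induction_on with
    | of g => simp; rfl
    | add r s hr hs => rw [map_add, hr, hs, map_add, map_add]
    | smul c r hr => rw [map_smul, hr, map_smul, map_smul]
  rw [h1, LinearEquiv.map_eq_zero_iff] at h
  have h2 := (hσ1 T ⟨y, hy⟩).symm.trans (LinearMap.congr_fun h _)
  exact congrArg Subtype.val h2

/-- Commuting operators have a common eigenvector in every non-zero invariant subspace. -/
theorem exists_common_eigenvector [FiniteDimensional ℂ V] (l : List (End ℂ V))
    (hl : ∀ f ∈ l, ∀ g ∈ l, Commute f g) {W : Submodule ℂ V} (hW : W ≠ ⊥)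
    (hlW : ∀ f ∈ l, ∀ w ∈ W, f w ∈ W) : ∃ v ∈ W, v ≠ 0 ∧ ∀ f ∈ l, ∃ c : ℂ, f v = c • v := by
  induction l generalizing W with
  | nil =>
    obtain ⟨v, hv, hv0⟩ := Submodule.exists_mem_ne_zero_of_ne_bot hW
    exact ⟨v, hv, hv0, by simp⟩
  | cons f l ih =>
    have : Nontrivial W := Submodule.nontrivial_iff_ne_bot.2 hW
    obtain ⟨c, hc⟩ := End.exists_eigenvalue (f.restrict (hlW f List.mem_cons_self))
    obtain ⟨w, hw⟩ := hc.exists_hasEigenvector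
    have hfw : f w = c • (w : V) := congrArg Subtype.val hw.apply_eq_smul
    obtain ⟨v, hv, hv0, h⟩ := ih (W := W ⊓ End.eigenspace f c)
      (fun f hf g hg => hl f (List.mem_cons_of_mem _ hf) g (List.mem_cons_of_mem _ hg))
      (fun h => hw.2 (Subtype.ext ((Submodule.eq_bot_iff _).1 h w
        ⟨w.2, End.mem_eigenspace_iff.2 hfw⟩)))
      (fun g hg v hv => ⟨hlW g (List.mem_cons_of_mem _ hg) v hv.1, by
        have hv2 := End.mem_eigenspace_iff.1 hv.2
        refine End.mem_eigenspace_iff.2 ?_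
        rw [← End.mul_apply, (hl f List.mem_cons_self g (List.mem_cons_of_mem _ hg)).eq,
          End.mul_apply, hv2, map_smul]⟩)
    refine ⟨v, hv.1, hv0, fun g hg => ?_⟩
    rcases List.mem_cons.1 hg with rfl | hg
    · exact ⟨c, End.mem_eigenspace_iff.1 hv.2⟩
    · exact h g hg

/-- Simultaneous eigenvectors with distinct systems of eigenvalues are linearly independent. -/
theorem linearIndependent_of_eigenvectors {ι Λ : Type*} (T : Λ → End ℂ V) {b : ι → V}
    {χ : ι → Λ → ℂ} (hb : ∀ i, b i ≠ 0) (h : ∀ i k, T k (b i) = χ i k • b i)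
    (hχ : ∀ i j, i ≠ j → ∃ k, χ i k ≠ χ j k) : LinearIndependent ℂ b := by
  classical
  rw [linearIndependent_iff']
  intro s
  induction s using Finset.induction_on with
  | empty => simp
  | insert a s ha ih =>
    intro c hc
    have hs : ∀ j ∈ s, c j = 0 := by
      intro j hj
      obtain ⟨k, hk⟩ := hχ j a fun h => ha (h ▸ hj)
      have h1 := congrArg (T k) hc
      have h2 : ∑ i ∈ s, (c i * (χ i k - χ a k)) • b i = 0 := by
        rw [Finset.sum_insert ha] at hc h1
        rw [map_add, map_smul, h, map_sum, map_zero] at h1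
        have h3 : ∑ i ∈ s, T k (c i • b i) = ∑ i ∈ s, (c i * χ i k) • b i :=
          Finset.sum_congr rfl fun i _ => by rw [map_smul, h, smul_smul]
        rw [h3] at h1
        have h4 : ∑ i ∈ s, (c i * (χ i k - χ a k)) • b i =
            ∑ i ∈ s, (c i * χ i k) • b i - χ a k • ∑ i ∈ s, c i • b i := by
          rw [Finset.smul_sum, ← Finset.sum_sub_distrib]
          refine Finset.sum_congr rfl fun i _ => ?_
          rw [smul_smul, ← sub_smul]
          ring_nf
        have h5 : c a • χ a k • b a + χ a k • ∑ i ∈ s, c i • b i = 0 := by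
          rw [smul_comm, ← smul_add, hc, smul_zero]
        rw [h4, ← add_sub_add_left_eq_sub _ _ (c a • χ a k • b a), h1, h5, sub_zero]
      exact (mul_eq_zero.1 (ih _ h2 j hj)).resolve_right (sub_ne_zero.2 hk)
    intro i hi
    rcases Finset.mem_insert.1 hi with rfl | hi
    · rw [Finset.sum_insert ha, Finset.sum_eq_zero fun j hj => by rw [hs j hj, zero_smul],
        add_zero] at hc
      exact (smul_eq_zero.1 hc).resolve_right (hb i)
    · exact hs i hi

/-! ### Eigenvectors with trivial stabilizer -/

/-- `v` is a non-zero vector on which the normal subgroup `H` acts by scalars `μ`, and whose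
translates are distinguished by the scalars by which `H` acts on them: the linear character `μ`
of `H` has inertia group `H`. -/
structure IsStableVector (ρ : Representation ℂ G V) (H : Subgroup G) (μ : G → ℂ) (v : V) :
    Prop where
  ne_zero : v ≠ 0
  apply_eq : ∀ h ∈ H, ρ h v = μ h • v
  mem_of_forall : ∀ g, (∀ h ∈ H, ρ h (ρ g v) = μ h • ρ g v) → g ∈ H

namespace IsStableVector

variable {ρ : Representation ℂ G V} {H : Subgroup G} {μ : G → ℂ} {v : V}

/-- Representatives of cosets are permuted by `g` up to elements of `H`, which act on `v` by
scalars. -/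
theorem exists_smul (hv : IsStableVector ρ H μ v) (g : G) (y : G ⧸ H) :
    ρ g (ρ y.out v) =
      μ ((QuotientGroup.mk (g * y.out) : G ⧸ H).out⁻¹ * (g * y.out)) •
        ρ (QuotientGroup.mk (g * y.out) : G ⧸ H).out v := by
  have h1 : (QuotientGroup.mk (g * y.out) : G ⧸ H).out⁻¹ * (g * y.out) ∈ H :=
    QuotientGroup.eq.1 (QuotientGroup.out_eq' _)
  rw [← map_smul, ← hv.apply_eq _ h1, ← End.mul_apply, ← End.mul_apply, ← map_mul, ← map_mul,
    mul_inv_cancel_left]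

variable [H.Normal]

theorem apply_translate (hv : IsStableVector ρ H μ v) (g : G) {h : G} (hh : h ∈ H) :
    ρ h (ρ g v) = μ (g⁻¹ * h * g) • ρ g v := by
  have h1 : g⁻¹ * h * g ∈ H := by
    simpa using Subgroup.Normal.conj_mem ‹H.Normal› h hh g⁻¹
  rw [← map_smul, ← hv.apply_eq _ h1, ← End.mul_apply, ← End.mul_apply, ← map_mul, ← map_mul]
  congr 2
  group

/-- The translates have distinct systems of eigenvalues under `H`. -/
theorem linearIndependent (hv : IsStableVector ρ H μ v) :
    LinearIndependent ℂ fun y : G ⧸ H => ρ y.out v := by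
  refine linearIndependent_of_eigenvectors (fun h : H => ρ h)
    (χ := fun y h => μ (y.out⁻¹ * h * y.out)) (fun y h => hv.ne_zero ?_)
    (fun y h => hv.apply_translate _ h.2) fun y z hyz => ?_
  · have : ρ y.out⁻¹ (ρ y.out v) = v := by
      rw [← End.mul_apply, ← map_mul, inv_mul_cancel, map_one, End.one_apply]
    rw [← this, h, map_zero]
  · by_contra! hχ
    refine hyz ?_
    rw [← y.out_eq', ← z.out_eq', QuotientGroup.eq]
    refine hv.mem_of_forall _ fun h hh => ?_
    have h1 : y.out * h * y.out⁻¹ ∈ H := Subgroup.Normal.conj_mem ‹H.Normal› h hh _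
    rw [hv.apply_translate _ hh]
    have := hχ ⟨_, h1⟩
    simp only at this
    have e1 : y.out⁻¹ * (y.out * h * y.out⁻¹) * y.out = h := by group
    rw [e1] at this
    rw [this]
    congr 2
    group

theorem span_eq_top (hv : IsStableVector ρ H μ v) (hρ : ρ.IsIrreducible) :
    Submodule.span ℂ (Set.range fun y : G ⧸ H => ρ y.out v) = ⊤ := by
  refine (((isIrreducible_iff ρ).1 hρ).2 _ fun g w hw => ?_).resolve_left fun h => ?_
  · induction hw using Submodule.span_induction with
    | mem w hw =>
      obtain ⟨y, rfl⟩ := hw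
      change ρ g (ρ y.out v) ∈ _
      rw [hv.exists_smul]
      exact Submodule.smul_mem _ _ (Submodule.subset_span ⟨_, rfl⟩)
    | zero => simp
    | add w w' _ _ h h' => rw [map_add]; exact Submodule.add_mem _ h h'
    | smul c w _ h => rw [map_smul]; exact Submodule.smul_mem _ _ h
  · have h1 := hv.linearIndependent.ne_zero (QuotientGroup.mk 1)
    rw [Submodule.eq_bot_iff] at h
    exact h1 (h _ (Submodule.subset_span ⟨_, rfl⟩))

/-- The translates of a stable vector form a basis of an irreducible representation. -/
def basis (hv : IsStableVector ρ H μ v) (hρ : ρ.IsIrreducible) : Basis (G ⧸ H) ℂ V :=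
  Basis.mk hv.linearIndependent (hv.span_eq_top hρ).ge

theorem basis_apply (hv : IsStableVector ρ H μ v) (hρ : ρ.IsIrreducible) (y : G ⧸ H) :
    hv.basis hρ y = ρ y.out v := Basis.mk_apply _ _ y

theorem finrank_eq_index (hv : IsStableVector ρ H μ v) (hρ : ρ.IsIrreducible) :
    finrank ℂ V = H.index :=
  finrank_eq_nat_card_basis (hv.basis hρ)

open scoped Classical in
/-- The formula for an induced character, in the case of a normal subgroup. -/
theorem character_eq [Fintype (G ⧸ H)] (hv : IsStableVector ρ H μ v) (hρ : ρ.IsIrreducible)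
    (g : G) : ρ.character g = ∑ y : G ⧸ H, if g ∈ H then μ (y.out⁻¹ * g * y.out) else 0 := by
  rw [Representation.character, LinearMap.trace_eq_matrix_trace ℂ (hv.basis hρ), Matrix.trace]
  refine Finset.sum_congr rfl fun y _ => ?_
  rw [Matrix.diag_apply, LinearMap.toMatrix_apply, basis_apply]
  split_ifs with hg
  · rw [hv.apply_translate _ hg, ← hv.basis_apply hρ, map_smul, Basis.repr_self,
      Finsupp.smul_single, Finsupp.single_eq_same, smul_eq_mul, mul_one]
  · rw [hv.exists_smul, ← hv.basis_apply hρ, map_smul, Basis.repr_self, Finsupp.smul_single,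
      Finsupp.single_eq_of_ne]
    intro h
    have h1 : (QuotientGroup.mk y.out : G ⧸ H) = QuotientGroup.mk (g * y.out) :=
      y.out_eq'.trans h
    have h2 := Subgroup.Normal.conj_mem ‹H.Normal› _ (QuotientGroup.eq.1 h1) y.out
    refine hg ?_
    convert h2 using 1
    group

/-- The character is determined by the scalars by which `H` acts on a stable vector. -/
theorem character_congr [Finite G] {μ' : G → ℂ} {ρ' : Representation ℂ G V'} {v' : V'}
    (hv : IsStableVector ρ H μ v) (hρ : ρ.IsIrreducible) (hv' : IsStableVector ρ' H μ' v')
    (hρ' : ρ'.IsIrreducible) (h : ∀ g ∈ H, μ g = μ' g) : ρ.character = ρ'.character := by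
  classical
  have : Fintype (G ⧸ H) := Fintype.ofFinite _
  ext g
  rw [hv.character_eq hρ, hv'.character_eq hρ']
  refine Finset.sum_congr rfl fun y _ => ?_
  split_ifs with hg
  · refine h _ ?_
    simpa using Subgroup.Normal.conj_mem ‹H.Normal› g hg y.out⁻¹
  · rfl

/-- All simultaneous eigenvectors of `H` in an irreducible representation belong to conjugates of
the same linear character. -/
theorem exists_conj (hv : IsStableVector ρ H μ v) (hρ : ρ.IsIrreducible) {μ' : G → ℂ} {w : V}
    (hw : w ≠ 0) (h : ∀ g ∈ H, ρ g w = μ' g • w) : ∃ g, ∀ k ∈ H, μ' k = μ (g⁻¹ * k * g) := by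
  obtain ⟨y, hy⟩ : ∃ y, (hv.basis hρ).repr w y ≠ 0 := by
    by_contra! h0
    exact hw ((hv.basis hρ).repr.map_eq_zero_iff.1 (Finsupp.ext h0))
  refine ⟨y.out, fun k hk => ?_⟩
  have h1 : (hv.basis hρ).repr (ρ k w) y = μ (y.out⁻¹ * k * y.out) * (hv.basis hρ).repr w y := by
    have h2 : ∀ u : V, (hv.basis hρ).repr (ρ k u) y =
        μ (y.out⁻¹ * k * y.out) * (hv.basis hρ).repr u y := by
      intro u
      have : (hv.basis hρ).coord y ∘ₗ ρ k =
          μ (y.out⁻¹ * k * y.out) • (hv.basis hρ).coord y := by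
        refine (hv.basis hρ).ext fun z => ?_
        rw [LinearMap.comp_apply, basis_apply, hv.apply_translate _ hk, ← hv.basis_apply hρ]
        simp only [map_smul, LinearMap.smul_apply, Basis.coord_apply, Basis.repr_self, smul_eq_mul]
        by_cases hzy : z = y
        · rw [hzy]
        · rw [Finsupp.single_eq_of_ne (Ne.symm hzy), mul_zero, mul_zero]
      exact LinearMap.congr_fun this u
    exact h2 w
  rw [h k hk, map_smul, Finsupp.smul_apply, smul_eq_mul] at h1
  exact mul_right_cancel₀ hy h1

end IsStableVector

/-- Irreducible representations with the same character are equivalent. -/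
theorem nonempty_equiv_of_character_eq [Finite G] [FiniteDimensional ℂ V] [FiniteDimensional ℂ V']
    {ρ : Representation ℂ G V} {ρ' : Representation ℂ G V'} (hρ : ρ.IsIrreducible)
    (hρ' : ρ'.IsIrreducible) (h : ρ.character = ρ'.character) : Nonempty (ρ'.Equiv ρ) := by
  have : Fintype G := Fintype.ofFinite G
  have : Invertible (Nat.card G : ℂ) := invertibleOfNonzero (Nat.cast_ne_zero.2 Nat.card_pos.ne')
  have h1 := Representation.char_orthonormal ρ ρ'
  have h2 := Representation.char_orthonormal ρ' ρ'
  rw [h, h2, if_pos ⟨.refl ρ'⟩] at h1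
  by_contra h3
  rw [if_neg h3] at h1
  exact one_ne_zero h1

end Representation

/-! ### The additive character `φ` -/

section Phi

variable {K : Type*} [Field K] [CharP K 2]

theorem phi_add (s t : K) : phi K (s + t) = phi K s * phi K t := by
  simp only [phi]
  rw [map_add, AddChar.map_add_eq_mul]

theorem phi_zero : phi K 0 = 1 := by
  simp only [phi]
  rw [map_zero, AddChar.map_zero_eq_one]

theorem phi_mul_self (t : K) : phi K t * phi K t = 1 := by
  rw [← phi_add, CharTwo.add_self_eq_zero, phi_zero]

theorem phi_eq_one_or (t : K) : phi K t = 1 ∨ phi K t = -1 := mul_self_eq_one_iff.1 (phi_mul_self t)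

theorem phi_ne_zero (t : K) : phi K t ≠ 0 := left_ne_zero_of_mul_eq_one (phi_mul_self t)

/-- The additive character `φ`, as a bundled character. -/
def phiChar (K : Type*) [Field K] [CharP K 2] : AddChar K ℂ where
  toFun := phi K
  map_zero_eq_one' := phi_zero
  map_add_eq_mul' := phi_add

theorem phi_eq_one_iff (t : K) :
    letI : Algebra (ZMod 2) K := ZMod.algebra K 2
    phi K t = 1 ↔ Algebra.trace (ZMod 2) K t = 0 := by
  simp only [phi]
  rw [← AddChar.map_zero_eq_one (ZMod.stdAddChar (N := 2)), ZMod.injective_stdAddChar.eq_iff]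

variable [Finite K]

/-- `φ` is invariant under the Frobenius automorphism. -/
theorem phi_sq (t : K) : phi K (t ^ 2) = phi K t := by
  let _ : Algebra (ZMod 2) K := ZMod.algebra K 2
  have := Algebra.trace_eq_of_algEquiv (FiniteField.frobeniusAlgEquiv (ZMod 2) K 2) t
  rw [FiniteField.frobeniusAlgEquiv_apply, ZMod.card] at this
  simp only [phi]
  rw [this]

theorem exists_phi_eq_neg_one : ∃ τ : K, phi K τ = -1 := by
  let _ : Algebra (ZMod 2) K := ZMod.algebra K 2
  obtain ⟨τ, hτ⟩ := Algebra.trace_surjective (ZMod 2) K 1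
  refine ⟨τ, (phi_eq_one_or τ).resolve_left fun h => ?_⟩
  rw [phi_eq_one_iff, hτ] at h
  exact one_ne_zero h

theorem eq_zero_of_phi_mul_eq_one {b : K} (h : ∀ t, phi K (b * t) = 1) : b = 0 := by
  by_contra hb
  obtain ⟨τ, hτ⟩ := exists_phi_eq_neg_one (K := K)
  have := h (b⁻¹ * τ)
  rw [mul_inv_cancel_left₀ hb, hτ] at this
  norm_num at this

theorem eq_of_phi_mul_eq {b c : K} (h : ∀ t, phi K (b * t) = phi K (c * t)) : b = c := by
  refine CharTwo.add_eq_zero.1 (eq_zero_of_phi_mul_eq_one fun t => ?_)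
  rw [add_mul, phi_add, h, phi_mul_self]

/-- Every additive character of `K` has the form `t ↦ φ(b t)`. -/
theorem exists_phi_mul_eq {χ : K → ℂ} (h0 : χ 0 = 1) (hadd : ∀ s t, χ (s + t) = χ s * χ t) :
    ∃ b, ∀ t, χ t = phi K (b * t) := by
  have : Fintype K := Fintype.ofFinite K
  have hinj : Function.Injective fun b : K => AddChar.mulShift (phiChar K) b := by
    intro b c h
    exact eq_of_phi_mul_eq fun t => DFunLike.congr_fun h t
  have hbij := (Fintype.bijective_iff_injective_and_card _).2 ⟨hinj, AddChar.card_eq.symm⟩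
  obtain ⟨b, hb⟩ := hbij.2 ⟨χ, h0, hadd⟩
  exact ⟨b, fun t => (DFunLike.congr_fun hb t).symm⟩

/-- The additive form of Hilbert's Theorem 90: the kernel of the trace consists of the elements
`z + z²`. -/
theorem exists_add_sq_eq {d : K} (hd : phi K d = 1) : ∃ z, z + z ^ 2 = d := by
  let _ : Algebra (ZMod 2) K := ZMod.algebra K 2
  let f : K →+ K := AddMonoidHom.mk' (fun z => z + z ^ 2) fun z w => by
    rw [CharTwo.add_sq]; abel
  let tr : K →+ ZMod 2 := (Algebra.trace (ZMod 2) K).toAddMonoidHom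
  have hf : ∀ z, f z = z + z ^ 2 := fun _ => rfl
  have htr : ∀ z, z ∈ tr.ker ↔ phi K z = 1 := fun z => (phi_eq_one_iff z).symm
  have h1 : Nat.card f.ker = 2 := by
    have : (f.ker : Set K) = {0, 1} := by
      ext z
      have e : z + z ^ 2 = z * (1 + z) := by ring
      rw [SetLike.mem_coe, AddMonoidHom.mem_ker, hf, e, mul_eq_zero, CharTwo.add_eq_zero,
        Set.mem_insert_iff, Set.mem_singleton_iff, eq_comm (a := (1 : K))]
    rw [← SetLike.coe_sort_coe, this, Nat.card_coe_set_eq, Set.ncard_pair zero_ne_one]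
  have h2 : Nat.card tr.range = 2 := by
    rw [AddMonoidHom.range_eq_top.2 (Algebra.trace_surjective (ZMod 2) K), AddSubgroup.card_top,
      Nat.card_zmod]
  have h3 := f.ker.card_mul_index
  have h4 := tr.ker.card_mul_index
  rw [AddSubgroup.index_ker, h1] at h3
  rw [AddSubgroup.index_ker, h2] at h4
  have hle : f.range ≤ tr.ker := by
    rintro _ ⟨z, rfl⟩
    rw [htr, hf, phi_add, phi_sq, phi_mul_self]
  have := AddSubgroup.eq_of_le_of_card_ge hle (by omega)
  obtain ⟨z, hz⟩ := (this ▸ (htr d).2 hd : d ∈ f.range)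
  exact ⟨z, hz⟩

theorem exists_sq_eq (b : K) : ∃ c, c ^ 2 = b :=
  surjective_frobenius K 2 b

end Phi

/-! ### Weight vectors -/

section Weight

open Module

variable {K : Type*} [Field K] [CharP K 2] {V : Type*} [AddCommGroup V] [Module ℂ V]

/-- The root elements `xₙ(t)` of `X_S`, `αₙ` not simple, act on `v` by the scalars `φ(bₙ t)`. -/
def IsWeightVector (ρ : Representation ℂ (Quattern K coreS) V) (b : ℕ → K) (v : V) : Prop :=
  ∀ n ∈ coreA, ∀ t, ρ (xb n t) v = phi K (b n * t) • v

/-- The linear character `aElt t ↦ ∏ φ(bₙ tₙ)`, in terms of the coordinates. -/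
def weightChar (b t : ℕ → K) : ℂ := (coreA.map fun n => phi K (b n * t n)).prod

theorem weightChar_congr {b s t : ℕ → K} (h : ∀ n ∈ coreA, s n = t n) :
    weightChar b s = weightChar b t := by
  unfold weightChar
  congr 1
  exact List.map_congr_left fun n hn => by rw [h n hn]

theorem weightChar_add (b s t : ℕ → K) :
    weightChar b (s + t) = weightChar b s * weightChar b t := by
  simp only [weightChar, coreA, List.map_cons, List.map_nil, List.prod_cons, List.prod_nil,
    Pi.add_apply, mul_add, phi_add]
  ring

theorem weightChar_zero (b : ℕ → K) : weightChar b 0 = 1 := by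
  simp [weightChar, coreA, phi_zero]

theorem weightChar_single (b : ℕ → K) {n : ℕ} (hn : n ∈ coreA) (u : K) :
    weightChar b (Pi.single n u) = phi K (b n * u) := by
  simp only [coreA, List.mem_cons, List.not_mem_nil, or_false] at hn
  rcases hn with rfl | rfl | rfl | rfl | rfl | rfl | rfl | rfl <;>
    simp [weightChar, coreA, Pi.single_apply, phi_zero]

theorem weightChar_ne_zero (b t : ℕ → K) : weightChar b t ≠ 0 := by
  refine List.prod_ne_zero fun h => ?_
  obtain ⟨n, -, hn⟩ := List.mem_map.1 h
  exact phi_ne_zero _ hn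

namespace IsWeightVector

variable {ρ : Representation ℂ (Quattern K coreS) V} {b b' : ℕ → K} {v : V}

theorem congr (h : IsWeightVector ρ b v) (hb : ∀ n ∈ coreA, b n = b' n) :
    IsWeightVector ρ b' v := fun n hn t => by rw [h n hn, hb n hn]

theorem smul (h : IsWeightVector ρ b v) (c : ℂ) : IsWeightVector ρ b (c • v) := fun n hn t => by
  rw [map_smul, h n hn, smul_comm]

theorem apply_aElt (h : IsWeightVector ρ b v) (t : ℕ → K) :
    ρ (aElt t) v = weightChar b t • v := by
  have key : ∀ l : List ℕ, (∀ n ∈ l, n ∈ coreA) → ρ (l.map fun n => xb n (t n)).prod v =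
      (l.map fun n => phi K (b n * t n)).prod • v := by
    intro l hl
    induction l with
    | nil => simp
    | cons n l ih =>
      rw [List.map_cons, List.prod_cons, map_mul, End.mul_apply,
        ih fun m hm => hl m (List.mem_cons_of_mem _ hm), map_smul, h n (hl n List.mem_cons_self),
        List.map_cons, List.prod_cons, smul_smul, mul_comm]
  exact key coreA fun _ h => h

/-- A commutator relation changes the weight of a translate by the scalar by which the commutator
acts. -/
theorem apply_of_comm (h : IsWeightVector ρ b v) {n : ℕ} (hn : n ∈ coreA) {t d : K}
    {g c : Quattern K coreS} (hg : g * xb n t = xb n t * g * c) (hc : ρ c v = phi K d • v) :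
    ρ (xb n t) (ρ g v) = phi K (b n * t + d) • ρ g v := by
  have h1 : ρ (g * xb n t) v = ρ (xb n t * g * c) v := by rw [hg]
  simp only [map_mul, End.mul_apply] at h1
  rw [h n hn, hc, map_smul, map_smul, map_smul] at h1
  rw [phi_add, mul_comm, mul_smul, h1, smul_smul, phi_mul_self, one_smul]

theorem apply_of_commute (h : IsWeightVector ρ b v) {n : ℕ} (hn : n ∈ coreA) {t : K}
    {g : Quattern K coreS} (hg : Commute g (xb n t)) :
    ρ (xb n t) (ρ g v) = phi K (b n * t) • ρ g v := by
  rw [← End.mul_apply, ← map_mul, ← hg.eq, map_mul, End.mul_apply, h n hn, map_smul]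

theorem apply_mul (h : IsWeightVector ρ b v) {m n : ℕ} (hm : m ∈ coreA) (hn : n ∈ coreA)
    (s t : K) : ρ (xb m s * xb n t) v = phi K (b m * s + b n * t) • v := by
  rw [map_mul, End.mul_apply, h n hn, map_smul, h m hm, smul_smul, phi_add, mul_comm]

theorem apply_xb_one (h : IsWeightVector ρ b v) (s : K) :
    IsWeightVector ρ (b + Pi.single 6 (b 8 * s) + Pi.single 9 (b 11 * s)) (ρ (xb 1 s) v) := by
  intro n hn t
  by_cases h6 : n = 6
  · subst h6
    rw [h.apply_of_comm hn (xb_comm_1_6 s t) (h 8 (by decide) _)]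
    congr 2
    simp
    ring
  by_cases h9 : n = 9
  · subst h9
    rw [h.apply_of_comm hn (xb_comm_1_9 s t) (h 11 (by decide) _)]
    congr 2
    simp
    ring
  · have hc : ∀ n ∈ coreA, n ≠ 6 → n ≠ 9 → (1, n) ∉ corePairs ∧ (n, 1) ∉ corePairs := by decide
    rw [h.apply_of_commute hn (xb_commute (by decide) (mem_coreS_of_mem_coreA hn)
      (hc n hn h6 h9).1 (hc n hn h6 h9).2 s t)]
    simp [Pi.single_eq_of_ne h6, Pi.single_eq_of_ne h9]

theorem apply_xb_three (h : IsWeightVector ρ b v) (s : K) :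
    IsWeightVector ρ (b + Pi.single 5 (b 8 * s + b 11 * s ^ 2)) (ρ (xb 3 s) v) := by
  intro n hn t
  by_cases h5 : n = 5
  · subst h5
    rw [h.apply_of_comm hn (xb_comm_3_5 s t) (h.apply_mul (by decide) (by decide) _ _)]
    congr 2
    simp
    ring
  · have hc : ∀ n ∈ coreA, n ≠ 5 → (3, n) ∉ corePairs ∧ (n, 3) ∉ corePairs := by decide
    rw [h.apply_of_commute hn (xb_commute (by decide) (mem_coreS_of_mem_coreA hn)
      (hc n hn h5).1 (hc n hn h5).2 s t)]
    simp [Pi.single_eq_of_ne h5]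

theorem apply_xb_four (h : IsWeightVector ρ b v) (s : K) :
    IsWeightVector ρ (b + Pi.single 6 (b 10 * s) + Pi.single 9 (b 16 * s ^ 2))
      (ρ (xb 4 s) v) := by
  intro n hn t
  by_cases h6 : n = 6
  · subst h6
    rw [h.apply_of_comm hn (xb_comm_4_6 s t) (h 10 (by decide) _)]
    congr 2
    simp
    ring
  by_cases h9 : n = 9
  · subst h9
    rw [h.apply_of_comm hn (xb_comm_4_9 s t) (h 16 (by decide) _)]
    congr 2
    simp
    ring
  · have hc : ∀ n ∈ coreA, n ≠ 6 → n ≠ 9 → (4, n) ∉ corePairs ∧ (n, 4) ∉ corePairs := by decide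
    rw [h.apply_of_commute hn (xb_commute (by decide) (mem_coreS_of_mem_coreA hn)
      (hc n hn h6 h9).1 (hc n hn h6 h9).2 s t)]
    simp [Pi.single_eq_of_ne h6, Pi.single_eq_of_ne h9]

/-- An element of `X_S` that acts by the same scalar on all translates of a weight vector acts by
this scalar. -/
theorem apply_eq_smul (h : IsWeightVector ρ b v) (hv : v ≠ 0) (hρ : ρ.IsIrreducible)
    {y : Quattern K coreS} {z : ℂ} (hy : ∀ s, ρ y (ρ (pElt s) v) = z • ρ (pElt s) v) (w : V) :
    ρ y w = z • w := by
  have hg : ∀ g, ρ y (ρ g v) = z • ρ g v := by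
    intro g
    obtain ⟨t, ht⟩ := exists_eq_pElt_mul_aElt g
    rw [ht, map_mul, End.mul_apply, h.apply_aElt, map_smul, map_smul, hy, smul_comm]
  have htop : Submodule.span ℂ (Set.range fun g => ρ g v) = ⊤ := by
    refine (((isIrreducible_iff ρ).1 hρ).2 _ fun g w hw => ?_).resolve_left fun h0 => ?_
    · induction hw using Submodule.span_induction with
      | mem w hw =>
        obtain ⟨k, rfl⟩ := hw
        exact Submodule.subset_span ⟨g * k, by simp only [map_mul, End.mul_apply]⟩
      | zero => simp
      | add w w' _ _ h h' => rw [map_add]; exact Submodule.add_mem _ h h'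
      | smul c w _ h => rw [map_smul]; exact Submodule.smul_mem _ _ h
    · rw [Submodule.eq_bot_iff] at h0
      exact hv (h0 _ (Submodule.subset_span ⟨1, by simp⟩))
  have hw : w ∈ Submodule.span ℂ (Set.range fun g => ρ g v) := htop ▸ Submodule.mem_top
  induction hw using Submodule.span_induction with
  | mem w hw =>
    obtain ⟨k, rfl⟩ := hw
    exact hg k
  | zero => simp
  | add w w' _ _ h h' => rw [map_add, h, h', smul_add]
  | smul c w _ h => rw [map_smul, h, smul_comm]

variable [Finite K]

/-- The commutator `[x₂(s), x₇(t)]` contributes `φ(b₁₆ s t²) = φ(r t)`, where `r² = b₁₆ s`. -/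
theorem apply_xb_two (h : IsWeightVector ρ b v) {r s : K} (hr : r ^ 2 = b 16 * s) :
    IsWeightVector ρ (b + Pi.single 7 (b 10 * s + r)) (ρ (xb 2 s) v) := by
  intro n hn t
  by_cases h7 : n = 7
  · subst h7
    have h1 : ρ (xb 10 (s * t) * xb 16 (s * t ^ 2)) v = phi K (b 10 * s * t + r * t) • v := by
      rw [h.apply_mul (by decide) (by decide), ← mul_assoc (b 16), ← hr, ← mul_pow, phi_add,
        phi_add, phi_sq, mul_assoc]
    rw [h.apply_of_comm hn (xb_comm_2_7 s t) h1]
    congr 2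
    simp
    ring
  · have hc : ∀ n ∈ coreA, n ≠ 7 → (2, n) ∉ corePairs ∧ (n, 2) ∉ corePairs := by decide
    rw [h.apply_of_commute hn (xb_commute (by decide) (mem_coreS_of_mem_coreA hn)
      (hc n hn h7).1 (hc n hn h7).2 s t)]
    simp [Pi.single_eq_of_ne h7]

/-- The weight of a translate of a weight vector. -/
theorem apply_pElt (h : IsWeightVector ρ b v) (s : Fin 4 → K) {r : K} (hr : r ^ 2 = b 16 * s 1) :
    IsWeightVector ρ (b + Pi.single 5 (b 8 * s 2 + b 11 * s 2 ^ 2) +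
      Pi.single 6 (b 8 * s 0 + b 10 * s 3) + Pi.single 7 (b 10 * s 1 + r) +
      Pi.single 9 (b 11 * s 0 + b 16 * s 3 ^ 2)) (ρ (pElt s) v) := by
  have h2 := ((h.apply_xb_four (s 3)).apply_xb_three (s 2)).apply_xb_two (r := r) (s := s 1)
    (by simpa using hr)
  have h1 := h2.apply_xb_one (s 0)
  simp only [pElt, map_mul, End.mul_apply]
  refine h1.congr fun n hn => ?_
  simp only [coreA, List.mem_cons, List.not_mem_nil, or_false] at hn
  rcases hn with rfl | rfl | rfl | rfl | rfl | rfl | rfl | rfl <;> simp <;> ring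

end IsWeightVector

/-- The elementary abelian normal subgroup acts diagonalizably, and all its linear characters have
the form `aElt t ↦ ∏ φ(bₙ tₙ)`. -/
theorem exists_isWeightVector [Finite K] [FiniteDimensional ℂ V] [Nontrivial V]
    (ρ : Representation ℂ (Quattern K coreS) V) : ∃ v, v ≠ 0 ∧ ∃ b, IsWeightVector ρ b v := by
  have : Finite (Matrix.GeneralLinearGroup Idx K) := inferInstance
  have : Finite (Quattern K coreS) := inferInstance
  have : Fintype (subA K) := Fintype.ofFinite _
  obtain ⟨v, -, hv0, hv⟩ := exists_common_eigenvector (W := ⊤)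
    ((Finset.univ : Finset (subA K)).toList.map fun g : subA K => ρ g) (by
      intro f hf g hg
      obtain ⟨f, -, rfl⟩ := List.mem_map.1 hf
      obtain ⟨g, -, rfl⟩ := List.mem_map.1 hg
      obtain ⟨s, hs⟩ := mem_subA.1 f.2
      obtain ⟨t, ht⟩ := mem_subA.1 g.2
      rw [commute_iff_eq, ← map_mul, ← map_mul, hs, ht, aElt_mul, aElt_mul, add_comm])
    top_ne_bot (fun _ _ _ _ => Submodule.mem_top)
  refine ⟨v, hv0, ?_⟩
  have hA : ∀ n ∈ coreA, n ∈ nonsimple := by decide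
  have key : ∀ n, ∃ b, n ∈ coreA → ∀ t : K, ρ (xb n t) v = phi K (b * t) • v := by
    intro n
    by_cases hn : n ∈ coreA
    · have hc : ∀ t : K, ∃ c : ℂ, ρ (xb n t) v = c • v := fun t => by
        refine hv _ (List.mem_map.2 ⟨⟨xb n t, xb_mem_subA (hA n hn) t⟩, by simp, rfl⟩)
      choose χ hχ using hc
      obtain ⟨b, hb⟩ := exists_phi_mul_eq (χ := χ)
        (smul_left_injective ℂ hv0 (by simp only [← hχ, xb_zero, map_one, End.one_apply, one_smul]))
        (fun s t => smul_left_injective ℂ hv0 (by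
          simp only
          rw [← hχ, ← xb_mul_xb, map_mul, End.mul_apply, hχ, map_smul, hχ, smul_smul, mul_comm]))
      exact ⟨b, fun _ t => by rw [hχ, hb]⟩
    · exact ⟨0, fun h => absurd h hn⟩
  choose b hb using key
  exact ⟨b, hb⟩

/-- Every linear character of the elementary abelian normal subgroup occurs in an irreducible
representation. -/
theorem exists_irreducible_isWeightVector [Finite K] (b : ℕ → K) :
    ∃ (m : ℕ) (ρ : Representation ℂ (Quattern K coreS) (Fin m → ℂ)) (v : Fin m → ℂ),
      ρ.IsIrreducible ∧ v ≠ 0 ∧ IsWeightVector ρ b v := by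
  have : Finite (Matrix.GeneralLinearGroup Idx K) := inferInstance
  have : Finite (Quattern K coreS) := inferInstance
  have : Fintype (subA K) := Fintype.ofFinite _
  choose c hc using fun g : subA K => mem_subA.1 g.2
  -- `T` is, up to a scalar, the idempotent of the linear character `weightChar b`, which is its own
  -- inverse; the vectors in its image have weight `b`
  let lam (g : subA K) : ℂ := weightChar b (c g)
  have hlam : ∀ (g : subA K) (t), (g : Quattern K coreS) = aElt t →
      lam g = weightChar b t := fun g t h =>
    weightChar_congr (aElt_injective ((hc g).symm.trans h))
  let T : MonoidAlgebra ℂ (Quattern K coreS) :=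
    ∑ g : subA K, MonoidAlgebra.single (g : Quattern K coreS) (lam g)
  have hT : T ≠ 0 := by
    classical
    intro h
    have h2 : T.coeff 1 = 0 := by rw [h]; rfl
    have h3 : T.coeff 1 = lam 1 := by
      simp only [T, MonoidAlgebra.coeff_sum, Finsupp.finsetSum_apply, MonoidAlgebra.coeff_single,
        Finsupp.single_apply]
      rw [Finset.sum_eq_single 1]
      · exact if_pos rfl
      · exact fun g _ hg => if_neg fun h => hg (Subtype.ext h)
      · exact fun h => absurd (Finset.mem_univ _) h
    exact weightChar_ne_zero b (c 1) (h3.symm.trans h2)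
  obtain ⟨m, ρ, hρ, hρT⟩ := exists_irreducible_asAlgebraHom_ne_zero hT
  obtain ⟨v, hv⟩ : ∃ v, ρ.asAlgebraHom T v ≠ 0 := by
    by_contra! h
    exact hρT (LinearMap.ext h)
  refine ⟨m, ρ, _, hρ, hv, fun n hn t => ?_⟩
  have hTv : ρ.asAlgebraHom T v = ∑ g : subA K, lam g • ρ g v := by
    simp [T, map_sum, Representation.asAlgebraHom_single]
  have hA : ∀ n ∈ coreA, n ∈ nonsimple := by decide
  let y : subA K := ⟨xb n t, xb_mem_subA (hA n hn) t⟩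
  have hy : lam y = phi K (b n * t) := by
    rw [hlam y (Pi.single n t) (aElt_single hn t).symm, weightChar_single b hn]
  have h1 : ∀ g, lam (y * g) = phi K (b n * t) * lam g := by
    intro g
    rw [hlam (y * g) (Pi.single n t + c g), weightChar_add, weightChar_single b hn]
    rw [← aElt_mul, aElt_single hn, ← hc g]
    rfl
  rw [hTv, map_sum, Finset.smul_sum]
  refine Eq.trans ?_ (Equiv.sum_comp (Equiv.mulLeft y) fun g : subA K =>
    phi K (b n * t) • lam g • ρ g v)
  refine Finset.sum_congr rfl fun g _ => ?_
  rw [Equiv.coe_mulLeft, h1, smul_smul, ← mul_assoc, phi_mul_self, one_mul, map_smul,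
    Subgroup.coe_mul, map_mul, End.mul_apply]

end Weight

/-! ### Signs -/

/-- Triples of bits. -/
abbrev Bits : Type := Bool × Bool × Bool

/-- The sum of triples of bits. -/
def badd (c d : Bits) : Bits := (xor c.1 d.1, xor c.2.1 d.2.1, xor c.2.2 d.2.2)

/-- The alternating form on triples of bits that describes the commutators of the three involutions
`p₁, p₂, p₃`: the labels `e = (e₅, e₆₉, e₇)` are the signs by which `[p₁, p₂]`, `[p₂, p₃]` and
`[p₁, p₃]` act. -/
def form (e c d : Bits) : Bool :=
  xor (c.1 && xor (d.2.1 && e.1) (d.2.2 && e.2.2))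
    (xor (c.2.1 && xor (d.1 && e.1) (d.2.2 && e.2.1))
      (c.2.2 && xor (d.1 && e.2.2) (d.2.1 && e.2.1)))

/-- A vector that is not in the radical of `form e`, if this form is not zero. It is chosen such
that `pProd a (isoU e)` is an involution. -/
def isoU (e : Bits) : Bits :=
  (!e.2.1 && (e.2.2 || e.1), e.2.1, false)

/-- The generator of the radical of `form e`, if this form is not zero. -/
def radW (e : Bits) : Bits := (e.2.1, e.2.2, e.1)

/-- Membership in the orthogonal complement of `isoU e`, a maximal totally isotropic subspace for
`form e`. -/
def inC (e c : Bits) : Bool := !form e (isoU e) c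

theorem inC_zero (e : Bits) : inC e (false, false, false) = true := by
  revert e; decide

theorem inC_isoU (e : Bits) : inC e (isoU e) = true := by
  revert e; decide

theorem inC_radW (e : Bits) : inC e (radW e) = true := by
  revert e; decide

theorem form_radW (e c : Bits) : form e (radW e) c = false := by
  revert e c; decide

theorem inC_badd {e c d : Bits} (hc : inC e c = true) (hd : inC e d = true) :
    inC e (badd c d) = true := by
  revert e c d; decide

theorem form_eq_false {e c d : Bits} (hc : inC e c = true) (hd : inC e d = true) :
    form e c d = false := by
  revert e c d; decide

theorem inC_cases {e c : Bits} (he : e ≠ (false, false, false)) (hc : inC e c = true) :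
    c = (false, false, false) ∨ c = isoU e ∨ c = radW e ∨ c = badd (isoU e) (radW e) := by
  revert e c; decide

theorem exists_form_isoU {e : Bits} (he : e ≠ (false, false, false)) :
    ∃ z, form e z (isoU e) = true := by
  revert e; decide

theorem form_zero (c d : Bits) : form (false, false, false) c d = false := by
  revert c d; decide

/-- The isotropic subspace has dimension `3` if the form vanishes, and dimension `2` otherwise. -/
theorem card_inC (e : Bits) :
    Nat.card {c // inC e c = true} = if e = (false, false, false) then 8 else 4 := by
  rw [Nat.card_eq_fintype_card]
  revert e; decide

/-- The scalar product of triples of bits. -/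
def bdot (d c : Bits) : Bool := xor (xor (d.1 && c.1) (d.2.1 && c.2.1)) (d.2.2 && c.2.2)

/-- There is a linear functional that separates the radical from `isoU e`. -/
theorem exists_bdot {e : Bits} (he : e ≠ (false, false, false)) :
    ∃ d, bdot d (isoU e) = false ∧ bdot d (radW e) = true := by
  revert e; decide

theorem sgn_xor (b c : Bool) : sgn (xor b c) = sgn b * sgn c := by
  cases b <;> cases c <;> simp [sgn]

theorem sgn_mul_self (b : Bool) : sgn b * sgn b = 1 := by
  cases b <;> simp [sgn]

theorem sgn_injective : Function.Injective sgn := by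
  intro b c h
  cases b <;> cases c <;> simp_all [sgn] <;> norm_num at h

theorem exists_sgn_eq {z : ℂ} (h : z = 1 ∨ z = -1) : ∃ b, z = sgn b := by
  rcases h with rfl | rfl
  · exact ⟨false, rfl⟩
  · exact ⟨true, rfl⟩

section SignCommute

variable {R : Type*} [Ring R] [Algebra ℂ R]

/-- Two elements of an algebra that commute up to the sign `(-1)^b`. -/
def SignCommute (b : Bool) (f g : R) : Prop := f * g = sgn b • (g * f)

namespace SignCommute

variable {b c : Bool} {f g h : R}

theorem one_right (f : R) : SignCommute false f 1 := by simp [SignCommute, sgn]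

theorem refl (f : R) : SignCommute false f f := by simp [SignCommute, sgn]

theorem symm (H : SignCommute b f g) : SignCommute b g f := by
  rw [SignCommute] at H ⊢
  rw [H, smul_smul, sgn_mul_self, one_smul]

theorem mul_right (H : SignCommute b f g) (H' : SignCommute c f h) :
    SignCommute (xor b c) f (g * h) := by
  rw [SignCommute] at H H' ⊢
  rw [← mul_assoc, H, smul_mul_assoc, mul_assoc, H', mul_smul_comm, smul_smul, sgn_xor, mul_assoc]

theorem cond_right (H : SignCommute b f g) (d : Bool) :
    SignCommute (d && b) f (if d then g else 1) := by
  cases d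
  · exact one_right f
  · simpa using H

end SignCommute

end SignCommute

/-! ### Labels of irreducible representations -/

section Labels

open Module

variable {K : Type*} [Field K]

theorem mk_y5 (a : ALabel K) :
    (QuotientGroup.mk (y5 a) : Quattern K coreS) = xb 5 ((a.a11 : K) / (a.a8 : K) ^ 2) := rfl

theorem mk_y69 (a : ALabel K) : (QuotientGroup.mk (y69 a) : Quattern K coreS) =
    xb 6 ((a.a8 : K) * a.a16 / ((a.a10 : K) ^ 2 * a.a11)) *
      xb 9 ((a.a8 : K) ^ 2 * a.a16 / ((a.a10 : K) ^ 2 * (a.a11 : K) ^ 2)) := rfl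

theorem mk_y7 (a : ALabel K) :
    (QuotientGroup.mk (y7 a) : Quattern K coreS) = xb 7 ((a.a10 : K) / a.a16) := rfl

theorem coeff_8 (a : ALabel K) : a.coeff 8 = a.a8 := rfl
theorem coeff_10 (a : ALabel K) : a.coeff 10 = a.a10 := rfl
theorem coeff_11 (a : ALabel K) : a.coeff 11 = a.a11 := rfl
theorem coeff_16 (a : ALabel K) : a.coeff 16 = a.a16 := rfl

variable [CharP K 2] {V : Type*} [AddCommGroup V] [Module ℂ V]

/-- `ρ` is an irreducible representation of `X_S` with label `a` on which the elements
`y₅, y_{6,9}, y₇` act by the signs prescribed by `e`. -/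
structure HasLabels (ρ : Representation ℂ (Quattern K coreS) V) (a : ALabel K) (e : Bits) :
    Prop where
  irreducible : ρ.IsIrreducible
  apply_center : ∀ n ∈ coreZ, ∀ t v, ρ (xb n t) v = phi K (a.coeff n * t) • v
  apply_y5 : ∀ v, ρ (QuotientGroup.mk (y5 a)) v = sgn e.1 • v
  apply_y69 : ∀ v, ρ (QuotientGroup.mk (y69 a)) v = sgn e.2.1 • v
  apply_y7 : ∀ v, ρ (QuotientGroup.mk (y7 a)) v = sgn e.2.2 • v

/-- Central root elements act by scalars. -/
theorem IsWeightVector.apply_of_mem_coreZ {ρ : Representation ℂ (Quattern K coreS) V} {b : ℕ → K}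
    {v : V} (h : IsWeightVector ρ b v) (hv : v ≠ 0) (hρ : ρ.IsIrreducible) {n : ℕ}
    (hn : n ∈ coreZ) (t : K) (w : V) : ρ (xb n t) w = phi K (b n * t) • w := by
  have hA : ∀ n ∈ coreZ, n ∈ coreA := by decide
  exact h.apply_eq_smul hv hρ
    (fun s => h.apply_of_commute (hA n hn) (commute_xb_of_mem_coreZ hn t _).symm) w

variable [Finite K]

/-- The labels of an irreducible representation can be read off from a weight vector. -/
theorem hasLabels_of_isWeightVector {ρ : Representation ℂ (Quattern K coreS) V} {a : ALabel K}
    {e : Bits} {b : ℕ → K} {v : V} (hρ : ρ.IsIrreducible) (hv : v ≠ 0) (h : IsWeightVector ρ b v)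
    (hZ : ∀ n ∈ coreZ, b n = a.coeff n)
    (h5 : phi K (b 5 * ((a.a11 : K) / (a.a8 : K) ^ 2)) = sgn e.1)
    (h69 : phi K (b 6 * ((a.a8 : K) * a.a16 / ((a.a10 : K) ^ 2 * a.a11)) +
      b 9 * ((a.a8 : K) ^ 2 * a.a16 / ((a.a10 : K) ^ 2 * (a.a11 : K) ^ 2))) = sgn e.2.1)
    (h7 : phi K (b 7 * ((a.a10 : K) / a.a16)) = sgn e.2.2) : HasLabels ρ a e := by
  have ha8 := a.a8.ne_zero
  have ha10 := a.a10.ne_zero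
  have ha11 := a.a11.ne_zero
  have ha16 := a.a16.ne_zero
  have hb8 := (hZ 8 (by decide)).trans (coeff_8 a)
  have hb10 := (hZ 10 (by decide)).trans (coeff_10 a)
  have hb11 := (hZ 11 (by decide)).trans (coeff_11 a)
  have hb16 := (hZ 16 (by decide)).trans (coeff_16 a)
  -- each value of `φ` in question changes by a factor `φ(z + z²) = 1` under translation
  have hz : ∀ z : K, phi K (z + z ^ 2) = 1 := fun z => by rw [phi_add, phi_sq, phi_mul_self]
  have hshift := fun s : Fin 4 → K => exists_sq_eq (b 16 * s 1)
  refine ⟨hρ, fun n hn t => hZ n hn ▸ h.apply_of_mem_coreZ hv hρ hn t,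
    h.apply_eq_smul hv hρ fun s => ?_, h.apply_eq_smul hv hρ fun s => ?_,
    h.apply_eq_smul hv hρ fun s => ?_⟩
  all_goals obtain ⟨r, hr⟩ := hshift s
  all_goals have hs := h.apply_pElt s hr
  · rw [mk_y5, hs 5 (by decide), ← h5, ← mul_one (phi K (b 5 * _)),
      ← hz ((a.a11 : K) / (a.a8 : K) * s 2), ← phi_add]
    congr 2
    simp [hb8, hb11]
    field_simp
  · rw [mk_y69, hs.apply_mul (by decide) (by decide), ← h69, ← mul_one (phi K (b 6 * _ + _)),
      ← hz ((a.a8 : K) * a.a16 / (a.a10 * a.a11) * s 3), ← phi_add]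
    congr 2
    simp [hb8, hb10, hb11, hb16]
    field_simp
    linear_combination (a.a8 * a.a11 * s 0 : K) * CharTwo.two_eq_zero (R := K)
  · rw [mk_y7, hs 7 (by decide), ← h7, ← mul_one (phi K (b 7 * _)),
      ← hz ((a.a10 : K) / a.a16 * r), ← phi_add]
    congr 2
    simp [hb10]
    have hs1 : s 1 = r ^ 2 / a.a16 := by
      rw [hr, hb16, mul_div_cancel_left₀ _ ha16]
    rw [hs1]
    field_simp
    ring

end Labels

/-! ### The standard weight for given labels -/

section Base

open Module

variable {K : Type*} [Field K]

/-- A weight with label `a` for which the elements `y₅, y_{6,9}, y₇` act by the signs given by `e`;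
here `τ` is an element with `φ(τ) = -1`. -/
def baseWeight (a : ALabel K) (τ : K) (e : Bits) : ℕ → K
  | 5 => if e.1 then τ * (a.a8 : K) ^ 2 / a.a11 else 0
  | 6 => if e.2.1 then τ * ((a.a10 : K) ^ 2 * a.a11) / (a.a8 * a.a16) else 0
  | 7 => if e.2.2 then τ * a.a16 / a.a10 else 0
  | 9 => 0
  | n => a.coeff n

theorem baseWeight_of_mem (a : ALabel K) (τ : K) (e : Bits) {n : ℕ} (hn : n ∈ coreZ) :
    baseWeight a τ e n = a.coeff n := by
  simp only [coreZ, Finset.mem_insert, Finset.mem_singleton] at hn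
  rcases hn with rfl | rfl | rfl | rfl <;> rfl

variable [CharP K 2]

theorem phi_cond {τ : K} (hτ : phi K τ = -1) (b : Bool) : phi K (if b then τ else 0) = sgn b := by
  cases b
  · simp [phi_zero, sgn]
  · simp [hτ, sgn]

theorem phi_baseWeight (a : ALabel K) {τ : K} (hτ : phi K τ = -1) (e : Bits) :
    phi K (baseWeight a τ e 5 * ((a.a11 : K) / (a.a8 : K) ^ 2)) = sgn e.1 ∧
    phi K (baseWeight a τ e 6 * ((a.a8 : K) * a.a16 / ((a.a10 : K) ^ 2 * a.a11)) +
      baseWeight a τ e 9 * ((a.a8 : K) ^ 2 * a.a16 / ((a.a10 : K) ^ 2 * (a.a11 : K) ^ 2))) =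
        sgn e.2.1 ∧
    phi K (baseWeight a τ e 7 * ((a.a10 : K) / a.a16)) = sgn e.2.2 := by
  have ha8 := a.a8.ne_zero
  have ha10 := a.a10.ne_zero
  have ha11 := a.a11.ne_zero
  have ha16 := a.a16.ne_zero
  refine ⟨?_, ?_, ?_⟩
  · rw [← phi_cond hτ]
    congr 1
    simp only [baseWeight]
    split_ifs
    · field_simp
    · rw [zero_mul]
  · rw [← phi_cond hτ]
    congr 1
    simp only [baseWeight]
    rw [zero_mul, add_zero]
    split_ifs
    · field_simp
    · rw [zero_mul]
  · rw [← phi_cond hτ]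
    congr 1
    simp only [baseWeight]
    split_ifs
    · field_simp
    · rw [zero_mul]

variable [Finite K] {V : Type*} [AddCommGroup V] [Module ℂ V]

/-- Weights with the same labels are conjugate. The translating element is found by solving
quadratic equations, which is possible by Hilbert's Theorem 90. -/
theorem IsWeightVector.exists_translate {ρ : Representation ℂ (Quattern K coreS) V} {a : ALabel K}
    {b b' : ℕ → K} {v : V} (h : IsWeightVector ρ b v) (hZ : ∀ n ∈ coreZ, b n = a.coeff n)
    (hZ' : ∀ n ∈ coreZ, b' n = a.coeff n)
    (h5 : phi K (b 5 * ((a.a11 : K) / (a.a8 : K) ^ 2)) =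
      phi K (b' 5 * ((a.a11 : K) / (a.a8 : K) ^ 2)))
    (h69 : phi K (b 6 * ((a.a8 : K) * a.a16 / ((a.a10 : K) ^ 2 * a.a11)) +
      b 9 * ((a.a8 : K) ^ 2 * a.a16 / ((a.a10 : K) ^ 2 * (a.a11 : K) ^ 2))) =
      phi K (b' 6 * ((a.a8 : K) * a.a16 / ((a.a10 : K) ^ 2 * a.a11)) +
      b' 9 * ((a.a8 : K) ^ 2 * a.a16 / ((a.a10 : K) ^ 2 * (a.a11 : K) ^ 2))))
    (h7 : phi K (b 7 * ((a.a10 : K) / a.a16)) = phi K (b' 7 * ((a.a10 : K) / a.a16))) :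
    ∃ s, IsWeightVector ρ b' (ρ (pElt s) v) := by
  have ha8 := a.a8.ne_zero
  have ha10 := a.a10.ne_zero
  have ha11 := a.a11.ne_zero
  have ha16 := a.a16.ne_zero
  have hb8 := (hZ 8 (by decide)).trans (coeff_8 a)
  have hb10 := (hZ 10 (by decide)).trans (coeff_10 a)
  have hb11 := (hZ 11 (by decide)).trans (coeff_11 a)
  have hb16 := (hZ 16 (by decide)).trans (coeff_16 a)
  have h90 : ∀ c d : K, phi K c = phi K d → ∃ z, z + z ^ 2 = c + d := fun c d hcd =>
    exists_add_sq_eq (by rw [phi_add, hcd, phi_mul_self])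
  obtain ⟨z5, hz5⟩ := h90 _ _ h5
  obtain ⟨z6, hz6⟩ := h90 _ _ h69
  obtain ⟨z7, hz7⟩ := h90 _ _ h7
  have h2 : (2 : K) = 0 := CharTwo.two_eq_zero
  -- with these simple coordinates, the changes in the weights at `α₅`, `α₆`, `α₇`, `α₉` that
  -- `apply_pElt` gives become `b + b'`; at `α₇` the square root in `hr` enters
  let s3 : K := a.a10 * a.a11 / (a.a8 * a.a16) * z6
  let s : Fin 4 → K := ![(b 6 + b' 6 + a.a10 * s3) / a.a8, a.a16 / (a.a10 : K) ^ 2 * z7 ^ 2,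
    a.a8 / a.a11 * z5, s3]
  have hr : ((a.a16 / a.a10 : K) * z7) ^ 2 = b 16 * s 1 := by
    simp only [s, hb16, Matrix.cons_val]
    field_simp
  refine ⟨s, (h.apply_pElt s hr).congr fun n hn => ?_⟩
  simp only [coreA, List.mem_cons, List.not_mem_nil, or_false] at hn
  have e8 : b 8 = b' 8 := (hZ 8 (by decide)).trans (hZ' 8 (by decide)).symm
  have e10 : b 10 = b' 10 := (hZ 10 (by decide)).trans (hZ' 10 (by decide)).symm
  have e11 : b 11 = b' 11 := (hZ 11 (by decide)).trans (hZ' 11 (by decide)).symm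
  have e16 : b 16 = b' 16 := (hZ 16 (by decide)).trans (hZ' 16 (by decide)).symm
  rcases hn with rfl | rfl | rfl | rfl | rfl | rfl | rfl | rfl
  · simp [hb8, hb11, s]
    have : (b 5 + (a.a8 ^ 2 / a.a11 : K) * (z5 + z5 ^ 2)) = b' 5 := by
      rw [hz5]
      field_simp
      linear_combination (b 5) * h2
    rw [← this]
    field_simp
  · simp [hb8, hb10, s]
    field_simp
    linear_combination (b 6 + a.a10 * s3) * h2
  · simp [hb10, s]
    have : (b 7 + (a.a16 / a.a10 : K) * (z7 + z7 ^ 2)) = b' 7 := by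
      rw [hz7]
      field_simp
      linear_combination (b 7) * h2
    rw [← this]
    field_simp
    ring
  · simpa using e8
  · simp [hb11, hb16, s]
    have : b 9 + ((a.a11 / a.a8 : K) * (b 6 + b' 6) +
        (a.a10 ^ 2 * a.a11 ^ 2 / (a.a8 ^ 2 * a.a16) : K) * (z6 + z6 ^ 2)) = b' 9 := by
      rw [hz6]
      field_simp
      linear_combination (b 9 * a.a8 + a.a11 * (b 6 + b' 6)) * h2
    rw [← this]
    simp only [s3]
    field_simp
    ring
  · simpa using e10
  · simpa using e11
  · simpa using e16

/-- In a representation with given labels, the standard weight occurs: some weight occurs, and it is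
conjugate to the standard one. -/
theorem HasLabels.exists_isWeightVector [FiniteDimensional ℂ V]
    {ρ : Representation ℂ (Quattern K coreS) V} {a : ALabel K} {e : Bits} (h : HasLabels ρ a e)
    {τ : K} (hτ : phi K τ = -1) : ∃ v, v ≠ 0 ∧ IsWeightVector ρ (baseWeight a τ e) v := by
  have := ((isIrreducible_iff ρ).1 h.irreducible).1
  obtain ⟨v, hv, b, hb⟩ := UF4.exists_isWeightVector ρ
  have hinj := smul_left_injective ℂ hv
  have hA : ∀ n ∈ coreZ, n ∈ coreA := by decide
  have h1 := phi_baseWeight a hτ e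
  obtain ⟨s, hs⟩ := hb.exists_translate (a := a) (b' := baseWeight a τ e)
    (fun n hn => eq_of_phi_mul_eq fun t => hinj (by
      simp only; rw [← h.apply_center n hn, ← hb n (hA n hn)]))
    (fun n hn => baseWeight_of_mem a τ e hn)
    (h1.1 ▸ hinj (by simp only; rw [← h.apply_y5, mk_y5, hb 5 (by decide)]))
    (h1.2.1 ▸ hinj (by
      simp only; rw [← h.apply_y69, mk_y69, hb.apply_mul (by decide) (by decide)]))
    (h1.2.2 ▸ hinj (by simp only; rw [← h.apply_y7, mk_y7, hb 7 (by decide)]))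
  refine ⟨_, fun h0 => hv ?_, hs⟩
  have : ρ (pElt s)⁻¹ (ρ (pElt s) v) = v := by
    rw [← End.mul_apply, ← map_mul, inv_mul_cancel, map_one, End.one_apply]
  rw [← this, h0, map_zero]

/-- An irreducible representation that contains the standard weight has the given labels. -/
theorem exists_hasLabels (a : ALabel K) (e : Bits) :
    ∃ (m : ℕ) (ρ : Representation ℂ (Quattern K coreS) (Fin m → ℂ)), HasLabels ρ a e := by
  obtain ⟨τ, hτ⟩ := exists_phi_eq_neg_one (K := K)
  obtain ⟨m, ρ, v, hρ, hv, h⟩ := exists_irreducible_isWeightVector (baseWeight a τ e)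
  have h1 := phi_baseWeight a hτ e
  exact ⟨m, ρ, hasLabels_of_isWeightVector hρ hv h (fun n hn => baseWeight_of_mem a τ e hn)
    h1.1 h1.2.1 h1.2.2⟩

end Base

/-! ### The involutions `p₁, p₂, p₃` -/

section Involutions

open Module

variable {K : Type*} [Field K]

/-- The simple coordinates of the products of the involutions `p₁, p₂, p₃`. -/
def pvec (a : ALabel K) (c : Bits) : Fin 4 → K :=
  ![if c.1 then (a.a10 : K) ^ 2 * a.a11 / ((a.a8 : K) ^ 2 * a.a16) else 0,
    if c.2.1 then (a.a16 : K) / (a.a10 : K) ^ 2 else 0,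
    if c.2.2 then (a.a8 : K) / a.a11 else 0,
    if c.1 then (a.a10 : K) * a.a11 / ((a.a8 : K) * a.a16) else 0]

/-- The involution `p₁ ∈ X₁ X₄`. -/
def p1 (a : ALabel K) : Quattern K coreS :=
  xb 1 ((a.a10 : K) ^ 2 * a.a11 / ((a.a8 : K) ^ 2 * a.a16)) *
    xb 4 ((a.a10 : K) * a.a11 / ((a.a8 : K) * a.a16))

/-- The involution `p₂ ∈ X₂`. -/
def p2 (a : ALabel K) : Quattern K coreS := xb 2 ((a.a16 : K) / (a.a10 : K) ^ 2)

/-- The involution `p₃ ∈ X₃`. -/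
def p3 (a : ALabel K) : Quattern K coreS := xb 3 ((a.a8 : K) / a.a11)

/-- The products of the involutions `p₁, p₂, p₃`. -/
def pProd (a : ALabel K) (c : Bits) : Quattern K coreS :=
  (if c.1 then p1 a else 1) * ((if c.2.1 then p2 a else 1) * (if c.2.2 then p3 a else 1))

theorem pvec_injective (a : ALabel K) : Function.Injective (pvec a) := by
  have ha8 := a.a8.ne_zero
  have ha10 := a.a10.ne_zero
  have ha11 := a.a11.ne_zero
  have ha16 := a.a16.ne_zero
  have key : ∀ (b c : Bool) {z : K}, z ≠ 0 →
      ((if b then z else 0) = if c then z else 0) → b = c := by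
    intro b c z hz h
    cases b <;> cases c <;> simp_all
  intro c d h
  have h0 := congrFun h 0
  have h1 := congrFun h 1
  have h2 := congrFun h 2
  simp only [pvec, Matrix.cons_val] at h0 h1 h2
  exact Prod.ext (key _ _ (by simp [*]) h0)
    (Prod.ext (key _ _ (by simp [*]) h1) (key _ _ (by simp [*]) h2))

theorem pProd_zero (a : ALabel K) : pProd a (false, false, false) = 1 := by simp [pProd]

/-- Group elements whose commutator acts by a sign commute up to this sign. -/
theorem signCommute_of_eq {V : Type*} [AddCommGroup V] [Module ℂ V]
    {ρ : Representation ℂ (Quattern K coreS) V} {g h y : Quattern K coreS} {b : Bool}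
    (hgh : g * h = h * g * y) (hy : ∀ v, ρ y v = sgn b • v) : SignCommute b (ρ g) (ρ h) := by
  refine LinearMap.ext fun v => ?_
  rw [← map_mul, hgh, map_mul, map_mul, End.mul_apply, hy, map_smul]
  rfl

variable [CharP K 2]

theorem pvec_add (a : ALabel K) (c d : Bits) : pvec a c + pvec a d = pvec a (badd c d) := by
  have key : ∀ (b c : Bool) (z : K),
      ((if b then z else 0) + if c then z else 0) = if xor b c then z else 0 := by
    intro b c z
    cases b <;> cases c <;> simp [CharTwo.add_self_eq_zero]
  ext i
  fin_cases i <;> simp [pvec, badd, key]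

theorem p1_mul_self (a : ALabel K) : p1 a * p1 a = 1 := by
  rw [p1, mul_assoc, ← mul_assoc (xb 4 _) (xb 1 _), ← (xb_commute (m := 1) (n := 4) (by decide)
    (by decide) (by decide) (by decide) _ _).eq, mul_assoc, xb_mul_self, mul_one, xb_mul_self]

theorem p2_mul_self (a : ALabel K) : p2 a * p2 a = 1 := xb_mul_self _ _

theorem p1_mul_p2 (a : ALabel K) :
    p1 a * p2 a = p2 a * p1 a * QuotientGroup.mk (y5 a) := by
  have ha10 := a.a10.ne_zero
  have ha16 := a.a16.ne_zero
  have e : (a.a10 : K) ^ 2 * a.a11 / ((a.a8 : K) ^ 2 * a.a16) * (a.a16 / (a.a10 : K) ^ 2) =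
      (a.a11 : K) / (a.a8 : K) ^ 2 := by
    field_simp
  rw [p1, p2, mk_y5, mul_assoc, ← (xb_commute (m := 2) (n := 4) (by decide) (by decide)
    (by decide) (by decide) _ _).eq, ← mul_assoc, xb_comm_1_2, e, mul_assoc,
    (xb_commute (m := 5) (n := 4) (by decide) (by decide) (by decide) (by decide) _ _).eq]
  simp only [mul_assoc]

theorem p2_mul_p3 (a : ALabel K) :
    p2 a * p3 a = p3 a * p2 a * QuotientGroup.mk (y69 a) := by
  have e1 : (a.a16 : K) / (a.a10 : K) ^ 2 * (a.a8 / a.a11) =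
      (a.a8 : K) * a.a16 / ((a.a10 : K) ^ 2 * a.a11) := by ring
  have e2 : (a.a16 : K) / (a.a10 : K) ^ 2 * (a.a8 / a.a11) ^ 2 =
      (a.a8 : K) ^ 2 * a.a16 / ((a.a10 : K) ^ 2 * (a.a11 : K) ^ 2) := by ring
  rw [p2, p3, mk_y69, xb_comm_2_3, e1, e2]

theorem p3_mul_p1 (a : ALabel K) :
    p3 a * p1 a = p1 a * p3 a * QuotientGroup.mk (y7 a) := by
  have ha8 := a.a8.ne_zero
  have ha11 := a.a11.ne_zero
  have e : (a.a8 : K) / a.a11 * (a.a10 * a.a11 / (a.a8 * a.a16)) = (a.a10 : K) / a.a16 := by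
    field_simp
  rw [p1, p3, mk_y7, ← mul_assoc, (xb_commute (m := 3) (n := 1) (by decide) (by decide)
    (by decide) (by decide) _ _).eq, mul_assoc, xb_comm_3_4, e]
  simp only [mul_assoc]

theorem simpleCoord_pProd (a : ALabel K) (c : Bits) :
    simpleCoord (pProd a c) = Multiplicative.ofAdd (pvec a c) := by
  have h1 : simpleCoord (p1 a) = Multiplicative.ofAdd (pvec a (true, false, false)) := by
    rw [p1, map_mul, simpleCoord_xb (by decide), simpleCoord_xb (by decide), ← ofAdd_add]
    congr 1
    ext i
    fin_cases i <;> simp [pvec]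
  have h2 : simpleCoord (p2 a) = Multiplicative.ofAdd (pvec a (false, true, false)) := by
    rw [p2, simpleCoord_xb (by decide)]
    congr 1
    ext i
    fin_cases i <;> simp [pvec]
  have h3 : simpleCoord (p3 a) = Multiplicative.ofAdd (pvec a (false, false, true)) := by
    rw [p3, simpleCoord_xb (by decide)]
    congr 1
    ext i
    fin_cases i <;> simp [pvec]
  have h0 : Multiplicative.ofAdd (pvec a (false, false, false)) = 1 := by
    rw [← ofAdd_zero]
    congr 1
    ext i
    fin_cases i <;> simp [pvec]
  obtain ⟨c1, c2, c3⟩ := c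
  have e : pvec a (c1, c2, c3) = pvec a (c1, false, false) + (pvec a (false, c2, false) +
      pvec a (false, false, c3)) := by
    rw [pvec_add, pvec_add]
    simp [badd]
  rw [e, ofAdd_add, ofAdd_add, pProd, map_mul, map_mul]
  congr 1
  · cases c1
    · rw [h0]; simp
    · exact h1
  · congr 1
    · cases c2
      · rw [h0]; simp
      · exact h2
    · cases c3
      · rw [h0]; simp
      · exact h3

theorem exists_eq_mul_aElt {g h : Quattern K coreS} (hgh : simpleCoord g = simpleCoord h) :
    ∃ t, g = h * aElt t := by
  have h1 : h⁻¹ * g ∈ subA K := by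
    rw [← ker_simpleCoord, MonoidHom.mem_ker, map_mul, map_inv, hgh, inv_mul_cancel]
  obtain ⟨t, ht⟩ := mem_subA.1 h1
  exact ⟨t, by rw [← ht, mul_inv_cancel_left]⟩

/-- Modulo the elementary abelian normal subgroup, the involutions generate an elementary abelian
group. -/
theorem pProd_mul_pProd (a : ALabel K) (c d : Bits) :
    ∃ t, pProd a c * pProd a d = pProd a (badd c d) * aElt t :=
  exists_eq_mul_aElt (by
    rw [map_mul, simpleCoord_pProd, simpleCoord_pProd, simpleCoord_pProd, ← ofAdd_add, pvec_add])

theorem pProd_isoU_mul_self (a : ALabel K) (e : Bits) :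
    pProd a (isoU e) * pProd a (isoU e) = 1 := by
  have h : ∀ e, isoU e = (false, false, false) ∨ isoU e = (true, false, false) ∨
      isoU e = (false, true, false) := by decide
  rcases h e with h | h | h
  · simp [h, pProd]
  · simpa [h, pProd] using p1_mul_self a
  · rw [h]
    simpa [pProd] using p2_mul_self a

variable {V : Type*} [AddCommGroup V] [Module ℂ V] {ρ : Representation ℂ (Quattern K coreS) V}
  {a : ALabel K} {e : Bits}

/-- The involutions commute up to the signs that are given by the labels `e`. -/
theorem HasLabels.signCommute (h : HasLabels ρ a e) (c d : Bits) :
    SignCommute (form e c d) (ρ (pProd a c)) (ρ (pProd a d)) := by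
  have h12 := signCommute_of_eq (p1_mul_p2 a) h.apply_y5
  have h23 := signCommute_of_eq (p2_mul_p3 a) h.apply_y69
  have h31 := signCommute_of_eq (p3_mul_p1 a) h.apply_y7
  have hP : ∀ c, ρ (pProd a c) = (if c.1 then ρ (p1 a) else 1) *
      ((if c.2.1 then ρ (p2 a) else 1) * (if c.2.2 then ρ (p3 a) else 1)) := by
    intro c
    simp only [pProd, map_mul, apply_ite ρ, map_one]
  have hd : ∀ {f : End ℂ V} {b1 b2 b3 : Bool} (d : Bits), SignCommute b1 f (ρ (p1 a)) →
      SignCommute b2 f (ρ (p2 a)) → SignCommute b3 f (ρ (p3 a)) →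
      SignCommute (xor (d.1 && b1) (xor (d.2.1 && b2) (d.2.2 && b3))) f (ρ (pProd a d)) := by
    intro f b1 b2 b3 d H1 H2 H3
    rw [hP]
    exact (H1.cond_right _).mul_right ((H2.cond_right _).mul_right (H3.cond_right _))
  have H1 := hd d (.refl _) h12 h31.symm
  have H2 := hd d h12.symm (.refl _) h23
  have H3 := hd d h31 h23.symm (.refl _)
  have H := (hd c H1.symm H2.symm H3.symm).symm
  have e1 : form e c d = xor (c.1 && xor (d.1 && false) (xor (d.2.1 && e.1) (d.2.2 && e.2.2)))
      (xor (c.2.1 && xor (d.1 && e.1) (xor (d.2.1 && false) (d.2.2 && e.2.1)))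
        (c.2.2 && xor (d.1 && e.2.2) (xor (d.2.1 && e.2.1) (d.2.2 && false)))) := by
    simp [form]
  rw [e1]
  exact H

end Involutions

/-! ### Inertia groups -/

section Inertia

open Module

variable {K : Type*} [Field K] [CharP K 2]

section

variable {V : Type*} [AddCommGroup V] [Module ℂ V]
  {ρ : Representation ℂ (Quattern K coreS) V} {a : ALabel K} {b b' : ℕ → K} {v : V}

theorem apply_inv_apply {G : Type*} [Group G] (ρ : Representation ℂ G V) (g : G) (v : V) :
    ρ g⁻¹ (ρ g v) = v := by
  rw [← End.mul_apply, ← map_mul, inv_mul_cancel, map_one, End.one_apply]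

theorem apply_ne_zero {G : Type*} [Group G] (ρ : Representation ℂ G V) (g : G) {v : V}
    (hv : v ≠ 0) : ρ g v ≠ 0 := fun h => hv (by rw [← apply_inv_apply ρ g v, h, map_zero])

variable [Finite K]

theorem IsWeightVector.unique (h : IsWeightVector ρ b v) (h' : IsWeightVector ρ b' v)
    (hv : v ≠ 0) : ∀ n ∈ coreA, b n = b' n := fun n hn =>
  eq_of_phi_mul_eq fun t => smul_left_injective ℂ hv (by simp only; rw [← h n hn, ← h' n hn])

/-- The involutions `p₁, p₂, p₃` stabilize every weight with label `a`. -/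
theorem IsWeightVector.apply_pProd (h : IsWeightVector ρ b v) (hZ : ∀ n ∈ coreZ, b n = a.coeff n)
    (c : Bits) : IsWeightVector ρ b (ρ (pProd a c) v) := by
  have ha8 := a.a8.ne_zero
  have ha10 := a.a10.ne_zero
  have ha11 := a.a11.ne_zero
  have ha16 := a.a16.ne_zero
  have hb8 := (hZ 8 (by decide)).trans (coeff_8 a)
  have hb10 := (hZ 10 (by decide)).trans (coeff_10 a)
  have hb11 := (hZ 11 (by decide)).trans (coeff_11 a)
  have hb16 := (hZ 16 (by decide)).trans (coeff_16 a)
  have h2 : ∀ z w : K, z = w → z + w = 0 := fun z w h => h ▸ CharTwo.add_self_eq_zero z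
  obtain ⟨t, ht⟩ := exists_eq_mul_aElt (g := pProd a c) (h := pElt (pvec a c)) (by
    rw [simpleCoord_pProd, simpleCoord_pElt])
  rw [ht, map_mul, End.mul_apply, h.apply_aElt, map_smul]
  refine IsWeightVector.smul ?_ _
  have hr : (if c.2.1 then (a.a16 : K) / a.a10 else 0) ^ 2 = b 16 * pvec a c 1 := by
    simp only [pvec, Matrix.cons_val, hb16]
    split_ifs
    · field_simp
    · simp
  refine (h.apply_pElt _ hr).congr fun n hn => ?_
  have e5 : b 8 * pvec a c 2 + b 11 * pvec a c 2 ^ 2 = 0 := by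
    refine h2 _ _ ?_
    simp only [pvec, Matrix.cons_val, hb8, hb11]
    split_ifs
    · field_simp
    · simp
  have e6 : b 8 * pvec a c 0 + b 10 * pvec a c 3 = 0 := by
    refine h2 _ _ ?_
    simp only [pvec, Matrix.cons_val, hb8, hb10]
    split_ifs
    · field_simp
    · simp
  have e7 : b 10 * pvec a c 1 + (if c.2.1 then (a.a16 : K) / a.a10 else 0) = 0 := by
    refine h2 _ _ ?_
    simp only [pvec, Matrix.cons_val, hb10]
    split_ifs
    · field_simp
    · simp
  have e9 : b 11 * pvec a c 0 + b 16 * pvec a c 3 ^ 2 = 0 := by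
    refine h2 _ _ ?_
    simp only [pvec, Matrix.cons_val, hb11, hb16]
    split_ifs
    · field_simp
    · simp
  rw [e5, e6, e7, e9]
  simp

/-- Modulo the elementary abelian normal subgroup, the stabilizer of a weight with label `a` is
generated by the involutions `p₁, p₂, p₃`. -/
theorem IsWeightVector.exists_eq_pProd_mul_aElt (h : IsWeightVector ρ b v)
    (hZ : ∀ n ∈ coreZ, b n = a.coeff n) (hv : v ≠ 0) {g : Quattern K coreS}
    (hg : IsWeightVector ρ b (ρ g v)) : ∃ c t, g = pProd a c * aElt t := by
  have ha8 := a.a8.ne_zero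
  have ha10 := a.a10.ne_zero
  have ha11 := a.a11.ne_zero
  have ha16 := a.a16.ne_zero
  have hb8 := (hZ 8 (by decide)).trans (coeff_8 a)
  have hb10 := (hZ 10 (by decide)).trans (coeff_10 a)
  have hb11 := (hZ 11 (by decide)).trans (coeff_11 a)
  have hb16 := (hZ 16 (by decide)).trans (coeff_16 a)
  obtain ⟨t, ht⟩ := UF4.exists_eq_pElt_mul_aElt g
  set s := (simpleCoord g).toAdd with hs
  obtain ⟨r, hr⟩ := exists_sq_eq (b 16 * s 1)
  have h1 : IsWeightVector ρ b (ρ (pElt s) v) := by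
    have := hg.smul (weightChar b t)⁻¹
    rwa [ht, map_mul, End.mul_apply, h.apply_aElt, map_smul, smul_smul,
      inv_mul_cancel₀ (weightChar_ne_zero b t), one_smul] at this
  have h2 := (h.apply_pElt s hr).unique h1 (apply_ne_zero ρ _ hv)
  have h5 := h2 5 (by decide)
  have h6 := h2 6 (by decide)
  have h7 := h2 7 (by decide)
  have h9 := h2 9 (by decide)
  simp [hb8, hb11] at h5
  simp [hb8, hb10] at h6
  simp [hb10] at h7
  simp [hb11, hb16] at h9
  rw [hb16] at hr
  -- each of the equations for `s` is quadratic, with two solutions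
  have hs2 : s 2 = 0 ∨ s 2 = a.a8 / a.a11 := by
    have : s 2 * (s 2 + a.a8 / a.a11) = 0 := by
      field_simp
      linear_combination h5
    exact (mul_eq_zero.1 this).imp id CharTwo.add_eq_zero.1
  have hs1 : s 1 = 0 ∨ s 1 = a.a16 / (a.a10 : K) ^ 2 := by
    have h7' : r = a.a10 * s 1 := (CharTwo.add_eq_zero.1 h7).symm
    rw [h7'] at hr
    have : s 1 * (s 1 + a.a16 / (a.a10 : K) ^ 2) = 0 := by
      field_simp
      linear_combination hr + s 1 * a.a16 * CharTwo.two_eq_zero (R := K)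
    exact (mul_eq_zero.1 this).imp id CharTwo.add_eq_zero.1
  have hs0 : s 0 = a.a10 * s 3 / a.a8 := by
    rw [eq_div_iff ha8, ← CharTwo.add_eq_zero]
    linear_combination h6
  have hs3 : s 3 = 0 ∨ s 3 = a.a10 * a.a11 / ((a.a8 : K) * a.a16) := by
    have : s 3 * (s 3 + a.a10 * a.a11 / ((a.a8 : K) * a.a16)) = 0 := by
      rw [hs0] at h9
      field_simp at h9 ⊢
      linear_combination h9
    exact (mul_eq_zero.1 this).imp id CharTwo.add_eq_zero.1
  -- the simple coordinates of `g` are those of a product of the involutions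
  obtain ⟨c3, hc3⟩ : ∃ c : Bool, s 2 = if c then (a.a8 : K) / a.a11 else 0 := by
    rcases hs2 with h | h
    · exact ⟨false, h⟩
    · exact ⟨true, h⟩
  obtain ⟨c2, hc2⟩ : ∃ c : Bool, s 1 = if c then (a.a16 : K) / (a.a10 : K) ^ 2 else 0 := by
    rcases hs1 with h | h
    · exact ⟨false, h⟩
    · exact ⟨true, h⟩
  obtain ⟨c1, hc1⟩ : ∃ c : Bool,
      s 3 = if c then (a.a10 : K) * a.a11 / ((a.a8 : K) * a.a16) else 0 := by
    rcases hs3 with h | h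
    · exact ⟨false, h⟩
    · exact ⟨true, h⟩
  refine ⟨(c1, c2, c3), exists_eq_mul_aElt ?_⟩
  rw [simpleCoord_pProd, ← ofAdd_toAdd (simpleCoord g), ← hs]
  congr 1
  ext i
  fin_cases i
  · cases c1
    · simp [hs0, hc1, pvec]
    · simp [hs0, hc1, pvec]
      field_simp
  · simp [hc2, pvec]
  · simp [hc3, pvec]
  · simp [hc1, pvec]

end

/-- The set of simple coordinates of the elements of `inertia a e`. -/
def inertiaCoord (a : ALabel K) (e : Bits) : Subgroup (Multiplicative (Fin 4 → K)) where
  carrier := {s | ∃ c, inC e c = true ∧ s = Multiplicative.ofAdd (pvec a c)}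
  one_mem' := ⟨(false, false, false), inC_zero e, by
    have := simpleCoord_pProd a (false, false, false)
    rw [pProd_zero, map_one] at this
    exact this⟩
  mul_mem' := by
    rintro _ _ ⟨c, hc, rfl⟩ ⟨d, hd, rfl⟩
    exact ⟨badd c d, inC_badd hc hd, by rw [← ofAdd_add, pvec_add]⟩
  inv_mem' := by
    rintro _ ⟨c, hc, rfl⟩
    refine ⟨c, hc, ?_⟩
    rw [← ofAdd_neg]
    congr 1
    ext i
    exact CharTwo.neg_eq _

/-- The subgroup of `X_S` generated by the elementary abelian normal subgroup and those products of
the involutions `p₁, p₂, p₃` that belong to a maximal isotropic subspace for `form e`. -/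
def inertia (a : ALabel K) (e : Bits) : Subgroup (Quattern K coreS) :=
  (inertiaCoord a e).comap simpleCoord

instance (a : ALabel K) (e : Bits) : (inertia a e).Normal :=
  Subgroup.Normal.comap inferInstance _

theorem mem_inertia {a : ALabel K} {e : Bits} {g : Quattern K coreS} :
    g ∈ inertia a e ↔ ∃ c, inC e c = true ∧ ∃ t, g = pProd a c * aElt t := by
  constructor
  · rintro ⟨c, hc, h⟩
    exact ⟨c, hc, exists_eq_mul_aElt (h.trans (simpleCoord_pProd a c).symm)⟩
  · rintro ⟨c, hc, t, rfl⟩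
    refine ⟨c, hc, ?_⟩
    rw [map_mul, simpleCoord_pProd, simpleCoord_aElt, mul_one]

/-- In the quotient `K⁴` of `X_S`, the image of `inertia a e` is in bijection with the isotropic
subspace. -/
theorem index_inertia [Finite K] (a : ALabel K) (e : Bits) :
    (inertia a e).index * Nat.card {c // inC e c = true} = Nat.card K ^ 4 := by
  have h1 : Nat.card (inertiaCoord a e) = Nat.card {c // inC e c = true} := by
    refine (Nat.card_congr (Equiv.ofBijective (fun c : {c // inC e c = true} =>
      (⟨Multiplicative.ofAdd (pvec a c), c, c.2, rfl⟩ : inertiaCoord a e)) ⟨?_, ?_⟩)).symm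
    · intro c d h
      exact Subtype.ext (pvec_injective a (Multiplicative.ofAdd.injective (congrArg Subtype.val h)))
    · rintro ⟨_, c, hc, rfl⟩
      exact ⟨⟨c, hc⟩, rfl⟩
  rw [inertia, Subgroup.index_comap_of_surjective _ simpleCoord_surjective, ← h1,
    Subgroup.index_mul_card]
  change Nat.card (Fin 4 → K) = _
  rw [Nat.card_fun, Nat.card_fin]

/-! ### Stable vectors in representations with given labels -/

/-- A weight vector for the standard weight on which the products of the involutions in a maximal
isotropic subspace act by the scalars `ε`. -/
structure IsGood {V : Type*} [AddCommGroup V] [Module ℂ V]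
    (ρ : Representation ℂ (Quattern K coreS) V) (a : ALabel K) (τ : K) (e : Bits) (ε : Bits → ℂ)
    (v : V) : Prop where
  ne_zero : v ≠ 0
  weight : IsWeightVector ρ (baseWeight a τ e) v
  apply_pProd : ∀ c, inC e c = true → ρ (pProd a c) v = ε c • v

section Good

variable {V V' : Type*} [AddCommGroup V] [Module ℂ V] [AddCommGroup V'] [Module ℂ V']
  {ρ : Representation ℂ (Quattern K coreS) V} {ρ' : Representation ℂ (Quattern K coreS) V'}
  {a : ALabel K} {τ : K} {e : Bits} {ε ε' : Bits → ℂ} {v v' : V} {w : V'}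

namespace IsGood

theorem eps_ne_zero (hv : IsGood ρ a τ e ε v) {c : Bits} (hc : inC e c = true) : ε c ≠ 0 := by
  intro h
  refine apply_ne_zero ρ (pProd a c) hv.ne_zero ?_
  rw [hv.apply_pProd c hc, h, zero_smul]

theorem apply_pProd_mul_aElt (hv : IsGood ρ a τ e ε v) {c : Bits} (hc : inC e c = true)
    (t : ℕ → K) :
    ρ (pProd a c * aElt t) v = (ε c * weightChar (baseWeight a τ e) t) • v := by
  rw [map_mul, End.mul_apply, hv.weight.apply_aElt, map_smul, hv.apply_pProd c hc, smul_smul,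
    mul_comm]

theorem eps_zero (hv : IsGood ρ a τ e ε v) : ε (false, false, false) = 1 := by
  have := hv.apply_pProd _ (inC_zero e)
  rw [pProd_zero, map_one, End.one_apply] at this
  exact smul_left_injective ℂ hv.ne_zero (by simp only; rw [← this, one_smul])

/-- The scalars by which products of the involutions act on two good vectors satisfy the same
multiplication rules. -/
theorem eps_mul (hv : IsGood ρ a τ e ε v) (hw : IsGood ρ' a τ e ε' w) {c d : Bits}
    (hc : inC e c = true) (hd : inC e d = true) :
    ∃ z : ℂ, z ≠ 0 ∧ ε c * ε d = z * ε (badd c d) ∧ ε' c * ε' d = z * ε' (badd c d) := by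
  obtain ⟨t, ht⟩ := pProd_mul_pProd a c d
  refine ⟨weightChar (baseWeight a τ e) t, weightChar_ne_zero _ _,
    smul_left_injective ℂ hv.ne_zero ?_, smul_left_injective ℂ hw.ne_zero ?_⟩
  · simp only
    rw [mul_comm _ (ε (badd c d)), ← hv.apply_pProd_mul_aElt (inC_badd hc hd), ← ht, map_mul,
      End.mul_apply, hv.apply_pProd d hd, map_smul, hv.apply_pProd c hc, smul_smul, mul_comm]
  · simp only
    rw [mul_comm _ (ε' (badd c d)), ← hw.apply_pProd_mul_aElt (inC_badd hc hd), ← ht, map_mul,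
      End.mul_apply, hw.apply_pProd d hd, map_smul, hw.apply_pProd c hc, smul_smul, mul_comm]

end IsGood

variable [Finite K]

/-- On the weight space for the standard weight, the products of the involutions in an isotropic
subspace commute, hence they have a common eigenvector. -/
theorem HasLabels.exists_isGood [FiniteDimensional ℂ V] (h : HasLabels ρ a e)
    (hτ : phi K τ = -1) : ∃ ε v, IsGood ρ a τ e ε v := by
  obtain ⟨v₀, hv₀, hw⟩ := h.exists_isWeightVector hτ
  let W : Submodule ℂ V :=
    { carrier := {v | IsWeightVector ρ (baseWeight a τ e) v}
      add_mem' := fun {v w} hv hw n hn t => by rw [map_add, hv n hn, hw n hn, smul_add]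
      zero_mem' := fun n hn t => by rw [map_zero, smul_zero]
      smul_mem' := fun c v hv => hv.smul c }
  obtain ⟨v, hv, hv0, h1⟩ := exists_common_eigenvector (W := W)
    ((Finset.univ.filter fun c => inC e c = true).toList.map fun c => ρ (pProd a c)) (by
      intro f hf g hg
      obtain ⟨c, hc, rfl⟩ := List.mem_map.1 hf
      obtain ⟨d, hd, rfl⟩ := List.mem_map.1 hg
      rw [Finset.mem_toList, Finset.mem_filter] at hc hd
      have := h.signCommute c d
      rw [form_eq_false hc.2 hd.2, SignCommute] at this
      simpa [sgn, commute_iff_eq] using this)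
    (fun h0 => hv₀ ((Submodule.eq_bot_iff _).1 h0 _ hw)) (by
      intro f hf w hw
      obtain ⟨c, -, rfl⟩ := List.mem_map.1 hf
      exact IsWeightVector.apply_pProd hw (fun n hn => baseWeight_of_mem a τ e hn) c)
  have h2 : ∀ c, ∃ z : ℂ, inC e c = true → ρ (pProd a c) v = z • v := by
    intro c
    by_cases hc : inC e c = true
    · obtain ⟨z, hz⟩ := h1 _ (List.mem_map.2 ⟨c, by simpa using hc, rfl⟩)
      exact ⟨z, fun _ => hz⟩
    · exact ⟨0, fun h => absurd h hc⟩
  choose ε hε using h2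
  exact ⟨ε, v, hv0, hv, hε⟩

namespace IsGood

/-- Translating a good vector by a product of the involutions changes signs. -/
theorem translate (hv : IsGood ρ a τ e ε v) (h : HasLabels ρ a e) (d : Bits) :
    IsGood ρ a τ e (fun c => sgn (form e c d) * ε c) (ρ (pProd a d) v) where
  ne_zero := apply_ne_zero ρ _ hv.ne_zero
  weight := hv.weight.apply_pProd (fun n hn => baseWeight_of_mem a τ e hn) d
  apply_pProd c hc := by
    have := LinearMap.congr_fun (h.signCommute c d) v
    rw [LinearMap.smul_apply, End.mul_apply, End.mul_apply, hv.apply_pProd c hc, map_smul,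
      smul_smul] at this
    exact this

/-- A good vector is stable: an element that preserves the eigenvalues of `inertia a e` preserves
the weight, so that it is a product of the involutions, up to the elementary abelian normal
subgroup, and it is orthogonal to `isoU e`, so that it belongs to the isotropic subspace. -/
theorem exists_isStableVector (hv : IsGood ρ a τ e ε v) (h : HasLabels ρ a e) :
    ∃ μ, IsStableVector ρ (inertia a e) μ v ∧
      ∀ c t, inC e c = true →
        μ (pProd a c * aElt t) = ε c * weightChar (baseWeight a τ e) t := by
  have h1 : ∀ g, ∃ z : ℂ, g ∈ inertia a e → ρ g v = z • v := by
    intro g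
    by_cases hg : g ∈ inertia a e
    · obtain ⟨c, hc, t, rfl⟩ := mem_inertia.1 hg
      exact ⟨_, fun _ => hv.apply_pProd_mul_aElt hc t⟩
    · exact ⟨0, fun h => absurd h hg⟩
  choose μ hμ using h1
  have hZ : ∀ n ∈ coreZ, baseWeight a τ e n = a.coeff n := fun n hn => baseWeight_of_mem a τ e hn
  have hμ' : ∀ c t, inC e c = true →
      μ (pProd a c * aElt t) = ε c * weightChar (baseWeight a τ e) t := fun c t hc =>
    smul_left_injective ℂ hv.ne_zero (by
      simp only
      rw [← hμ _ (mem_inertia.2 ⟨c, hc, t, rfl⟩), hv.apply_pProd_mul_aElt hc])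
  refine ⟨μ, ⟨hv.ne_zero, fun g hg => hμ g hg, fun g hg => ?_⟩, hμ'⟩
  have hgw : IsWeightVector ρ (baseWeight a τ e) (ρ g v) := by
    intro n hn t
    have e1 : xb n t = pProd a (false, false, false) * aElt (Pi.single n t) := by
      rw [pProd_zero, one_mul, aElt_single hn]
    have h2 := hg (xb n t) (mem_inertia.2 ⟨_, inC_zero e, _, e1⟩)
    rw [h2, e1, hμ' _ _ (inC_zero e), hv.eps_zero, one_mul, weightChar_single _ hn]
  obtain ⟨c, t, rfl⟩ := hv.weight.exists_eq_pProd_mul_aElt hZ hv.ne_zero hgw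
  refine mem_inertia.2 ⟨c, ?_, t, rfl⟩
  have h2 := hg (pProd a (isoU e)) (mem_inertia.2 ⟨_, inC_isoU e, 0, by rw [aElt_zero, mul_one]⟩)
  have h3 := hμ' (isoU e) 0 (inC_isoU e)
  rw [aElt_zero, mul_one, weightChar_zero, mul_one] at h3
  rw [h3, map_mul, End.mul_apply, hv.weight.apply_aElt, map_smul, map_smul, smul_comm] at h2
  have h5 := smul_right_injective V (weightChar_ne_zero _ t) h2
  rw [(hv.translate h c).apply_pProd _ (inC_isoU e)] at h5
  have h6 := smul_left_injective ℂ (hv.translate h c).ne_zero h5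
  have h7 : sgn (form e (isoU e) c) = sgn false :=
    (mul_eq_right₀ (hv.eps_ne_zero (inC_isoU e))).1 h6
  rw [inC, sgn_injective h7]
  rfl

/-- The degree is the index of `inertia a e`. -/
theorem finrank_mul_card (hv : IsGood ρ a τ e ε v) (h : HasLabels ρ a e) :
    finrank ℂ V * Nat.card {c // inC e c = true} = Nat.card K ^ 4 := by
  have : Finite (Matrix.GeneralLinearGroup Idx K) := inferInstance
  obtain ⟨μ, hμ, -⟩ := hv.exists_isStableVector h
  rw [hμ.finrank_eq_index h.irreducible, index_inertia]

/-- The character is determined by the labels and the scalars `ε`. -/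
theorem character_eq (hv : IsGood ρ a τ e ε v) (h : HasLabels ρ a e)
    (hw : IsGood ρ' a τ e ε' w) (h' : HasLabels ρ' a e) (hε : ∀ c, inC e c = true → ε c = ε' c) :
    ρ.character = ρ'.character := by
  have : Finite (Matrix.GeneralLinearGroup Idx K) := inferInstance
  have : Finite (Quattern K coreS) := inferInstance
  obtain ⟨μ, hμ, h1⟩ := hv.exists_isStableVector h
  obtain ⟨μ', hμ', h2⟩ := hw.exists_isStableVector h'
  refine hμ.character_congr h.irreducible hμ' h'.irreducible fun g hg => ?_
  obtain ⟨c, hc, t, rfl⟩ := mem_inertia.1 hg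
  rw [h1 c t hc, h2 c t hc, hε c hc]

/-- The scalars by which the radical of the form acts do not depend on the good vector. -/
theorem eps_eq_of_radical (hv : IsGood ρ a τ e ε v) (h : HasLabels ρ a e)
    (hv' : IsGood ρ a τ e ε' v') {r : Bits} (hr : inC e r = true) (hr' : ∀ c, form e r c = false) :
    ε r = ε' r := by
  have : Finite (Matrix.GeneralLinearGroup Idx K) := inferInstance
  have : Finite (Quattern K coreS) := inferInstance
  obtain ⟨μ, hμ, h1⟩ := hv.exists_isStableVector h
  obtain ⟨μ', hμ', h2⟩ := hv'.exists_isStableVector h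
  obtain ⟨g, hg⟩ := hμ.exists_conj h.irreducible hv'.ne_zero hμ'.apply_eq
  have hgw : IsWeightVector ρ (baseWeight a τ e) (ρ g v) := by
    intro n hn t
    have e1 : xb n t = pProd a (false, false, false) * aElt (Pi.single n t) := by
      rw [pProd_zero, one_mul, aElt_single hn]
    have h3 : xb n t ∈ inertia a e := mem_inertia.2 ⟨_, inC_zero e, _, e1⟩
    rw [hμ.apply_translate g h3, ← hg _ h3, e1, h2 _ _ (inC_zero e), hv'.eps_zero, one_mul,
      weightChar_single _ hn]
  have h4 : pProd a r ∈ inertia a e := mem_inertia.2 ⟨r, hr, 0, by rw [aElt_zero, mul_one]⟩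
  have h5 : ρ (pProd a r) (ρ g v) = ε' r • ρ g v := by
    have h6 := h2 r 0 hr
    rw [aElt_zero, mul_one, weightChar_zero, mul_one] at h6
    rw [hμ.apply_translate g h4, ← hg _ h4, h6]
  obtain ⟨c, t, rfl⟩ := hv.weight.exists_eq_pProd_mul_aElt
    (fun n hn => baseWeight_of_mem a τ e hn) hv.ne_zero hgw
  rw [map_mul, End.mul_apply, hv.weight.apply_aElt, map_smul, map_smul,
    (hv.translate h c).apply_pProd r hr, hr' c, smul_comm] at h5
  have h8 := smul_left_injective ℂ
    (smul_ne_zero (weightChar_ne_zero _ t) (hv.translate h c).ne_zero) h5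
  simpa [sgn] using h8

end IsGood

end Good

end Inertia

/-! ### Characters with given labels -/

section Characters

open Module

variable {K : Type*} [Field K] [CharP K 2]

/-- The linear character of `X_S` that is given by the simple coordinates and the coefficients
`k`. -/
def simpleChar (k : Fin 4 → K) : Quattern K coreS →* ℂ where
  toFun g := phi K (∑ i, k i * (simpleCoord g).toAdd i)
  map_one' := by simp [phi_zero]
  map_mul' g h := by
    rw [map_mul, toAdd_mul, ← phi_add, ← Finset.sum_add_distrib]
    simp only [Pi.add_apply, mul_add]

/-- There are linear characters of `X_S` with prescribed signs on the involutions `p₁, p₂, p₃`. -/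
theorem exists_sign_character (a : ALabel K) {τ : K} (hτ : phi K τ = -1) (d : Bits) :
    ∃ ν : Quattern K coreS →* ℂ, (∀ t, ν (aElt t) = 1) ∧
      ∀ c, ν (pProd a c) = sgn (bdot d c) := by
  have ha8 := a.a8.ne_zero
  have ha10 := a.a10.ne_zero
  have ha11 := a.a11.ne_zero
  have ha16 := a.a16.ne_zero
  refine ⟨simpleChar ![if d.1 then τ / ((a.a10 : K) ^ 2 * a.a11 / ((a.a8 : K) ^ 2 * a.a16)) else 0,
    if d.2.1 then τ / ((a.a16 : K) / (a.a10 : K) ^ 2) else 0,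
    if d.2.2 then τ / ((a.a8 : K) / a.a11) else 0, 0], fun t => ?_, fun c => ?_⟩
  · simp [simpleChar, simpleCoord_aElt, phi_zero]
  · have key : ∀ (b b' : Bool) {z : K}, z ≠ 0 →
        phi K ((if b then τ / z else 0) * (if b' then z else 0)) = sgn (b && b') := by
      intro b b' z hz
      cases b <;> cases b' <;> simp [phi_zero, sgn, div_mul_cancel₀ τ hz, hτ]
    change phi K (∑ i, _ * (simpleCoord (pProd a c)).toAdd i) = _
    rw [simpleCoord_pProd, toAdd_ofAdd, Fin.sum_univ_four, phi_add, phi_add, phi_add, bdot, sgn_xor,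
      sgn_xor]
    simp only [pvec, Matrix.cons_val, zero_mul, phi_zero, mul_one]
    rw [key _ _ (by simp [*]), key _ _ (by simp [*]), key _ _ (by simp [*])]

section Twist

variable {V V' : Type*} [AddCommGroup V] [Module ℂ V] [AddCommGroup V'] [Module ℂ V']
  {ρ : Representation ℂ (Quattern K coreS) V} {ρ' : Representation ℂ (Quattern K coreS) V'}
  {a : ALabel K} {τ : K} {e d : Bits} {ε : Bits → ℂ} {v : V} {ν : Quattern K coreS →* ℂ}

theorem twist_apply_xb (hν : ∀ t, ν (aElt t) = 1) {n : ℕ} (hn : n ∈ coreA) (t : K) (v : V) :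
    twist ν ρ (xb n t) v = ρ (xb n t) v := by
  rw [twist_apply, ← aElt_single hn, hν, one_smul]

theorem HasLabels.twist (h : HasLabels ρ a e) (hν : ∀ t, ν (aElt t) = 1) :
    HasLabels (twist ν ρ) a e where
  irreducible := twist_irreducible h.irreducible ν
  apply_center n hn t v := by
    have hA : ∀ n ∈ coreZ, n ∈ coreA := by decide
    rw [twist_apply_xb hν (hA n hn), h.apply_center n hn]
  apply_y5 v := by
    rw [mk_y5, twist_apply_xb hν (by decide), ← mk_y5, h.apply_y5]
  apply_y69 v := by
    rw [mk_y69, map_mul, End.mul_apply, twist_apply_xb hν (by decide),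
      twist_apply_xb hν (by decide), ← End.mul_apply, ← map_mul, ← mk_y69, h.apply_y69]
  apply_y7 v := by
    rw [mk_y7, twist_apply_xb hν (by decide), ← mk_y7, h.apply_y7]

theorem IsGood.twist (hv : IsGood ρ a τ e ε v) (hν : ∀ t, ν (aElt t) = 1)
    (hνd : ∀ c, ν (pProd a c) = sgn (bdot d c)) :
    IsGood (twist ν ρ) a τ e (fun c => sgn (bdot d c) * ε c) v where
  ne_zero := hv.ne_zero
  weight n hn t := by rw [twist_apply_xb hν hn, hv.weight n hn]
  apply_pProd c hc := by rw [twist_apply, hνd, hv.apply_pProd c hc, smul_smul]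

theorem IsGood.map (hv : IsGood ρ a τ e ε v) (f : ρ.Equiv ρ') : IsGood ρ' a τ e ε (f v) := by
  have hf : ∀ g w, f (ρ g w) = ρ' g (f w) := fun g w =>
    Representation.IntertwiningMap.isIntertwining ρ ρ' f.toIntertwiningMap g w
  refine ⟨fun h => hv.ne_zero ?_, fun n hn t => ?_, fun c hc => ?_⟩
  · exact f.toLinearEquiv.map_eq_zero_iff.1 h
  · rw [← hf, hv.weight n hn, map_smul]
  · rw [← hf, hv.apply_pProd c hc, map_smul]

end Twist

/-- The characters of the irreducible representations of `X_S` with labels `a` and `e`. -/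
def labelChars (a : ALabel K) (e : Bits) : Set (Quattern K coreS → ℂ) :=
  {χ | ∃ (m : ℕ) (ρ : Representation ℂ (Quattern K coreS) (Fin m → ℂ)),
    HasLabels ρ a e ∧ χ = ρ.character}

section Pairs

variable {V V' : Type*} [AddCommGroup V] [Module ℂ V] [AddCommGroup V'] [Module ℂ V']
  {ρ : Representation ℂ (Quattern K coreS) V} {ρ' : Representation ℂ (Quattern K coreS) V'}
  {a : ALabel K} {τ : K} {e : Bits} {ε ε' : Bits → ℂ} {v : V} {w : V'}

/-- On the isotropic subspace, `ε` is determined by its values at `isoU e` and `radW e`. -/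
theorem IsGood.eps_congr (hv : IsGood ρ a τ e ε v) (hw : IsGood ρ' a τ e ε' w)
    (he : e ≠ (false, false, false)) (hU : ε (isoU e) = ε' (isoU e))
    (hW : ε (radW e) = ε' (radW e)) {c : Bits} (hc : inC e c = true) : ε c = ε' c := by
  rcases inC_cases he hc with rfl | rfl | rfl | rfl
  · rw [hv.eps_zero, hw.eps_zero]
  · exact hU
  · exact hW
  · obtain ⟨z, hz, h1, h2⟩ := hv.eps_mul hw (inC_isoU e) (inC_radW e)
    rw [hU, hW, h2] at h1
    exact (mul_left_cancel₀ hz h1).symm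

/-- The value of `ε` at the radical is determined up to sign, because the square of
`pProd a (radW e)` is in the elementary abelian normal subgroup. -/
theorem IsGood.eps_radW (hv : IsGood ρ a τ e ε v) (hw : IsGood ρ' a τ e ε' w) :
    ε' (radW e) = ε (radW e) ∨ ε' (radW e) = -ε (radW e) := by
  obtain ⟨z, -, h1, h2⟩ := hv.eps_mul hw (inC_radW e) (inC_radW e)
  have h0 : badd (radW e) (radW e) = (false, false, false) := by simp [badd]
  rw [h0, hv.eps_zero] at h1
  rw [h0, hw.eps_zero, ← h1] at h2
  exact mul_self_eq_mul_self_iff.1 h2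

variable [Finite K]

/-- A good vector can be normalized at the isotropic vector outside the radical. -/
theorem IsGood.exists_normalized (hv : IsGood ρ a τ e ε v) (h : HasLabels ρ a e)
    (he : e ≠ (false, false, false)) :
    ∃ ε' v', IsGood ρ a τ e ε' v' ∧ ε' (isoU e) = 1 := by
  have h1 : ε (isoU e) * ε (isoU e) = 1 := by
    refine smul_left_injective ℂ hv.ne_zero ?_
    simp only
    rw [mul_smul, ← hv.apply_pProd _ (inC_isoU e), ← map_smul, ← hv.apply_pProd _ (inC_isoU e),
      ← End.mul_apply, ← map_mul, pProd_isoU_mul_self, map_one, End.one_apply, one_smul]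
  rcases mul_self_eq_one_iff.1 h1 with h1 | h1
  · exact ⟨ε, v, hv, h1⟩
  · obtain ⟨z, hz⟩ := exists_form_isoU he
    refine ⟨_, _, hv.translate h z, ?_⟩
    have hz' : form e (isoU e) z = true := by
      rw [← hz]
      clear * -
      revert e z
      decide
    simp [hz', h1, sgn]

end Pairs

/-- Good vectors can be normalized at `isoU e` by a translation; then the only invariant is the
scalar at the radical, which has two possible values. Twisting with a linear character interchanges
them. -/
theorem ncard_labelChars [Finite K] (a : ALabel K) {e : Bits} (he : e ≠ (false, false, false)) :
    (labelChars a e).ncard = 2 := by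
  have : Finite (Matrix.GeneralLinearGroup Idx K) := inferInstance
  have : Finite (Quattern K coreS) := inferInstance
  obtain ⟨τ, hτ⟩ := exists_phi_eq_neg_one (K := K)
  obtain ⟨m, ρ, h⟩ := exists_hasLabels a e
  obtain ⟨_, _, hv⟩ := h.exists_isGood hτ
  obtain ⟨ε, v, hv, hU⟩ := hv.exists_normalized h he
  obtain ⟨d, hdU, hdW⟩ := exists_bdot he
  obtain ⟨ν, hν, hνd⟩ := exists_sign_character a hτ d
  have h' := h.twist hν
  have hv' := hv.twist hν hνd
  rw [Set.ncard_eq_two]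
  refine ⟨ρ.character, (twist ν ρ).character, fun hχ => ?_, ?_⟩
  · -- the scalar by which the radical acts is an invariant of the representation
    obtain ⟨f⟩ := nonempty_equiv_of_character_eq h.irreducible h'.irreducible hχ
    have h1 := hv.eps_eq_of_radical h (hv'.map f) (inC_radW e) (form_radW e)
    simp only [hdW] at h1
    have h2 := hv.eps_ne_zero (inC_radW e)
    refine h2 ?_
    have h3 : sgn true = -1 := rfl
    rw [h3, neg_one_mul, eq_neg_iff_add_eq_zero, ← two_mul] at h1
    exact (mul_eq_zero.1 h1).resolve_left two_ne_zero
  · ext χ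
    constructor
    · rintro ⟨m', σ, hσ, rfl⟩
      obtain ⟨_, _, hw⟩ := hσ.exists_isGood hτ
      obtain ⟨ε', w, hw, hU'⟩ := hw.exists_normalized hσ he
      rcases hv.eps_radW hw with h1 | h1
      · exact Or.inl (hw.character_eq hσ hv h fun c hc =>
          hw.eps_congr hv he (hU'.trans hU.symm) h1 hc)
      · refine Or.inr (hw.character_eq hσ hv' h' fun c hc => hw.eps_congr hv' he ?_ ?_ hc)
        · simp [hU', hU, hdU, sgn]
        · simp [h1, hdW, sgn]
    · rintro (rfl | rfl)
      · exact ⟨m, ρ, h, rfl⟩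
      · exact ⟨m, _, h', rfl⟩

/-! ### The case of trivial signs -/

theorem bdot_injective {c d : Bits} (h : ∀ b, bdot c b = bdot d b) : c = d := by
  revert c d; decide

theorem bdot_badd_left (c d b : Bits) : bdot (badd c d) b = xor (bdot c b) (bdot d b) := by
  revert c d b; decide

theorem badd_badd_cancel (c d : Bits) : badd (badd c d) d = c := by
  revert c d; decide

section Trivial

variable {V : Type*} [AddCommGroup V] [Module ℂ V]
  {ρ : Representation ℂ (Quattern K coreS) V} {a : ALabel K} {τ : K} {v : V}

/-- If the signs `e` are trivial, then the form is zero, and the whole space is isotropic. -/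
theorem isGood_zero_iff {c : Bits} :
    IsGood ρ a τ (false, false, false) (fun d => sgn (bdot c d)) v ↔
      v ≠ 0 ∧ IsWeightVector ρ (baseWeight a τ (false, false, false)) v ∧
        ρ (p1 a) v = sgn c.1 • v ∧ ρ (p2 a) v = sgn c.2.1 • v ∧ ρ (p3 a) v = sgn c.2.2 • v := by
  have hC : ∀ d, inC (false, false, false) d = true := by decide
  constructor
  · intro h
    refine ⟨h.ne_zero, h.weight, ?_, ?_, ?_⟩
    · simpa [pProd, bdot] using h.apply_pProd (true, false, false) (hC _)
    · simpa [pProd, bdot] using h.apply_pProd (false, true, false) (hC _)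
    · simpa [pProd, bdot] using h.apply_pProd (false, false, true) (hC _)
  · rintro ⟨h0, hw, h1, h2, h3⟩
    refine ⟨h0, hw, fun d _ => ?_⟩
    have key : ∀ (g : Quattern K coreS) (b b' : Bool), ρ g v = sgn b • v →
        ρ (if b' then g else 1) v = sgn (b && b') • v := by
      intro g b b' h
      cases b'
      · simp [sgn]
      · simpa using h
    rw [pProd, map_mul, map_mul, End.mul_apply, End.mul_apply, key _ _ _ h3, map_smul,
      key _ _ _ h2, map_smul, map_smul, key _ _ _ h1, bdot, sgn_xor, sgn_xor, smul_smul, smul_smul]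
    congr 1
    ring

variable [Finite K]

/-- For trivial signs, the good vectors are the common eigenvectors of the three commuting
involutions. -/
theorem HasLabels.exists_isGood_sgn [FiniteDimensional ℂ V]
    (h : HasLabels ρ a (false, false, false)) (hτ : phi K τ = -1) :
    ∃ c v, IsGood ρ a τ (false, false, false) (fun d => sgn (bdot c d)) v := by
  obtain ⟨ε, v, hv⟩ := h.exists_isGood hτ
  have hC : ∀ d, inC (false, false, false) d = true := by decide
  have key : ∀ (g : Quattern K coreS) (z : ℂ), g * g = 1 → ρ g v = z • v →
      ∃ b, ρ g v = sgn b • v := by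
    intro g z hg hz
    have h1 : z * z = 1 := by
      refine smul_left_injective ℂ hv.ne_zero ?_
      simp only
      rw [mul_smul, ← hz, ← map_smul, ← hz, ← End.mul_apply, ← map_mul, hg, map_one,
        End.one_apply, one_smul]
    obtain ⟨b, hb⟩ := exists_sgn_eq (mul_self_eq_one_iff.1 h1)
    exact ⟨b, by rw [hz, hb]⟩
  obtain ⟨c1, h1⟩ := key (p1 a) _ (p1_mul_self a) (by
    simpa [pProd] using hv.apply_pProd (true, false, false) (hC _))
  obtain ⟨c2, h2⟩ := key (p2 a) _ (p2_mul_self a) (by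
    simpa [pProd] using hv.apply_pProd (false, true, false) (hC _))
  obtain ⟨c3, h3⟩ := key (p3 a) _ (xb_mul_self _ _) (by
    simpa [pProd] using hv.apply_pProd (false, false, true) (hC _))
  exact ⟨(c1, c2, c3), v, isGood_zero_iff.2 ⟨hv.ne_zero, hv.weight, h1, h2, h3⟩⟩

/-- All signs occur, by twisting with linear characters. -/
theorem exists_isGood_sgn (a : ALabel K) (hτ : phi K τ = -1) (c : Bits) :
    ∃ (m : ℕ) (ρ : Representation ℂ (Quattern K coreS) (Fin m → ℂ)) (v : Fin m → ℂ),
      HasLabels ρ a (false, false, false) ∧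
        IsGood ρ a τ (false, false, false) (fun d => sgn (bdot c d)) v := by
  obtain ⟨m, ρ, h⟩ := exists_hasLabels a (false, false, false)
  obtain ⟨c₀, v, hv⟩ := h.exists_isGood_sgn hτ
  obtain ⟨ν, hν, hνd⟩ := exists_sign_character a hτ (badd c c₀)
  refine ⟨m, twist ν ρ, v, h.twist hν, ?_⟩
  convert hv.twist hν hνd using 2 with d
  rw [← sgn_xor, ← bdot_badd_left, badd_badd_cancel]

end Trivial

end Characters

/-! ### The family `F_{7,2}` -/

section Family

open Module

variable {K : Type*} [Field K]

/-- The inflation to `U` of a class function of `X_S`. -/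
def inflate (χ : Quattern K coreS → ℂ) (u : U K) : ℂ := χ (QuotientGroup.mk u)

theorem inflate_injective : Function.Injective (inflate (K := K)) := by
  intro χ ψ h
  ext g
  obtain ⟨u, rfl⟩ := QuotientGroup.mk_surjective g
  exact congrFun h u

/-- The inflation to `U` of a representation of `X_S`. -/
def inflateRep {V : Type*} [AddCommGroup V] [Module ℂ V]
    (ρ : Representation ℂ (Quattern K coreS) V) : Representation ℂ (U K) V :=
  ρ.comp (QuotientGroup.mk' _)

theorem inflateRep_irreducible {V : Type*} [AddCommGroup V] [Module ℂ V]
    {ρ : Representation ℂ (Quattern K coreS) V} (h : ρ.IsIrreducible) :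
    (inflateRep ρ).IsIrreducible :=
  (comp_irreducible_iff (QuotientGroup.mk'_surjective _) ρ).2 h

theorem F72_subset_Irr : F72 K ⊆ Irr (U K) := by
  rintro _ ⟨χ, ⟨⟨m, ρ, hρ, hχ⟩, -⟩, rfl⟩
  exact ⟨m, inflateRep ρ, inflateRep_irreducible hρ, fun u => hχ _⟩

theorem character_eq_mul {G V : Type*} [Group G] [AddCommGroup V] [Module ℂ V]
    {ρ : Representation ℂ G V} {g : G} {z : ℂ} (h : ∀ v, ρ g v = z • v) :
    ρ.character g = z * ρ.character 1 := by
  have : ρ g = z • ρ 1 := LinearMap.ext fun v => by rw [h, map_one]; rfl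
  rw [Representation.character, this, map_smul, smul_eq_mul]
  rfl

theorem character_one_ne_zero {G V : Type*} [Group G] [AddCommGroup V] [Module ℂ V]
    [FiniteDimensional ℂ V] {ρ : Representation ℂ G V} (h : ρ.IsIrreducible) :
    ρ.character 1 ≠ 0 := by
  have := ((isIrreducible_iff ρ).1 h).1
  rw [Representation.char_one, Nat.cast_ne_zero]
  exact finrank_pos.ne'

theorem ALabel.ext_coeff {a a' : ALabel K} (h : ∀ n ∈ coreZ, a.coeff n = a'.coeff n) : a = a' := by
  have h8 : a.a8 = a'.a8 := Units.ext (h 8 (by decide))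
  have h10 : a.a10 = a'.a10 := Units.ext (h 10 (by decide))
  have h11 : a.a11 = a'.a11 := Units.ext (h 11 (by decide))
  have h16 : a.a16 = a'.a16 := Units.ext (h 16 (by decide))
  cases a
  cases a'
  simp_all

theorem card_ALabel : Nat.card (ALabel K) = (Nat.card K - 1) ^ 4 := by
  let f : ALabel K ≃ Kˣ × Kˣ × Kˣ × Kˣ :=
    { toFun := fun a => (a.a8, a.a10, a.a11, a.a16)
      invFun := fun t => ⟨t.1, t.2.1, t.2.2.1, t.2.2.2⟩
      left_inv := fun _ => rfl
      right_inv := fun _ => rfl }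
  rw [Nat.card_congr f, Nat.card_prod, Nat.card_prod, Nat.card_prod, Nat.card_units]
  ring

theorem eLabel_injective : Function.Injective eLabel := by decide

theorem eLabel_surjective : Function.Surjective eLabel := by decide

variable [CharP K 2] [Finite K]

theorem HasLabels.hasALabel_iff {V : Type*} [AddCommGroup V] [Module ℂ V] [FiniteDimensional ℂ V]
    {ρ : Representation ℂ (Quattern K coreS) V} {a : ALabel K} {e : Bits} (h : HasLabels ρ a e)
    (a' : ALabel K) : HasALabel (inflate ρ.character) a' ↔ a' = a := by
  have h1 : ∀ n ∈ coreZ, ∀ t : K, inflate ρ.character (x n t) =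
      inflate ρ.character 1 * phi K (a.coeff n * t) := fun n hn t =>
    (character_eq_mul (h.apply_center n hn t)).trans (mul_comm _ _)
  constructor
  · intro h'
    refine ALabel.ext_coeff fun n hn => eq_of_phi_mul_eq fun t => ?_
    exact mul_left_cancel₀ (character_one_ne_zero h.irreducible)
      ((h' n hn t).symm.trans (h1 n hn t))
  · rintro rfl
    exact h1

/-- The condition on the kernel says that the central weights are not zero; they form the label. -/
theorem exists_hasLabels_of_irreducible {V : Type*} [AddCommGroup V] [Module ℂ V]
    [FiniteDimensional ℂ V] {ρ : Representation ℂ (Quattern K coreS) V} (hρ : ρ.IsIrreducible)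
    (h : ∀ n ∈ coreZ, ∃ t : K, ρ.character (xb n t) ≠ ρ.character 1) :
    ∃ a e, HasLabels ρ a e := by
  have := ((isIrreducible_iff ρ).1 hρ).1
  obtain ⟨v, hv, b, hb⟩ := exists_isWeightVector ρ
  have h0 : ∀ n ∈ coreZ, b n ≠ 0 := by
    intro n hn hbn
    obtain ⟨t, ht⟩ := h n hn
    refine ht ((character_eq_mul (hb.apply_of_mem_coreZ hv hρ hn t)).trans ?_)
    rw [hbn, zero_mul, phi_zero, one_mul]
  let a : ALabel K := ⟨.mk0 _ (h0 8 (by decide)), .mk0 _ (h0 10 (by decide)),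
    .mk0 _ (h0 11 (by decide)), .mk0 _ (h0 16 (by decide))⟩
  obtain ⟨e5, h5⟩ := exists_sgn_eq (phi_eq_one_or (b 5 * ((a.a11 : K) / (a.a8 : K) ^ 2)))
  obtain ⟨e69, h69⟩ := exists_sgn_eq (phi_eq_one_or
    (b 6 * ((a.a8 : K) * a.a16 / ((a.a10 : K) ^ 2 * a.a11)) +
      b 9 * ((a.a8 : K) ^ 2 * a.a16 / ((a.a10 : K) ^ 2 * (a.a11 : K) ^ 2))))
  obtain ⟨e7, h7⟩ := exists_sgn_eq (phi_eq_one_or (b 7 * ((a.a10 : K) / a.a16)))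
  refine ⟨a, (e5, e69, e7), hasLabels_of_isWeightVector hρ hv hb (fun n hn => ?_) h5 h69 h7⟩
  simp only [coreZ, Finset.mem_insert, Finset.mem_singleton] at hn
  rcases hn with rfl | rfl | rfl | rfl <;> rfl

theorem mem_F72_iff {χ : U K → ℂ} :
    χ ∈ F72 K ↔ ∃ a e, ∃ ψ ∈ labelChars a e, inflate ψ = χ := by
  constructor
  · rintro ⟨ψ, ⟨⟨m, ρ, hρ, hψ⟩, hZ⟩, rfl⟩
    have hψ' : ψ = ρ.character := funext hψ
    subst hψ'
    obtain ⟨a, e, h⟩ := exists_hasLabels_of_irreducible hρ hZ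
    exact ⟨a, e, _, ⟨m, ρ, h, rfl⟩, rfl⟩
  · rintro ⟨a, e, _, ⟨m, ρ, h, rfl⟩, rfl⟩
    refine ⟨ρ.character, ⟨⟨m, ρ, h.irreducible, fun _ => rfl⟩, fun n hn => ?_⟩, rfl⟩
    by_contra! h1
    have h2 : a.coeff n = 0 := eq_zero_of_phi_mul_eq_one fun t => by
      have h3 := character_eq_mul (h.apply_center n hn t)
      exact mul_right_cancel₀ (character_one_ne_zero h.irreducible)
        (h3.symm.trans ((h1 t).trans (one_mul _).symm))
    simp only [coreZ, Finset.mem_insert, Finset.mem_singleton] at hn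
    rcases hn with rfl | rfl | rfl | rfl <;> exact Units.ne_zero _ h2

theorem F72At_eq (i : Fin 8) (a : ALabel K) : F72At K i a = inflate '' labelChars a (eLabel i) := by
  ext χ
  constructor
  · rintro ⟨h1, h2, h5, h69, h7⟩
    obtain ⟨a', e, ψ, ⟨m, ρ, h, rfl⟩, rfl⟩ := mem_F72_iff.1 h1
    obtain rfl := (h.hasALabel_iff a).1 h2
    refine ⟨_, ⟨m, ρ, ?_, rfl⟩, rfl⟩
    have key : ∀ {b b' : Bool}, sgn b * ρ.character 1 = sgn b' * ρ.character 1 → b = b' :=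
      fun h' => sgn_injective (mul_right_cancel₀ (character_one_ne_zero h.irreducible) h')
    have e5 := key ((character_eq_mul h.apply_y5).symm.trans h5)
    have e69 := key ((character_eq_mul h.apply_y69).symm.trans h69)
    have e7 := key ((character_eq_mul h.apply_y7).symm.trans h7)
    have : e = eLabel i := Prod.ext e5 (Prod.ext e69 e7)
    rwa [← this]
  · rintro ⟨_, ⟨m, ρ, h, rfl⟩, rfl⟩
    exact ⟨mem_F72_iff.2 ⟨a, _, _, ⟨m, ρ, h, rfl⟩, rfl⟩, (h.hasALabel_iff a).2 rfl,
      character_eq_mul h.apply_y5, character_eq_mul h.apply_y69, character_eq_mul h.apply_y7⟩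

theorem existsUnique_aLabel {i : Fin 8} {χ : U K → ℂ} (hχ : χ ∈ F72Sub K i) :
    ∃! a, HasALabel χ a := by
  obtain ⟨a, ha⟩ := Set.mem_iUnion.1 hχ
  rw [F72At_eq] at ha
  obtain ⟨_, ⟨m, ρ, h, rfl⟩, rfl⟩ := ha
  exact ⟨a, (h.hasALabel_iff a).2 rfl, fun a' h' => (h.hasALabel_iff a').1 h'⟩

/-- The index `i` runs through the triples of signs. -/
theorem F72_eq_iUnion : F72 K = ⋃ i, F72Sub K i := by
  ext χ
  simp only [Set.mem_iUnion, F72Sub, F72At_eq]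
  rw [mem_F72_iff]
  constructor
  · rintro ⟨a, e, ψ, h, rfl⟩
    obtain ⟨i, rfl⟩ := eLabel_surjective e
    exact ⟨i, a, ψ, h, rfl⟩
  · rintro ⟨i, a, ψ, h, rfl⟩
    exact ⟨a, _, ψ, h, rfl⟩

theorem F72At_disjoint {i j : Fin 8} {a a' : ALabel K} (h : i ≠ j ∨ a ≠ a') :
    Disjoint (F72At K i a) (F72At K j a') := by
  rw [Set.disjoint_left]
  rintro χ h1 h2
  obtain ⟨-, hA', h5', h69', h7'⟩ := h2
  rw [F72At_eq] at h1
  obtain ⟨_, ⟨m, ρ, h1, rfl⟩, rfl⟩ := h1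
  obtain rfl := (h1.hasALabel_iff a').1 hA'
  have key : ∀ {b b' : Bool}, sgn b * ρ.character 1 = sgn b' * ρ.character 1 → b = b' :=
    fun h' => sgn_injective (mul_right_cancel₀ (character_one_ne_zero h1.irreducible) h')
  have e5 := key ((character_eq_mul h1.apply_y5).symm.trans h5')
  have e69 := key ((character_eq_mul h1.apply_y69).symm.trans h69')
  have e7 := key ((character_eq_mul h1.apply_y7).symm.trans h7')
  have hij := eLabel_injective (Prod.ext e5 (Prod.ext e69 e7))
  rcases h with h | h
  · exact h hij
  · exact h rfl

theorem F72Sub_disjoint {i j : Fin 8} (h : i ≠ j) : Disjoint (F72Sub K i) (F72Sub K j) := by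
  simp only [F72Sub, Set.disjoint_iUnion_left, Set.disjoint_iUnion_right]
  exact fun a a' => F72At_disjoint (Or.inl h)

theorem ncard_F72Sub {i : Fin 8} {k : ℕ} (hk : k ≠ 0) (h : ∀ a, (F72At K i a).ncard = k) :
    (F72Sub K i).ncard = k * (Nat.card K - 1) ^ 4 := by
  have hfin : ∀ a, Finite (F72At K i a) := fun a =>
    Set.finite_of_ncard_ne_zero ((h a).trans_ne hk)
  have : Finite (ALabel K) := Nat.finite_of_card_ne_zero (by
    rw [card_ALabel]
    have := Finite.one_lt_card (α := K)
    exact pow_ne_zero _ (by omega))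
  have : Fintype (ALabel K) := Fintype.ofFinite _
  rw [F72Sub, ← Nat.card_coe_set_eq, Nat.card_congr (Set.unionEqSigmaOfDisjoint fun a a' haa' =>
    F72At_disjoint (Or.inr haa')), Nat.card_sigma]
  simp only [Nat.card_coe_set_eq, h]
  rw [Finset.sum_const, Finset.card_univ, ← Nat.card_eq_fintype_card, card_ALabel, smul_eq_mul,
    mul_comm]

/-- The degree is the index of the inertia group, whose image in `K⁴` has order `8` or `4`. -/
theorem degree_mul_card {i : Fin 8} {χ : U K → ℂ} (hχ : χ ∈ F72Sub K i) :
    χ 1 * (if i = 0 then 8 else 4 : ℕ) = (Nat.card K : ℂ) ^ 4 := by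
  obtain ⟨a, ha⟩ := Set.mem_iUnion.1 hχ
  rw [F72At_eq] at ha
  obtain ⟨_, ⟨m, ρ, h, rfl⟩, rfl⟩ := ha
  obtain ⟨τ, hτ⟩ := exists_phi_eq_neg_one (K := K)
  obtain ⟨ε, v, hv⟩ := h.exists_isGood hτ
  have h1 := hv.finrank_mul_card h
  have h0 : ∀ i, eLabel i = (false, false, false) ↔ i = 0 := by decide
  rw [card_inC] at h1
  simp only [h0] at h1
  have h2 : inflate ρ.character 1 = finrank ℂ (Fin m → ℂ) := Representation.char_one ρ
  rw [h2]
  exact_mod_cast h1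

theorem ncard_F72At {i : Fin 8} (hi : i ≠ 0) (a : ALabel K) : (F72At K i a).ncard = 2 := by
  have h0 : eLabel i ≠ (false, false, false) := by
    revert i; decide
  rw [F72At_eq, Set.ncard_image_of_injective _ inflate_injective, ncard_labelChars a h0]

/-- The `c`-labels of a character in terms of good vectors. -/
theorem HasLabels.hasCLabel_iff {m : ℕ} {ρ : Representation ℂ (Quattern K coreS) (Fin m → ℂ)}
    {a : ALabel K} (h : HasLabels ρ a (false, false, false)) (τ : K) (c : Bits) :
    HasCLabel (inflate ρ.character) a c ↔
      ∃ v, IsGood ρ a τ (false, false, false) (fun d => sgn (bdot c d)) v := by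
  have : Finite (Matrix.GeneralLinearGroup Idx K) := inferInstance
  have hA : ∀ n ∈ coreA, n ∈ ({5, 6, 7, 9} : Finset ℕ) ∨ n ∈ coreZ := by decide
  have hA' : ∀ n ∈ ({5, 6, 7, 9} : Finset ℕ), n ∈ coreA := by decide
  have hb : ∀ n ∈ ({5, 6, 7, 9} : Finset ℕ), baseWeight a τ (false, false, false) n = 0 := by
    intro n hn
    simp only [Finset.mem_insert, Finset.mem_singleton] at hn
    rcases hn with rfl | rfl | rfl | rfl <;> simp [baseWeight]
  constructor
  · rintro ⟨m', σ, hσ, hχ, v, hv, h0, hZ, h1, h2, h3⟩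
    obtain ⟨f⟩ := nonempty_equiv_of_character_eq (inflateRep_irreducible h.irreducible) hσ
      (funext hχ)
    have hf : ∀ u w, f (σ u w) = ρ (QuotientGroup.mk u) (f w) := fun u w =>
      Representation.IntertwiningMap.isIntertwining σ (inflateRep ρ) f.toIntertwiningMap u w
    refine ⟨f v, isGood_zero_iff.2 ⟨fun h => hv (f.toLinearEquiv.map_eq_zero_iff.1 h),
      fun n hn t => ?_, ?_, ?_, ?_⟩⟩
    · rcases hA n hn with hn | hn
      · rw [hb n hn, zero_mul, phi_zero, one_smul]
        exact (hf (x n t) v).symm.trans (by rw [h0 n hn])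
      · rw [baseWeight_of_mem _ _ _ hn]
        exact (hf (x n t) v).symm.trans (by rw [hZ n hn, map_smul])
    · exact (hf _ v).symm.trans (by rw [h1, map_smul])
    · exact (hf _ v).symm.trans (by rw [h2, map_smul])
    · exact (hf _ v).symm.trans (by rw [h3, map_smul])
  · rintro ⟨v, hv⟩
    obtain ⟨hv0, hw, h1, h2, h3⟩ := isGood_zero_iff.1 hv
    refine ⟨m, inflateRep ρ, inflateRep_irreducible h.irreducible, fun u => rfl, v, hv0,
      fun n hn t => ?_, fun n hn t => h.apply_center n hn t v, h1, h2, h3⟩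
    refine (hw n (hA' n hn) t).trans ?_
    rw [hb n hn, zero_mul, phi_zero, one_smul]

theorem existsUnique_cLabel {a : ALabel K} {χ : U K → ℂ} (hχ : χ ∈ F72At K 0 a) :
    ∃! c, HasCLabel χ a c := by
  rw [F72At_eq] at hχ
  obtain ⟨_, ⟨m, ρ, h, rfl⟩, rfl⟩ := hχ
  obtain ⟨τ, hτ⟩ := exists_phi_eq_neg_one (K := K)
  obtain ⟨c, v, hv⟩ := HasLabels.exists_isGood_sgn h hτ
  refine ⟨c, (HasLabels.hasCLabel_iff h τ c).2 ⟨v, hv⟩, fun c' hc' => ?_⟩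
  obtain ⟨w, hw⟩ := (HasLabels.hasCLabel_iff h τ c').1 hc'
  refine bdot_injective fun d => sgn_injective ?_
  exact hw.eps_eq_of_radical h hv (by revert d; decide) (form_zero d)

theorem existsUnique_F72At (a : ALabel K) (c : Bits) :
    ∃! χ, χ ∈ F72At K 0 a ∧ HasCLabel χ a c := by
  obtain ⟨τ, hτ⟩ := exists_phi_eq_neg_one (K := K)
  obtain ⟨m, ρ, v, h, hv⟩ := exists_isGood_sgn a hτ c
  rw [F72At_eq]
  refine ⟨_, ⟨⟨_, ⟨m, ρ, h, rfl⟩, rfl⟩, (h.hasCLabel_iff τ c).2 ⟨v, hv⟩⟩, ?_⟩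
  rintro _ ⟨⟨_, ⟨m', σ, h', rfl⟩, rfl⟩, hc⟩
  obtain ⟨w, hw⟩ := (HasLabels.hasCLabel_iff h' τ c).1 hc
  rw [IsGood.character_eq hw h' hv h fun _ _ => rfl]

theorem ncard_F72At_zero (a : ALabel K) : (F72At K 0 a).ncard = 8 := by
  choose f hf hf' using fun c => existsUnique_F72At a c
  choose g hg hg' using fun χ : F72At K 0 a => existsUnique_cLabel χ.2
  let E : F72At K 0 a ≃ Bits :=
    { toFun := g
      invFun := fun c => ⟨f c, (hf c).1⟩
      left_inv := fun χ => Subtype.ext (hf' _ _ ⟨χ.2, hg χ⟩).symm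
      right_inv := fun c => (hg' _ _ (hf c).2).symm }
  rw [← Nat.card_coe_set_eq, Nat.card_congr E, Nat.card_eq_fintype_card]
  rfl

end Family

/-! ### The cuspidal characters -/

/-- The `2`-part of a degree of the form `q⁴ m / (8 k)` with `m` and `k` odd. -/
theorem two_pow_factorization_mul {f d k m : ℕ} (hk : Odd k) (hm : Odd m)
    (h : d * (8 * k) = (2 ^ f) ^ 4 * m) : 2 ^ d.factorization 2 * 8 = (2 ^ f) ^ 4 := by
  have hd : d ≠ 0 := by
    rintro rfl
    rw [zero_mul] at h
    exact (mul_pos (by positivity) hm.pos).ne h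
  have h2 : ∀ {n : ℕ}, Odd n → n.factorization 2 = 0 := fun hn =>
    Nat.factorization_eq_zero_of_not_dvd hn.not_two_dvd_nat
  have h3 := congrArg (fun n => n.factorization 2) h
  have h8 : (8 : ℕ).factorization 2 = 3 := by
    rw [show (8 : ℕ) = 2 ^ 3 by norm_num, Nat.factorization_pow]
    simp [Nat.prime_two.factorization_self]
  rw [Nat.factorization_mul hd (mul_ne_zero (by norm_num) hk.pos.ne'),
    Nat.factorization_mul (by norm_num) hk.pos.ne', Nat.factorization_mul (by positivity)
    hm.pos.ne', ← pow_mul, Nat.factorization_pow] at h3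
  simp only [Finsupp.add_apply, Finsupp.smul_apply, h2 hk, h2 hm, h8,
    Nat.prime_two.factorization_self, smul_eq_mul] at h3
  rw [← pow_mul, show f * 4 = d.factorization 2 + 3 by omega, pow_add]
  norm_num

theorem card_eq_two_pow (K : Type*) [Field K] [Finite K] [CharP K 2] :
    ∃ f, f ≠ 0 ∧ Nat.card K = 2 ^ f := by
  have : Fintype K := Fintype.ofFinite K
  obtain ⟨n, -, hn⟩ := FiniteField.card K 2
  exact ⟨n, n.ne_zero, by rw [Nat.card_eq_fintype_card, hn]⟩

theorem two_part_of_cuspidal {K : Type*} [Field K] [Finite K] [CharP K 2] {ψ : F4 K → ℂ}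
    (h : IsF4I ψ ∨ IsF4II ψ) :
    ∃ d : ℕ, ψ 1 = d ∧ 2 ^ d.factorization 2 * 8 = Nat.card K ^ 4 := by
  obtain ⟨f, hf, hq⟩ := card_eq_two_pow K
  obtain ⟨r, hr⟩ : ∃ r, Nat.card K = r + 1 := Nat.exists_eq_add_one.2 Nat.card_pos
  have hev : Even (r + 1) := by
    rw [← hr, hq]
    exact (Nat.even_pow.2 ⟨even_two, hf⟩)
  have hodd : Odd r := by
    rcases Nat.even_or_odd r with h | h
    · exact absurd hev (Nat.not_even_iff_odd.2 h.add_one)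
    · exact h
  have hirr : ψ ∈ Irr (F4 K) := h.elim (·.1) (·.1)
  obtain ⟨d, ρ, -, hρ⟩ := hirr
  have hd : ψ 1 = d := by rw [hρ, Representation.char_one, Module.finrank_fin_fun]
  refine ⟨d, hd, ?_⟩
  -- in terms of `r = q - 1` no subtraction occurs, and the factors other than `q⁴` are odd
  have hodd1 : ∀ n : ℕ, Odd ((r + 1) * n + 1) := fun n => (hev.mul_right n).add_one
  have hcast : (Nat.card K : ℂ) = r + 1 := by rw [hr]; push_cast; ring
  rw [hq]
  rcases h with h | h
  · refine two_pow_factorization_mul (k := 1)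
      (m := r ^ 4 * ((r + 1) * (r + 2) + 1) ^ 2 * ((r + 1) * (r + 1) ^ 3 + 1) *
        ((r + 1) * ((r + 1) * (r * (r + 2))) + 1)) odd_one
      ((((hodd.pow).mul (hodd1 _).pow).mul (hodd1 _)).mul (hodd1 _)) ?_
    rw [← hq, hr]
    have h1 := hd.symm.trans h.2.2
    rw [hcast] at h1
    have h2 : (d : ℂ) * 8 = ((r + 1 : ℕ) : ℂ) ^ 4 * (r ^ 4 * ((r + 1) * (r + 2) + 1) ^ 2 *
        ((r + 1) * (r + 1) ^ 3 + 1) * ((r + 1) * ((r + 1) * (r * (r + 2))) + 1)) := by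
      rw [h1]
      push_cast
      ring
    rw [mul_one]
    exact_mod_cast h2
  · refine two_pow_factorization_mul (k := 3)
      (m := r ^ 4 * ((r + 1) * r + 1) ^ 2 * ((r + 1) * (r + 1) ^ 3 + 1) *
        ((r + 1) * ((r + 1) * (r * (r + 2))) + 1)) (by decide)
      ((((hodd.pow).mul (hodd1 _).pow).mul (hodd1 _)).mul (hodd1 _)) ?_
    rw [← hq, hr]
    have h1 := hd.symm.trans h.2.2
    rw [hcast] at h1
    have h2 : (d : ℂ) * (8 * 3) = ((r + 1 : ℕ) : ℂ) ^ 4 * (r ^ 4 * ((r + 1) * r + 1) ^ 2 *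
        ((r + 1) * (r + 1) ^ 3 + 1) * ((r + 1) * ((r + 1) * (r * (r + 2))) + 1)) := by
      rw [h1]
      push_cast
      ring
    exact_mod_cast h2

end UF4

end

theorem mainTheorem3 (K : Type*) [Field K] [Finite K] [CharP K 2] (q : ℕ) (hq : q = Nat.card K) :
    -- `(S, Z)` gives a quattern group of order `q¹²` and has the form `[4, 12, 9]`
    ((UF4.X K (Finset.Icc 1 24 \ UF4.coreS)).Normal ∧
      Nat.card (UF4.Quattern K UF4.coreS) = q ^ 12 ∧
      UF4.centralRoots K UF4.coreS = UF4.coreZ ∧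
      UF4.coreZ.card = 4 ∧ UF4.coreS.card = 12 ∧
      (UF4.nontrivialPairs K UF4.coreS).ncard = 9) ∧
    -- `F_{7,2}` consists of irreducible characters of `U` and is the disjoint union of the
    -- eight subfamilies
    (UF4.F72 K ⊆ UF4.Irr (UF4.U K) ∧
      UF4.F72 K = ⋃ i, UF4.F72Sub K i ∧
      ∀ i j, i ≠ j → Disjoint (UF4.F72Sub K i) (UF4.F72Sub K j)) ∧
    -- numbers and degrees
    ((UF4.F72Sub K 0).ncard = 8 * (q - 1) ^ 4 ∧
      (∀ χ ∈ UF4.F72Sub K 0, χ 1 = (q : ℂ) ^ 4 / 8) ∧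
      ∀ i, i ≠ 0 →
        (UF4.F72Sub K i).ncard = 2 * (q - 1) ^ 4 ∧
        ∀ χ ∈ UF4.F72Sub K i, χ 1 = (q : ℂ) ^ 4 / 4) ∧
    -- labels
    ((∀ i, ∀ χ ∈ UF4.F72Sub K i, ∃! a, UF4.HasALabel χ a) ∧
      (∀ a c, ∃! χ, χ ∈ UF4.F72At K 0 a ∧ UF4.HasCLabel χ a c) ∧
      (∀ a, ∀ χ ∈ UF4.F72At K 0 a, ∃! c, UF4.HasCLabel χ a c) ∧
      ∀ i, i ≠ 0 → ∀ a, (UF4.F72At K i a).ncard = 2) ∧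
    -- the cuspidal characters `F₄^I[1]` and `F₄^II[1]`
    (∀ ψ : UF4.F4 K → ℂ, UF4.IsF4I ψ ∨ UF4.IsF4II ψ →
      ∃ d : ℕ, ψ 1 = d ∧ ((2 ^ d.factorization 2 : ℕ) : ℂ) = (q : ℂ) ^ 4 / 8 ∧
        ∃ χ ∈ UF4.F72Sub K 0, χ 1 = ((2 ^ d.factorization 2 : ℕ) : ℂ)) := by
  subst hq
  have h8 : ∀ χ ∈ UF4.F72Sub K 0, χ 1 = (Nat.card K : ℂ) ^ 4 / 8 := fun χ hχ =>
    (eq_div_iff (by norm_num)).2 (by simpa using UF4.degree_mul_card hχ)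
  refine ⟨⟨UF4.X_coreN_normal, UF4.card_quattern, UF4.centralRoots_coreS, rfl, rfl, ?_⟩,
    ⟨UF4.F72_subset_Irr, UF4.F72_eq_iUnion, fun i j h => UF4.F72Sub_disjoint h⟩,
    ⟨UF4.ncard_F72Sub (by norm_num) UF4.ncard_F72At_zero, h8, fun i hi =>
      ⟨UF4.ncard_F72Sub (by norm_num) (UF4.ncard_F72At hi), fun χ hχ =>
        (eq_div_iff (by norm_num)).2 (by simpa [hi] using UF4.degree_mul_card hχ)⟩⟩,
    ⟨fun i χ hχ => UF4.existsUnique_aLabel hχ, UF4.existsUnique_F72At,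
      fun a χ hχ => UF4.existsUnique_cLabel hχ, fun i hi a => UF4.ncard_F72At hi a⟩,
    fun ψ hψ => ?_⟩
  · rw [UF4.nontrivialPairs_coreS, Set.ncard_coe_finset]
    rfl
  · obtain ⟨d, hd, h2⟩ := UF4.two_part_of_cuspidal hψ
    have hd8 : ((2 ^ d.factorization 2 : ℕ) : ℂ) = (Nat.card K : ℂ) ^ 4 / 8 :=
      (eq_div_iff (by norm_num)).2 (by exact_mod_cast h2)
    obtain ⟨χ, ⟨hχ, -⟩, -⟩ := UF4.existsUnique_F72At (K := K) ⟨1, 1, 1, 1⟩ (false, false, false)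
    have hχ' : χ ∈ UF4.F72Sub K 0 := Set.mem_iUnion.2 ⟨_, hχ⟩
    exact ⟨d, hd, hd8, χ, hχ', (h8 χ hχ').trans hd8.symm⟩
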